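/- Let $V$ be a real superspace of dimension $n|m$ with homogeneous basis $(e_A)$ and dual basis $(e^A)$; a tilde denotes parity. Let $p,q,r,s\ge 0$. An array of $p|q$ covectors on $V\oplus\mathbb R^{r|s}$ is written as a matrix with rows $p_A=(p_A{}^K)$ (indexed by the basis of $V$) and $w_F=(w_F{}^K)$ (indexed by the basis of $\mathbb R^{r|s}$); its columns $K$ are the $p$ even and $q$ odd covectors, and the entry in row $A$ (or $F$) and column $K$ has parity $\tilde A+\tilde K$ (or $\tilde F+\tilde K$). An array is admissible if, in its underlying real array, the $q$ odd covectors are linearly independent and so are the $s$ odd rows of $w$. A mixed form of codegree $p|q$ and additional degree $r|s$ on $V$ is a smooth function $\mathcal L(p,w)$ of admissible arrays (a function on a superdomain), with values in the one-dimensional space $\operatorname{Vol}V$ (trivialised by the basis), such that $$\mathcal L(ph,wh)=\mathcal L(p,w)\operatorname{Ber}h\quad(h\in GL(p|q)),\qquad \mathcal L(p+aw,gw)=\mathcal L(p,w)\operatorname{Ber}g\quad(g\in GL(r|s),\ a\in \mathrm{Mat}(n|m\times r|s)),$$ where $h,g,a$ are even supermatrices over arbitrary Grassmann algebras, and such that,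 for all columns $K,M$ and all rows $i,j$, where $z_i{}^K$ stands for $p_A{}^K$ or $w_F{}^K$, $$\frac{\partial^2\mathcal L}{\partial z_i{}^K\partial z_j{}^M}+(-1)^{\tilde\imath\tilde\jmath+(\tilde\imath+\tilde\jmath)\tilde M}\frac{\partial^2\mathcal L}{\partial z_j{}^K\partial z_i{}^M}=0 .$$ Let $\Lambda^{r|s}_{p|q}$ be the space of these forms. For homogeneous $u=u^Ae_A\in V$ and $\alpha=e^A\alpha_A\in V^*$ put $$e(\alpha)\mathcal L=(-1)^r\alpha_A\,w_{r+1}{}^K(-1)^{\tilde\alpha\tilde A}\frac{\partial\mathcal L}{\partial p_A{}^K},$$ $$e(u)\mathcal L=(-1)^ru^A\Bigl(p_A{}^{p+1}-(-1)^{\tilde B\tilde K}p_A{}^Kp_B{}^{p+1}\frac{\partial}{\partial p_B{}^K}-(-1)^{\tilde F\tilde K}p_A{}^Kw_F{}^{p+1}\frac{\partial}{\partial w_F{}^K}\Bigr)\mathcal L,$$ where $w_{r+1}$ is a new last even row of $w$, and $p+1$ denotes a new last even column. Let $\sigma=\sigma_{1|0}$ be the stability map, for which $\sigma\mathcal L$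 is the extension to all admissible arrays of $$\begin{pmatrix}p_1&p_2\\ w_{11}&w_{12}\\ w_{21}&w_{22}\end{pmatrix}\longmapsto\mathcal L\begin{pmatrix}p_1-p_2w_{22}^{-1}w_{21}\\ w_{11}-w_{12}w_{22}^{-1}w_{21}\end{pmatrix}\cdot w_{22},$$ where the entry $w_{22}$ in the last even row and the last even column is invertible. Then $e(\alpha)$ maps $\Lambda^{r|s}_{p|q}$ to $\Lambda^{r+1|s}_{p|q}$, $e(u)$ maps $\Lambda^{r|s}_{p|q}$ to $\Lambda^{r|s}_{p+1|q}$, for each $\mathcal L\in\Lambda^{r|s}_{p|q}$ the extension $\sigma\mathcal L$ exists as an element of $\Lambda^{r+1|s}_{p+1|q}$ and is unique, and on $\Lambda^{r|s}_{p|q}$, for all homogeneous $u,v\in V$ and $\alpha,\beta\in V^*$, $$e(u)e(v)+(-1)^{\tilde u\tilde v}e(v)e(u)=0,\qquad e(\alpha)e(\beta)+(-1)^{\tilde\alpha\tilde\beta}e(\beta)e(\alpha)=0,$$ $$e(u)e(\alpha)+(-1)^{\tilde\alpha\tilde u}e(\alpha)e(u)=\langle u,\alpha\rangle\,\sigma,\qquad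 \langle u,\alpha\rangle=u^A\alpha_A .$$ Moreover $\sigma$ is central: $\sigma e(u)=e(u)\sigma$ and $\sigma e(\alpha)=e(\alpha)\sigma$. -/

import Mathlib

open scoped ContDiff

noncomputable section

namespace MixedForms

/-! ## Signs and Grassmann algebras -/

/-- The sign `(-1)^i` of a parity `i`. -/
def sgn (i : ZMod 2) : ℝ := if i = 0 then 1 else -1

theorem eq_one_of_ne_zero {i : ZMod 2} (h : ¬ i = 0) : i = 1 := by
  revert i
  decide

/-- The Grassmann algebra over `ℝ` with one odd generator for each element of `O`. -/
abbrev Gr (O : Type) : Type := ExteriorAlgebra ℝ (O → ℝ)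

/-- The homogeneous part of parity `i` of a Grassmann algebra. -/
abbrev grPart (O : Type) (i : ZMod 2) : Submodule ℝ (Gr O) :=
  CliffordAlgebra.evenOdd (0 : QuadraticForm ℝ (O → ℝ)) i

/-- Coefficients of an element with respect to the monomials in the generators. -/
def grCoeff (O : Type) [Finite O] : Gr O ≃ₗ[ℝ] (Finset (Fin (Nat.card O)) → ℝ) :=
  (((Pi.basisFun ℝ O).reindex (Finite.equivFin O)).ExteriorAlgebra).equivFun

/-- A Grassmann algebra with finitely many generators is a finite-dimensional real vector space;
it is normed by the maximum of the coefficients (all norms on it are equivalent). -/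
instance grNormedAddCommGroup (O : Type) [Finite O] : NormedAddCommGroup (Gr O) :=
  NormedAddCommGroup.induced (Gr O) (Finset (Fin (Nat.card O)) → ℝ) (grCoeff O)
    (grCoeff O).injective

instance grNormedSpace (O : Type) [Finite O] : NormedSpace ℝ (Gr O) :=
  NormedSpace.induced ℝ (Gr O) (Finset (Fin (Nat.card O)) → ℝ) (grCoeff O)

/-- Supercommutativity of Grassmann algebras. -/
theorem gr_supercomm {O : Type} {i j : ZMod 2} {x y : Gr O}
    (hx : x ∈ grPart O i) (hy : y ∈ grPart O j) :
    x * y = ((-1 : ℤˣ) ^ (j * i)) • (y * x) := by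
  have h := CliffordAlgebra.map_mul_map_of_isOrtho_of_mem_evenOdd
    (QuadraticMap.Isometry.id (0 : QuadraticForm ℝ (O → ℝ)))
    (QuadraticMap.Isometry.id (0 : QuadraticForm ℝ (O → ℝ)))
    (fun a b => by simp [QuadraticMap.IsOrtho]) x y hx hy
  simpa [CliffordAlgebra.map_id] using h

theorem gr_odd_anticomm {O : Type} {x y : Gr O} (hx : x ∈ grPart O 1) (hy : y ∈ grPart O 1) :
    x * y = -(y * x) := by
  have h := gr_supercomm hx hy
  simpa using h

theorem gr_odd_sq {O : Type} {x : Gr O} (hx : x ∈ grPart O 1) : x * x = 0 := by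
  have h := gr_odd_anticomm hx hx
  have h2 : (2 : ℝ) • (x * x) = 0 := by
    rw [two_smul]
    nth_rewrite 1 [h]
    exact neg_add_cancel _
  exact (smul_eq_zero.mp h2).resolve_left two_ne_zero

/-- The even part of a Grassmann algebra is a commutative ring. -/
abbrev EvenGr (N : ℕ) : Type := CliffordAlgebra.even (0 : QuadraticForm ℝ (Fin N → ℝ))

instance evenGrCommRing (N : ℕ) : CommRing (EvenGr N) :=
  { (inferInstance : Ring (EvenGr N)) with
    mul_comm := fun a b => Subtype.ext (by
      have h := gr_supercomm (O := Fin N) (i := 0) (j := 0) a.2 b.2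
      simpa using h) }

/-- The augmentation of the Grassmann algebra with `N` generators (all generators go to `0`). -/
def grBody (N : ℕ) : Gr (Fin N) →ₐ[ℝ] ℝ := ExteriorAlgebra.algebraMapInv

/-! ## Functions on superdomains

A finite family `I` of coordinates with parities `π : I → ZMod 2` is fixed.  A function on a
superdomain with these coordinates is a function of the even coordinates with values in the
Grassmann algebra generated by the odd coordinates. -/

/-- The even coordinates. -/
abbrev EvenIdx {I : Type} (π : I → ZMod 2) : Type := {i : I // π i = 0}

/-- The odd coordinates. -/
abbrev OddIdx {I : Type} (π : I → ZMod 2) : Type := {i : I // π i = 1}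

/-- Functions `∑ f_S(x) ξ^S` of even coordinates `x` and odd coordinates `ξ`. -/
abbrev SuperFun {I : Type} (π : I → ZMod 2) : Type := (EvenIdx π → ℝ) → Gr (OddIdx π)

section SuperFun

variable {I : Type} [Fintype I] [DecidableEq I] {π : I → ZMod 2}

/-- Left multiplication by the coordinate `i`. -/
def coordMul (i : I) (F : SuperFun π) : SuperFun π := fun x =>
  if h : π i = 0 then x ⟨i, h⟩ • F x
  else ExteriorAlgebra.ι ℝ (Pi.single (⟨i, eq_one_of_ne_zero h⟩ : OddIdx π) (1 : ℝ)) * F x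

/-- The (left) partial derivative along the coordinate `i`. -/
def pderiv (i : I) (F : SuperFun π) : SuperFun π := fun x =>
  if h : π i = 0 then fderiv ℝ F x (Pi.single ⟨i, h⟩ 1)
  else CliffordAlgebra.contractLeft
    (LinearMap.proj (⟨i, eq_one_of_ne_zero h⟩ : OddIdx π) : Module.Dual ℝ (OddIdx π → ℝ)) (F x)

/-- A function of the coordinates `I`, regarded as a function of a larger family `J` of
coordinates; `f` sends each coordinate in `I` to the corresponding one in `J`. -/
def extend {J : Type} [Fintype J] [DecidableEq J] {π' : J → ZMod 2} (f : I → J)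
    (hf : ∀ i, π' (f i) = π i) (F : SuperFun π) : SuperFun π' := fun y =>
  ExteriorAlgebra.map
    (Fintype.linearCombination ℝ (fun i : OddIdx π =>
      (Pi.single (⟨f i.1, (hf i.1).trans i.2⟩ : OddIdx π') (1 : ℝ) : OddIdx π' → ℝ)))
    (F fun i => y ⟨f i.1, (hf i.1).trans i.2⟩)

/-- Points of the superspace with values in the Grassmann algebra with `N` generators: even
coordinates take even values and odd coordinates take odd values. -/
structure SPoint (N : ℕ) (π : I → ZMod 2) where
  val : I → Gr (Fin N)
  mem : ∀ i, val i ∈ grPart (Fin N) (π i)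

variable {N : ℕ}

/-- The underlying real point of a Grassmann-valued point. -/
def SPoint.body (z : SPoint N π) : EvenIdx π → ℝ := fun i => grBody N (z.val i.1)

/-- The nilpotent part of an even coordinate of a Grassmann-valued point. -/
def SPoint.soul (z : SPoint N π) (i : EvenIdx π) : Gr (Fin N) :=
  z.val i.1 - algebraMap ℝ (Gr (Fin N)) (z.body i)

/-- Substitution of the odd coordinates of `z` for the odd generators. -/
def SPoint.oddHom (z : SPoint N π) : Gr (OddIdx π) →ₐ[ℝ] Gr (Fin N) :=
  ExteriorAlgebra.lift ℝ ⟨Fintype.linearCombination ℝ (fun i : OddIdx π => z.val i.1), fun m => by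
    refine gr_odd_sq ?_
    rw [Fintype.linearCombination_apply]
    refine Submodule.sum_mem _ fun i _ => Submodule.smul_mem _ _ ?_
    have h := z.mem i.1
    rwa [i.2] at h⟩

/-- The value of a smooth function at a Grassmann-valued point, by Taylor expansion at the
underlying real point.  A product of more than `N` nilpotent even elements vanishes, so the terms
of order greater than `N` do not contribute. -/
def eval (F : SuperFun π) (z : SPoint N π) : Gr (Fin N) :=
  ∑ k ∈ Finset.range (N + 1), ((k.factorial : ℝ)⁻¹) • ∑ c : Fin k → EvenIdx π,
    z.oddHom (iteratedFDeriv ℝ k F z.body (fun j => Pi.single (c j) 1)) *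
      (List.ofFn fun j => z.soul (c j)).prod

end SuperFun

/-! ## Even supermatrices and the Berezinian -/

/-- Even matrices over the Grassmann algebra with `N` generators, with rows of parities `ρ` and
columns of parities `κ`: the entry `(i, j)` has parity `ρ i + κ j`. -/
abbrev SMat (N : ℕ) {R C : Type} (ρ : R → ZMod 2) (κ : C → ZMod 2) : Type :=
  SPoint N (fun ij : R × C => ρ ij.1 + κ ij.2)

section SMat

variable {N : ℕ} {R S C : Type} {ρ : R → ZMod 2} {τ : S → ZMod 2} {κ : C → ZMod 2}

/-- The underlying matrix. -/
def SMat.toMatrix (M : SMat N ρ κ) : Matrix R C (Gr (Fin N)) := fun i j => M.val (i, j)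

theorem mul_mem_grPart {a b c : ZMod 2} {x y : Gr (Fin N)} (hx : x ∈ grPart (Fin N) (a + b))
    (hy : y ∈ grPart (Fin N) (b + c)) : x * y ∈ grPart (Fin N) (a + c) := by
  have h : x * y ∈ grPart (Fin N) ((a + b) + (b + c)) := SetLike.mul_mem_graded hx hy
  have e : ∀ a b c : ZMod 2, (a + b) + (b + c) = a + c := by decide
  rwa [e a b c] at h

/-- The product of even supermatrices. -/
def SMat.mul [Fintype S] (M : SMat N ρ τ) (M' : SMat N τ κ) : SMat N ρ κ where
  val ij := (M.toMatrix * M'.toMatrix) ij.1 ij.2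
  mem ij := by
    rw [Matrix.mul_apply]
    exact Submodule.sum_mem _ fun k _ => mul_mem_grPart (M.mem (ij.1, k)) (M'.mem (k, ij.2))

end SMat

/-- Indices of dimension `a|b`: `a` even ones followed by `b` odd ones. -/
abbrev Idx (a b : ℕ) : Type := Fin a ⊕ Fin b

/-- The parity of an index. -/
def par {a b : ℕ} : Idx a b → ZMod 2 := Sum.elim (fun _ => 0) (fun _ => 1)

section Ber

variable {N a b : ℕ}

/-- An element of the even part, from an element whose parity is known to be zero. -/
def mkEven {i : ZMod 2} (hi : i = 0) (x : Gr (Fin N)) (hx : x ∈ grPart (Fin N) i) : EvenGr N :=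
  ⟨x, by subst hi; exact hx⟩

theorem coe_mem_grPart (x : EvenGr N) {i : ZMod 2} (hi : i = 0) :
    (x : Gr (Fin N)) ∈ grPart (Fin N) i := by
  subst hi
  exact x.2

/-- The even-even block. -/
def evenBlock (g : SMat N (par (a := a) (b := b)) (par (a := a) (b := b))) :
    Matrix (Fin a) (Fin a) (EvenGr N) := fun i j =>
  mkEven (add_zero 0) (g.val (Sum.inl i, Sum.inl j)) (g.mem (Sum.inl i, Sum.inl j))

/-- The odd-odd block. -/
def oddBlock (g : SMat N (par (a := a) (b := b)) (par (a := a) (b := b))) :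
    Matrix (Fin b) (Fin b) (EvenGr N) := fun i j =>
  mkEven (by decide : (1 : ZMod 2) + 1 = 0) (g.val (Sum.inr i, Sum.inr j))
    (g.mem (Sum.inr i, Sum.inr j))

/-- The matrix `g₀₁ g₁₁⁻¹ g₁₀`, where `g_{ij}` are the blocks of `g`. -/
def schurCorrection (g : SMat N (par (a := a) (b := b)) (par (a := a) (b := b))) :
    Matrix (Fin a) (Fin a) (EvenGr N) := fun i j =>
  mkEven (add_zero 0)
    (∑ k, ∑ l, g.val (Sum.inl i, Sum.inr k) * ((oddBlock g)⁻¹ k l : Gr (Fin N)) *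
      g.val (Sum.inr l, Sum.inl j))
    (Submodule.sum_mem _ fun k _ => Submodule.sum_mem _ fun l _ =>
      mul_mem_grPart (b := 1)
        (mul_mem_grPart (b := 1) (g.mem (Sum.inl i, Sum.inr k)) (coe_mem_grPart _ (by decide)))
        (g.mem (Sum.inr l, Sum.inl j)))

/-- The Berezinian `det (g₀₀ - g₀₁ g₁₁⁻¹ g₁₀) · (det g₁₁)⁻¹` of an invertible even
supermatrix `g` with blocks `g_{ij}`. -/
def ber (g : SMat N (par (a := a) (b := b)) (par (a := a) (b := b))) : EvenGr N :=
  (evenBlock g - schurCorrection g).det * Ring.inverse (oddBlock g).det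

end Ber

/-! ## Mixed forms

Let `V` be a superspace of dimension `n|m` with a homogeneous basis.  An array of `p|q` covectors
on `V ⊕ ℝ^{r|s}` is a matrix `(p_A^K ; w_F^K)` whose columns are the covectors; the rows `A` are
indexed by the basis of `V` and the rows `F` by the basis of `ℝ^{r|s}`.  The space `Vol V` is
one-dimensional, spanned by the volume form of the basis, so a `Vol V`-valued function is given by
its coefficient. -/

/-- Row indices: `n|m` rows `A` (the `p`-part) and `r|s` rows `F` (the `w`-part). -/
abbrev Row (n m r s : ℕ) : Type := Idx n m ⊕ Idx r s

/-- The parity of a row. -/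
def rowPar {n m r s : ℕ} : Row n m r s → ZMod 2 := Sum.elim par par

/-- The parity of the coordinate in a given row and column. -/
abbrev coordPar (n m r s p q : ℕ) : Row n m r s × Idx p q → ZMod 2 :=
  fun ij => rowPar ij.1 + par ij.2

/-- Functions of an array of `p|q` covectors on `V ⊕ ℝ^{r|s}`. -/
abbrev MixedFun (n m r s p q : ℕ) : Type := SuperFun (coordPar n m r s p q)

/-- The entry at an odd row (of `V` or of `ℝ^{r|s}`) and an odd column, an even coordinate. -/
def oddEntry {n m r s p q : ℕ} (x : EvenIdx (coordPar n m r s p q) → ℝ)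
    (i : Fin m ⊕ Fin s) (k : Fin q) : ℝ :=
  x ⟨(Sum.map Sum.inr Sum.inr i, Sum.inr k), by cases i <;> rfl⟩

/-- The real points over which forms are defined: the odd covectors are linearly
independent, and so are the odd rows of `w`. -/
def admissible (n m r s p q : ℕ) : Set (EvenIdx (coordPar n m r s p q) → ℝ) :=
  {x | LinearIndependent ℝ (fun (k : Fin q) (i : Fin m ⊕ Fin s) => oddEntry x i k) ∧
    LinearIndependent ℝ (fun (f : Fin s) (k : Fin q) => oddEntry x (Sum.inr f) k)}

/-- The array `(p + a w ; g w)` obtained from the array `z = (p ; w)`. -/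
def leftAct {n m r s p q N : ℕ} (a : SMat N (par (a := n) (b := m)) (par (a := r) (b := s)))
    (g : SMat N (par (a := r) (b := s)) (par (a := r) (b := s)))
    (z : SPoint N (coordPar n m r s p q)) : SPoint N (coordPar n m r s p q) where
  val
    | (Sum.inl A, K) => z.val (Sum.inl A, K) + ∑ F, a.val (A, F) * z.val (Sum.inr F, K)
    | (Sum.inr F, K) => ∑ G, g.val (F, G) * z.val (Sum.inr G, K)
  mem := by
    rintro ⟨A | F, K⟩
    · exact Submodule.add_mem _ (z.mem (Sum.inl A, K)) (Submodule.sum_mem _ fun F _ =>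
        mul_mem_grPart (a.mem (A, F)) (z.mem (Sum.inr F, K)))
    · exact Submodule.sum_mem _ fun G _ => mul_mem_grPart (g.mem (F, G)) (z.mem (Sum.inr G, K))

/-- `IsMixedForm n m r s p q L`: the function `L` is a mixed form on `V` of codegree `p|q` and
additional degree `r|s`.  Identities for elements of supergroups are understood for points with
values in arbitrary Grassmann algebras. -/
structure IsMixedForm (n m r s p q : ℕ) (L : MixedFun n m r s p q) : Prop where
  smooth : ContDiffOn ℝ ∞ L (admissible n m r s p q)
  /-- `L(p h, w h) = L(p, w) Ber h` for `h ∈ GL(p|q)`. -/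
  right_equivariant : ∀ (N : ℕ) (z : SPoint N (coordPar n m r s p q))
    (h : SMat N (par (a := p) (b := q)) (par (a := p) (b := q))),
    z.body ∈ admissible n m r s p q → IsUnit h.toMatrix →
    eval L (SMat.mul z h) = eval L z * (ber h : Gr (Fin N))
  /-- `L(p + a w, g w) = L(p, w) Ber g` for `g ∈ GL(r|s)` and all even matrices `a`. -/
  left_equivariant : ∀ (N : ℕ) (z : SPoint N (coordPar n m r s p q))
    (a : SMat N (par (a := n) (b := m)) (par (a := r) (b := s)))
    (g : SMat N (par (a := r) (b := s)) (par (a := r) (b := s))),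
    z.body ∈ admissible n m r s p q → IsUnit g.toMatrix →
    eval L (leftAct a g z) = eval L z * (ber g : Gr (Fin N))
  /-- The second-order equations, for all pairs of rows `i`, `j` (two `p`-rows, a `p`-row and a
  `w`-row, or two `w`-rows) and all columns `K`, `M`. -/
  equations : ∀ (i j : Row n m r s) (K M : Idx p q), ∀ x ∈ admissible n m r s p q,
    pderiv (i, K) (pderiv (j, M) L) x +
      sgn (rowPar i * rowPar j + (rowPar i + rowPar j) * par M) •
        pderiv (j, K) (pderiv (i, M) L) x = 0

/-! ## The operators -/

/-- The columns `1, …, p|q` among the columns `1, …, p+1|q`. -/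
def oldCol {p q : ℕ} : Idx p q → Idx (p + 1) q := Sum.map Fin.castSucc id

/-- The new last even column. -/
def newCol {p q : ℕ} : Idx (p + 1) q := Sum.inl (Fin.last p)

/-- The old rows among the rows for `r+1|s`. -/
def oldRow {n m r s : ℕ} : Row n m r s → Row n m (r + 1) s :=
  Sum.map id (Sum.map Fin.castSucc id)

/-- The new last even `w`-row. -/
def newRow {n m r s : ℕ} : Row n m (r + 1) s := Sum.inr (Sum.inl (Fin.last r))

theorem par_oldCol {p q : ℕ} (K : Idx p q) : par (oldCol K) = par K := by
  cases K <;> rfl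

theorem rowPar_oldRow {n m r s : ℕ} (i : Row n m r s) : rowPar (oldRow i) = rowPar i := by
  rcases i with A | (f | f) <;> rfl

/-- `L` as a function of arrays with one more even column (on which it does not depend). -/
def addCol {n m r s p q : ℕ} (L : MixedFun n m r s p q) : MixedFun n m r s (p + 1) q :=
  extend (fun iK : Row n m r s × Idx p q => (iK.1, oldCol iK.2))
    (fun iK => by rw [coordPar, coordPar, par_oldCol]) L

/-- `L` as a function of arrays with one more even `w`-row (on which it does not depend). -/
def addRow {n m r s p q : ℕ} (L : MixedFun n m r s p q) : MixedFun n m (r + 1) s p q :=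
  extend (fun iK : Row n m r s × Idx p q => (oldRow iK.1, iK.2))
    (fun iK => by rw [coordPar, coordPar, rowPar_oldRow]) L

section Operators

variable {n m r s p q : ℕ} {V : Type*} [AddCommGroup V] [Module ℝ V]

/-- The operator `e(u)`, for a vector `u = u^A e_A`:
`(-1)^r u^A (p_A^{p+1} - (-1)^{BK} p_A^K p_B^{p+1} ∂/∂p_B^K
  - (-1)^{FK} p_A^K w_F^{p+1} ∂/∂w_F^K) L`;
the sum over `j` runs over the rows `B` of `p` and the rows `F` of `w`. -/
def eVec (b : Module.Basis (Idx n m) ℝ V) (u : V) (L : MixedFun n m r s p q) :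
    MixedFun n m r s (p + 1) q :=
  ((-1 : ℝ) ^ r) • ∑ A : Idx n m, b.repr u A •
    (coordMul (Sum.inl A, newCol) (addCol L) -
      ∑ j : Row n m r s, ∑ K : Idx p q, sgn (rowPar j * par K) •
        coordMul (Sum.inl A, oldCol K) (coordMul (j, newCol)
          (pderiv (j, oldCol K) (addCol L))))

/-- `α` is a covector of parity `i` on the superspace with homogeneous parts `𝒱 0`, `𝒱 1`. -/
def CovectorOfParity (𝒱 : ZMod 2 → Submodule ℝ V) (i : ZMod 2) (α : Module.Dual ℝ V) : Prop :=
  ∀ k, k ≠ i → ∀ x ∈ 𝒱 k, α x = 0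

/-- The operator `e(α)`, for a covector `α` of parity `i` with components `α_A = α(e_A)`:
`(-1)^r α_A w_{r+1}^K (-1)^{i A} ∂L/∂p_A^K`. -/
def eCov (b : Module.Basis (Idx n m) ℝ V) (i : ZMod 2) (α : Module.Dual ℝ V)
    (L : MixedFun n m r s p q) : MixedFun n m (r + 1) s p q :=
  ((-1 : ℝ) ^ r) • ∑ A : Idx n m, ∑ K : Idx p q, (α (b A) * sgn (i * par A)) •
    coordMul (newRow, K) (pderiv (Sum.inl A, K) (addRow L))

end Operators

/-! ## The stability isomorphism `σ_{1|0}` -/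

/-- For an array with blocks `(p₁ p₂ ; w₁₁ w₁₂ ; w₂₁ w₂₂)`, where the last even column is
`(p₂ ; w₁₂ ; w₂₂)` and the last even row is `(w₂₁ w₂₂)`, the array
`(p₁ - p₂ c w₂₁ ; w₁₁ - w₁₂ c w₂₁)`.  It is used with `c = w₂₂⁻¹`. -/
def reduceArray {n m r s p q N : ℕ} (z : SPoint N (coordPar n m (r + 1) s (p + 1) q))
    (c : EvenGr N) : SPoint N (coordPar n m r s p q) where
  val iK := z.val (oldRow iK.1, oldCol iK.2) -
    z.val (oldRow iK.1, newCol) * (c : Gr (Fin N)) * z.val (newRow, oldCol iK.2)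
  mem iK := by
    have h0 : z.val (oldRow iK.1, oldCol iK.2) ∈
        grPart (Fin N) (rowPar (oldRow iK.1) + par (oldCol iK.2)) :=
      z.mem (oldRow iK.1, oldCol iK.2)
    have h1 : z.val (oldRow iK.1, newCol) ∈ grPart (Fin N) (rowPar (oldRow iK.1) + 0) :=
      z.mem (oldRow iK.1, newCol)
    have h2 : (c : Gr (Fin N)) ∈ grPart (Fin N) (0 + 0) := coe_mem_grPart c (add_zero 0)
    have h3 : z.val (newRow, oldCol iK.2) ∈ grPart (Fin N) (0 + par (oldCol iK.2)) :=
      z.mem (newRow, oldCol iK.2)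
    have h := Submodule.sub_mem _ h0 (mul_mem_grPart (mul_mem_grPart h1 h2) h3)
    rw [rowPar_oldRow, par_oldCol] at h
    exact h

/-- The formula for `σ = σ_{1|0}`: on all arrays whose corner entry `w₂₂` is invertible,
`L'(p₁ p₂ ; w₁₁ w₁₂ ; w₂₁ w₂₂) = L(p₁ - p₂ w₂₂⁻¹ w₂₁ ; w₁₁ - w₁₂ w₂₂⁻¹ w₂₁) · w₂₂`. -/
def SigmaFormula {n m r s p q : ℕ} (L : MixedFun n m r s p q)
    (L' : MixedFun n m (r + 1) s (p + 1) q) : Prop :=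
  ∀ (N : ℕ) (z : SPoint N (coordPar n m (r + 1) s (p + 1) q)) (c : EvenGr N),
    z.body ∈ admissible n m (r + 1) s (p + 1) q →
    (c : Gr (Fin N)) * z.val (newRow, newCol) = 1 →
    eval L' z = eval L (reduceArray z c) * z.val (newRow, newCol)

open Classical in
/-- The stability map `σ = σ_{1|0}`: the extension to all admissible arguments, as a mixed
form, of the function given by `SigmaFormula`. -/
def sigma {n m r s p q : ℕ} (L : MixedFun n m r s p q) : MixedFun n m (r + 1) s (p + 1) q :=
  if h : ∃ L', IsMixedForm n m (r + 1) s (p + 1) q L' ∧ SigmaFormula L L' then h.choose else 0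

end MixedForms

end

/-!
The proof works with the functor of points. A smooth function on a superdomain is determined by its
values `eval F z` at Grassmann-valued points (`eq_zero_of_eval`), these values obey the chain rule
(`hasDerivAt_eval`), and odd vectors and covectors become even ones after multiplication with
auxiliary odd parameters, which do no harm because a new generator annihilates nothing in the old
Grassmann algebra (`exists_faithful_multiplier`, `eq_zero_of_prod_mul_eval`). All signs are thereby
absorbed into products in Grassmann algebras.

In this language the second-order equations say that the second differential on directions of rank
one, `d²L(ζ ⊗ y, ζ' ⊗ y')`, is skew-symmetric in `y` and `y'` (`IsPreForm.d2Eval_swap`); conversely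
its vanishing for equal directions `ζ ⊗ y` implies the equations (`IsPreForm.of_d2Eval`). Hence `L`
is affine in directions of rank one (`IsPreForm.eval_add_outer`), and for an array `(z ζ ; y e)` with
one more column and one more row the expression `L(z - ζ e⁻¹ y) e` extends to the polynomial
expression `e L(z) - dL(z; ζ ⊗ y)`, the bordered value (`bordered`). Up to sign, the three operators
are

* `σ L`: the bordered value for the new column and the new row of `w` (`eval_sigmaFun`),
* `e(u) L`: the bordered value for the new column and the row `u^A p_A` (`mul_eval_eVec`),
* `e(α) L`: the derivative of `L` in the direction `α ⊗ w_{r+1}` (`mul_eval_eCov`).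

Equivariance. An invertible supermatrix of size `k+1|l` is a product of invertible ones of size
`k|l`, scalings of the last even coordinate and unipotent bordered ones (`BorderGenerators.mem`), so
the behaviour under each of these suffices. For the first kind it is the equivariance of `L`, the
scalings are immediate, and the unipotent ones are covered by the vanishing of the second
differential on directions with a common factor and by the infinitesimal equivariance
`dL(z; zc ⊗ y) = (yc) L(z)`, which follows from the Berezinian of `1 + c ⊗ y` on single
coordinates (`ber_elementary`, `IsMixedForm.dEval_outer_mulVec`, `IsMixedForm.dEval_outer_wVec`).
The second-order equations of the new functions say that these are affine in directions of rank one,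
which is visible from the formulas (`IsPreForm.borderedAt_affine`, `IsPreForm.dEval_affine`).

Relations. The compositions `e(u) e(v)`, `σ e(u)` and `e(u) σ` are values of `L` bordered twice,
which are skew-symmetric in the two rows (`IsPreForm.bordered₂_swap`); `σ e(α)` and `e(α) σ` are
mixed bordered derivatives with the same symmetry (`IsPreForm.borderedDeriv_swap`); `e(α) e(β)` is a
second differential. In `e(α) e(u)` the row `u^A p_A` is differentiated as well, which contributes
the contraction `⟨u, α⟩` times the bordered value `σ L`. The extension `σ L` is unique because the
arrays with invertible corner entry `w₂₂` are dense (`eqOn_of_sigmaFormula`).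
-/

set_option linter.unusedSectionVars false

noncomputable section

namespace MixedForms

/-! ### Signs, parities and nilpotents in Grassmann algebras -/

@[simp] theorem sgn_zero : sgn 0 = 1 := rfl

@[simp] theorem sgn_one : sgn 1 = -1 := rfl

theorem sgn_mul_self (i : ZMod 2) : sgn i * sgn i = 1 := by
  by_cases h : i = 0 <;> simp [sgn, h]

theorem sgn_add (i j : ZMod 2) : sgn (i + j) = sgn i * sgn j := by
  have key : ∀ i j : ZMod 2, i = 0 ∧ j = 0 ∨ i = 0 ∧ j = 1 ∨ i = 1 ∧ j = 0 ∨ i = 1 ∧ j = 1 := by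
    decide
  have h2 : (1 : ZMod 2) + 1 = 0 := by decide
  rcases key i j with ⟨rfl, rfl⟩ | ⟨rfl, rfl⟩ | ⟨rfl, rfl⟩ | ⟨rfl, rfl⟩ <;> simp [h2]

theorem gr_mul_comm_sgn {O : Type} {i j : ZMod 2} {x y : Gr O}
    (hx : x ∈ grPart O i) (hy : y ∈ grPart O j) : x * y = sgn (i * j) • (y * x) := by
  rw [gr_supercomm hx hy]
  have key : ∀ i : ZMod 2, i = 0 ∨ i = 1 := by decide
  rcases key i with rfl | rfl <;> rcases key j with rfl | rfl <;> simp

theorem ι_mem_grPart {O : Type} (v : O → ℝ) : ExteriorAlgebra.ι ℝ v ∈ grPart O 1 :=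
  CliffordAlgebra.ι_mem_evenOdd_one _ v

theorem algebraMap_mem_grPart {O : Type} (r : ℝ) : algebraMap ℝ (Gr O) r ∈ grPart O 0 :=
  SetLike.algebraMap_mem_graded (CliffordAlgebra.evenOdd (0 : QuadraticForm ℝ (O → ℝ))) r

theorem one_mem_grPart {O : Type} : (1 : Gr O) ∈ grPart O 0 := by
  simpa using algebraMap_mem_grPart (O := O) 1

theorem gr_mul_mem {O : Type} {i j : ZMod 2} {x y : Gr O}
    (hx : x ∈ grPart O i) (hy : y ∈ grPart O j) : x * y ∈ grPart O (i + j) :=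
  SetLike.mul_mem_graded hx hy

/-- Induction by left multiplication with generators. -/
theorem gr_induction {O : Type} {P : Gr O → Prop} (h0 : ∀ r : ℝ, P (algebraMap ℝ (Gr O) r))
    (h1 : ∀ x y, P x → P y → P (x + y)) (h2 : ∀ v x, P x → P (ExteriorAlgebra.ι ℝ v * x))
    (x : Gr O) : P x :=
  CliffordAlgebra.left_induction (P := P) (0 : QuadraticForm ℝ (O → ℝ)) h0 h1
    (fun x v hx => h2 v x hx) x

/-- Even elements are central, also with respect to inhomogeneous elements. -/
theorem gr_even_comm {O : Type} {c : Gr O} (hc : c ∈ grPart O 0) (x : Gr O) : c * x = x * c := by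
  induction x using ExteriorAlgebra.induction with
  | algebraMap r => exact (Algebra.commutes r c).symm
  | ι v => simpa using gr_mul_comm_sgn hc (ι_mem_grPart v)
  | mul a b ha hb => rw [← mul_assoc, ha, mul_assoc, hb, mul_assoc]
  | add a b ha hb => rw [mul_add, ha, hb, add_mul]

theorem EvenGr.comm {N : ℕ} (c : EvenGr N) (x : Gr (Fin N)) :
    (c : Gr (Fin N)) * x = x * (c : Gr (Fin N)) := gr_even_comm c.2 x

theorem grBody_odd {N : ℕ} {x : Gr (Fin N)} (hx : x ∈ grPart (Fin N) 1) : grBody N x = 0 := by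
  have h1 : (grBody N).comp (CliffordAlgebra.involute (Q := (0 : QuadraticForm ℝ (Fin N → ℝ))))
      = grBody N := by
    apply ExteriorAlgebra.hom_ext
    ext v
    have e : CliffordAlgebra.involute (Q := (0 : QuadraticForm ℝ (Fin N → ℝ)))
        (ExteriorAlgebra.ι ℝ (Pi.single v 1)) = - ExteriorAlgebra.ι ℝ (Pi.single v 1) :=
      CliffordAlgebra.involute_ι _
    simp [grBody, ExteriorAlgebra.algebraMapInv, e]
  have h2 := DFunLike.congr_fun h1 x
  rw [AlgHom.comp_apply, CliffordAlgebra.involute_eq_of_mem_odd hx, map_neg] at h2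
  linarith

theorem grBody_ι {N : ℕ} (v : Fin N → ℝ) : grBody N (ExteriorAlgebra.ι ℝ v) = 0 :=
  grBody_odd (ι_mem_grPart v)

@[simp] theorem grBody_algebraMap {N : ℕ} (r : ℝ) : grBody N (algebraMap ℝ _ r) = r :=
  (grBody N).commutes r

/-- The elements of degree at least `k` in the generators. -/
def grFilt (N k : ℕ) : Submodule ℝ (Gr (Fin N)) :=
  ⨆ d : {d : ℕ // k ≤ d}, ⋀[ℝ]^(d : ℕ) (Fin N → ℝ)

theorem mul_mem_grFilt {N j k : ℕ} {x y : Gr (Fin N)} (hx : x ∈ grFilt N j)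
    (hy : y ∈ grFilt N k) : x * y ∈ grFilt N (j + k) := by
  have h : grFilt N j * grFilt N k ≤ grFilt N (j + k) := by
    unfold grFilt
    rw [Submodule.iSup_mul]
    refine iSup_le fun d => ?_
    rw [Submodule.mul_iSup]
    refine iSup_le fun e => ?_
    refine le_trans (le_of_eq ?_) (le_iSup (fun d : {d : ℕ // j + k ≤ d} =>
      ⋀[ℝ]^(d : ℕ) (Fin N → ℝ)) ⟨d.1 + e.1, add_le_add d.2 e.2⟩)
    exact (pow_add _ _ _).symm
  exact h (Submodule.mul_mem_mul hx hy)

theorem grFilt_zero (N : ℕ) : grFilt N 0 = ⊤ := by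
  rw [eq_top_iff, ← CliffordAlgebra.iSup_ι_range_eq_top]
  refine iSup_le fun d => ?_
  exact le_iSup (fun d : {d : ℕ // 0 ≤ d} => ⋀[ℝ]^(d : ℕ) (Fin N → ℝ)) ⟨d, Nat.zero_le d⟩

theorem eq_zero_of_mem_grFilt {N k : ℕ} (hk : N < k) {x : Gr (Fin N)} (hx : x ∈ grFilt N k) :
    x = 0 := by
  have h : grFilt N k = ⊥ := by
    unfold grFilt
    rw [iSup_eq_bot]
    rintro ⟨d, hd⟩
    rw [← Submodule.finrank_eq_zero (R := ℝ), exteriorPower.finrank_eq]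
    simpa using Nat.choose_eq_zero_of_lt (lt_of_lt_of_le hk hd)
  rw [h] at hx
  simpa using hx

/-- The body of an element is its component of degree zero in the generators. -/
theorem mem_grFilt_one {N : ℕ} {x : Gr (Fin N)} (hx : grBody N x = 0) : x ∈ grFilt N 1 := by
  have hb : ∀ y ∈ grFilt N 1, grBody N y = 0 := by
    have : grFilt N 1 ≤ LinearMap.ker (grBody N).toLinearMap := by
      refine iSup_le ?_
      rintro ⟨d, hd⟩
      obtain ⟨e, rfl⟩ := Nat.exists_eq_add_of_le hd
      change LinearMap.range (ExteriorAlgebra.ι ℝ) ^ (1 + e) ≤ _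
      rw [pow_add, pow_one, Submodule.mul_le]
      rintro _ ⟨v, rfl⟩ y -
      simp [grBody_ι]
    intro y hy
    exact this hy
  have htop : x ∈ (1 : Submodule ℝ (Gr (Fin N))) ⊔ grFilt N 1 := by
    have : (⊤ : Submodule ℝ (Gr (Fin N))) ≤ 1 ⊔ grFilt N 1 := by
      rw [← CliffordAlgebra.iSup_ι_range_eq_top]
      refine iSup_le fun d => ?_
      rcases Nat.eq_zero_or_pos d with rfl | hd
      · rw [pow_zero]; exact le_sup_left
      · exact le_sup_of_le_right (le_iSup (fun d : {d : ℕ // 1 ≤ d} =>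
          ⋀[ℝ]^(d : ℕ) (Fin N → ℝ)) ⟨d, hd⟩)
    exact this trivial
  obtain ⟨a, ha, y, hy, rfl⟩ := Submodule.mem_sup.1 htop
  obtain ⟨r, rfl⟩ := Submodule.mem_one.1 ha
  have : r = 0 := by simpa [hb y hy] using hx
  simpa [this] using hy

theorem pow_mem_grFilt {N : ℕ} {x : Gr (Fin N)} (hx : grBody N x = 0) (k : ℕ) :
    x ^ k ∈ grFilt N k := by
  induction k with
  | zero => rw [grFilt_zero]; trivial
  | succ k ih => rw [pow_succ]; exact mul_mem_grFilt ih (mem_grFilt_one hx)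

/-- The augmentation on the even part. -/
def evenBody (N : ℕ) : EvenGr N →+* ℝ :=
  ((grBody N).comp (CliffordAlgebra.even (0 : QuadraticForm ℝ (Fin N → ℝ))).val).toRingHom

theorem evenBody_apply {N : ℕ} (c : EvenGr N) : evenBody N c = grBody N (c : Gr (Fin N)) := rfl

/-- An even element with nonzero body is invertible, because it differs from its body by a nilpotent
element. -/
theorem isUnit_of_evenBody_ne_zero {N : ℕ} {c : EvenGr N} (hc : evenBody N c ≠ 0) : IsUnit c := by
  set r := evenBody N c with hr
  have hn : IsNilpotent (c - algebraMap ℝ (EvenGr N) r) := by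
    refine ⟨N + 1, Subtype.ext ?_⟩
    have h0 : grBody N ((c : Gr (Fin N)) - algebraMap ℝ _ r) = 0 := by
      rw [map_sub, grBody_algebraMap, hr, evenBody_apply, sub_self]
    exact eq_zero_of_mem_grFilt (Nat.lt_succ_self N) (pow_mem_grFilt h0 (N + 1))
  have hu : IsUnit (algebraMap ℝ (EvenGr N) r) := (isUnit_iff_ne_zero.2 hc).map _
  have := hn.isUnit_add_left_of_commute hu (Commute.all _ _)
  simpa using this

theorem evenBody_ne_zero_of_isUnit {N : ℕ} {c : EvenGr N} (hc : IsUnit c) : evenBody N c ≠ 0 :=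
  (hc.map (evenBody N)).ne_zero

/-! ### Adjoining an odd generator -/

/-- The inclusion of the first `N` generators among `N + 1`. -/
def genIncl (N : ℕ) : (Fin N → ℝ) →ₗ[ℝ] (Fin (N + 1) → ℝ) where
  toFun v := Fin.snoc (α := fun _ => ℝ) v 0
  map_add' v w := by
    ext i
    refine Fin.lastCases ?_ (fun i => ?_) i <;> simp
  map_smul' r v := by
    ext i
    refine Fin.lastCases ?_ (fun i => ?_) i <;> simp

/-- The Grassmann algebra with `N` generators as a subalgebra of the one with `N + 1`. -/
def grEmb (N : ℕ) : Gr (Fin N) →ₐ[ℝ] Gr (Fin (N + 1)) := ExteriorAlgebra.map (genIncl N)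

theorem grEmb_mem {N : ℕ} {i : ZMod 2} {x : Gr (Fin N)} (hx : x ∈ grPart (Fin N) i) :
    grEmb N x ∈ grPart (Fin (N + 1)) i := by
  have key : ∀ i : ZMod 2, i = 0 ∨ i = 1 := by decide
  have hι : ∀ v : Fin N → ℝ, grEmb N (CliffordAlgebra.ι _ v) = ExteriorAlgebra.ι ℝ (genIncl N v) :=
    fun v => ExteriorAlgebra.map_apply_ι _ _
  have h2 : ∀ (i : ZMod 2) (v w : Fin N → ℝ) (y : Gr (Fin N)),
      grEmb N y ∈ grPart (Fin (N + 1)) i →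
      grEmb N (CliffordAlgebra.ι _ v * CliffordAlgebra.ι _ w * y) ∈ grPart (Fin (N + 1)) i := by
    intro i v w y hy
    have e : grEmb N (CliffordAlgebra.ι _ v * CliffordAlgebra.ι _ w * y) =
        ExteriorAlgebra.ι ℝ (genIncl N v) * ExteriorAlgebra.ι ℝ (genIncl N w) * grEmb N y := by
      rw [← hι, ← hι]
      exact (map_mul (grEmb N) _ _).trans (congrArg (· * grEmb N y) (map_mul (grEmb N) _ _))
    have h := gr_mul_mem (gr_mul_mem (ι_mem_grPart (genIncl N v)) (ι_mem_grPart (genIncl N w))) hy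
    have h11 : ∀ i : ZMod 2, 1 + 1 + i = i := by decide
    rw [h11] at h
    rwa [e]
  rcases key i with rfl | rfl
  · induction x, hx using CliffordAlgebra.even_induction with
    | algebraMap r =>
      have : grEmb N (algebraMap ℝ _ r) = algebraMap ℝ _ r := (grEmb N).commutes r
      exact this ▸ algebraMap_mem_grPart r
    | add x y hx hy ihx ihy => exact (map_add (grEmb N) x y).symm ▸ Submodule.add_mem _ ihx ihy
    | ι_mul_ι_mul v w x hx ih => exact h2 0 v w x ih
  · induction x, hx using CliffordAlgebra.odd_induction with
    | ι v => exact (hι v).symm ▸ ι_mem_grPart _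
    | add x y hx hy ihx ihy => exact (map_add (grEmb N) x y).symm ▸ Submodule.add_mem _ ihx ihy
    | ι_mul_ι_mul v w x hx ih => exact h2 1 v w x ih

theorem grBody_grEmb {N : ℕ} (x : Gr (Fin N)) : grBody (N + 1) (grEmb N x) = grBody N x := by
  have h : (grBody (N + 1)).comp (grEmb N) = grBody N := by
    apply ExteriorAlgebra.hom_ext
    ext v
    simp [grEmb, grBody_ι]
  exact DFunLike.congr_fun h x

theorem grEmb_injective (N : ℕ) : Function.Injective (grEmb N) := by
  refine ExteriorAlgebra.map_injective ⟨LinearMap.funLeft ℝ ℝ Fin.castSucc, ?_⟩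
  ext v i
  simp [genIncl, LinearMap.funLeft_apply]

/-- For each parity there is an element that annihilates nothing in the subalgebra generated by
the first `N` generators: the unit, or the last generator. -/
theorem exists_faithful_multiplier (N : ℕ) (i : ZMod 2) : ∃ θ ∈ grPart (Fin (N + 1)) i,
    ∀ x : Gr (Fin N), θ * grEmb N x = 0 → x = 0 := by
  have key : ∀ i : ZMod 2, i = 0 ∨ i = 1 := by decide
  rcases key i with rfl | rfl
  · refine ⟨1, one_mem_grPart, fun x hx => grEmb_injective N ?_⟩
    rw [one_mul] at hx
    rw [hx, map_zero]
  · refine ⟨ExteriorAlgebra.ι ℝ (Pi.single (Fin.last N) 1), ι_mem_grPart _, fun x hx => ?_⟩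
    -- contraction with the last generator recovers `x` from its product with that generator
    set d : Module.Dual ℝ (Fin (N + 1) → ℝ) := LinearMap.proj (Fin.last N) with hd
    have hz : ∀ y : Gr (Fin N), CliffordAlgebra.contractLeft
        (Q := (0 : QuadraticForm ℝ (Fin (N + 1) → ℝ))) d (grEmb N y) = 0 := by
      intro y
      induction y using CliffordAlgebra.left_induction with
      | algebraMap r =>
        have : grEmb N (algebraMap ℝ _ r) = algebraMap ℝ _ r := (grEmb N).commutes r
        exact (congrArg _ this).trans (CliffordAlgebra.contractLeft_algebraMap (d := d) _ r)
      | add a b ha hb =>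
        have : grEmb N (a + b) = grEmb N a + grEmb N b := map_add _ _ _
        rw [this, map_add, ha, hb, add_zero]
      | ι_mul a v ha =>
        have : grEmb N (CliffordAlgebra.ι _ v * a) =
            CliffordAlgebra.ι _ (genIncl N v) * grEmb N a := by
          rw [← ExteriorAlgebra.map_apply_ι]; exact map_mul _ _ _
        rw [this, CliffordAlgebra.contractLeft_ι_mul, ha]
        simp [hd, genIncl]
    have h1 : CliffordAlgebra.contractLeft (Q := (0 : QuadraticForm ℝ (Fin (N + 1) → ℝ))) d
        (ExteriorAlgebra.ι ℝ (Pi.single (Fin.last N) 1) * grEmb N x) = grEmb N x := by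
      refine (CliffordAlgebra.contractLeft_ι_mul (d := d) _ _).trans ?_
      rw [hz]
      simp [hd]
    rw [hx, map_zero] at h1
    exact grEmb_injective N (by rw [← h1, map_zero])

/-! ### Grassmann-valued points -/

section

variable {I : Type} {π : I → ZMod 2} {N : ℕ}

attribute [ext] SPoint

namespace SPoint

instance : Zero (SPoint N π) := ⟨⟨0, fun _ => Submodule.zero_mem _⟩⟩
instance : Add (SPoint N π) :=
  ⟨fun z w => ⟨z.val + w.val, fun i => Submodule.add_mem _ (z.mem i) (w.mem i)⟩⟩
instance : Neg (SPoint N π) := ⟨fun z => ⟨-z.val, fun i => Submodule.neg_mem _ (z.mem i)⟩⟩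
instance : Sub (SPoint N π) :=
  ⟨fun z w => ⟨z.val - w.val, fun i => Submodule.sub_mem _ (z.mem i) (w.mem i)⟩⟩
instance {S : Type*} [SMul S ℝ] [SMul S (Gr (Fin N))] [IsScalarTower S ℝ (Gr (Fin N))] :
    SMul S (SPoint N π) :=
  ⟨fun c z => ⟨c • z.val, fun i => Submodule.smul_of_tower_mem _ c (z.mem i)⟩⟩

theorem val_injective : Function.Injective (val : SPoint N π → I → Gr (Fin N)) :=
  fun _ _ h => SPoint.ext h

instance : AddCommGroup (SPoint N π) :=
  val_injective.addCommGroup _ rfl (fun _ _ => rfl) (fun _ => rfl) (fun _ _ => rfl)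
    (fun _ _ => rfl) (fun _ _ => rfl)

/-- The coordinates of a point, as an additive map. -/
def valHom : SPoint N π →+ (I → Gr (Fin N)) := ⟨⟨val, rfl⟩, fun _ _ => rfl⟩

instance : Module ℝ (SPoint N π) :=
  val_injective.module ℝ valHom (fun _ _ => rfl)

/-- Even elements of the Grassmann algebra act on points. -/
instance : SMul (EvenGr N) (SPoint N π) :=
  ⟨fun c z => ⟨fun i => (c : Gr (Fin N)) * z.val i, fun i => by
    have h := gr_mul_mem c.2 (z.mem i)
    rwa [zero_add] at h⟩⟩

@[simp] theorem val_zero (i : I) : (0 : SPoint N π).val i = 0 := rfl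

@[simp] theorem val_add (z w : SPoint N π) (i : I) : (z + w).val i = z.val i + w.val i := rfl
@[simp] theorem val_smul (t : ℝ) (z : SPoint N π) (i : I) : (t • z).val i = t • z.val i := rfl
@[simp] theorem val_esmul (c : EvenGr N) (z : SPoint N π) (i : I) :
    (c • z).val i = (c : Gr (Fin N)) * z.val i := rfl

@[simp] theorem body_add (z w : SPoint N π) : (z + w).body = z.body + w.body :=
  funext fun _ => map_add (grBody N) _ _
@[simp] theorem body_smul (t : ℝ) (z : SPoint N π) : (t • z).body = t • z.body :=
  funext fun _ => map_smul (grBody N) _ _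

theorem soul_add (z w : SPoint N π) (i : EvenIdx π) : (z + w).soul i = z.soul i + w.soul i := by
  simp only [soul, val_add, body_add, Pi.add_apply, map_add]; abel
theorem soul_smul (t : ℝ) (z : SPoint N π) (i : EvenIdx π) :
    (t • z).soul i = t • z.soul i := by
  simp only [soul, val_smul, body_smul, Pi.smul_apply, smul_eq_mul, map_mul, Algebra.smul_def,
    mul_sub]

theorem val_eq_body_add_soul (z : SPoint N π) (i : EvenIdx π) :
    z.val i.1 = algebraMap ℝ _ (z.body i) + z.soul i := by
  simp [soul]

theorem soul_mem_even (z : SPoint N π) (i : EvenIdx π) : z.soul i ∈ grPart (Fin N) 0 := by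
  have h := z.mem i.1
  rw [i.2] at h
  exact Submodule.sub_mem _ h (algebraMap_mem_grPart _)

theorem soul_mem_grFilt (z : SPoint N π) (i : EvenIdx π) : z.soul i ∈ grFilt N 1 := by
  apply mem_grFilt_one
  simp [soul, body]

/-- The point with the coordinates `f i`, for a parity-preserving map of coordinates. -/
def comap {J : Type} {π' : J → ZMod 2} (f : I → J) (hf : ∀ i, π' (f i) = π i)
    (z : SPoint N π') : SPoint N π where
  val i := z.val (f i)
  mem i := by
    have h := z.mem (f i)
    rwa [hf] at h

/-- The image of a point in the Grassmann algebra with one more generator. -/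
def emb (z : SPoint N π) : SPoint (N + 1) π := ⟨fun i => grEmb N (z.val i), fun i => grEmb_mem (z.mem i)⟩

@[simp] theorem body_emb (z : SPoint N π) : z.emb.body = z.body :=
  funext fun _ => grBody_grEmb _

theorem soul_emb (z : SPoint N π) (i : EvenIdx π) : z.emb.soul i = grEmb N (z.soul i) := by
  rw [soul, body_emb, soul, map_sub]
  congr 1
  exact ((grEmb N).commutes _).symm

end SPoint

end

/-! ### Calculus of functions on superdomains -/

section

variable {O O' : Type} [Finite O] [Finite O']

instance grFinite : Module.Finite ℝ (Gr O) := Module.Finite.equiv (grCoeff O).symm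

theorem gr_linearMap_contDiff (f : Gr O →ₗ[ℝ] Gr O') {n : WithTop ℕ∞} :
    ContDiff ℝ n (fun x => f x) := (LinearMap.toContinuousLinearMap f).contDiff

theorem gr_linearMap_hasFDerivAt (f : Gr O →ₗ[ℝ] Gr O') (x : Gr O) :
    HasFDerivAt (fun x => f x) (LinearMap.toContinuousLinearMap f) x :=
  (LinearMap.toContinuousLinearMap f).hasFDerivAt

theorem hasDerivAt_gr_linearMap {f : ℝ → Gr O} {f' : Gr O} {t : ℝ} (ℓ : Gr O →ₗ[ℝ] Gr O')
    (hf : HasDerivAt f f' t) : HasDerivAt (fun s => ℓ (f s)) (ℓ f') t :=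
  (LinearMap.toContinuousLinearMap ℓ).hasFDerivAt.comp_hasDerivAt t hf

theorem hasDerivAt_gr_mul {f g : ℝ → Gr O} {f' g' : Gr O} {t : ℝ} (hf : HasDerivAt f f' t)
    (hg : HasDerivAt g g' t) : HasDerivAt (fun s => f s * g s) (f' * g t + f t * g') t := by
  let B : Gr O →L[ℝ] Gr O →L[ℝ] Gr O := LinearMap.toContinuousLinearMap
    ((LinearMap.toContinuousLinearMap (E := Gr O) (F' := Gr O)).toLinearMap ∘ₗ LinearMap.mul ℝ (Gr O))
  have h := B.hasDerivAt_of_bilinear (fun _ => hf) (fun _ => hg)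
  rw [add_comm]
  exact h

theorem hasDerivAt_gr_const_mul {g : ℝ → Gr O} {g' : Gr O} {t : ℝ} (c : Gr O)
    (hg : HasDerivAt g g' t) : HasDerivAt (fun s => c * g s) (c * g') t :=
  hasDerivAt_gr_linearMap (LinearMap.mulLeft ℝ c) hg

theorem hasDerivAt_gr_mul_const {g : ℝ → Gr O} {g' : Gr O} {t : ℝ} (hg : HasDerivAt g g' t)
    (c : Gr O) : HasDerivAt (fun s => g s * c) (g' * c) t :=
  hasDerivAt_gr_linearMap (LinearMap.mulRight ℝ c) hg

end

section

variable {I : Type} [Fintype I] [DecidableEq I] {π : I → ZMod 2} {N : ℕ}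
  {U : Set (EvenIdx π → ℝ)} {F G : SuperFun π}

/-- Contraction with the odd coordinate `i`. -/
def contract (i : OddIdx π) : Gr (OddIdx π) →ₗ[ℝ] Gr (OddIdx π) :=
  CliffordAlgebra.contractLeft (LinearMap.proj i : Module.Dual ℝ (OddIdx π → ℝ))

theorem contract_comm (i j : OddIdx π) (x : Gr (OddIdx π)) :
    contract i (contract j x) = -contract j (contract i x) :=
  CliffordAlgebra.contractLeft_comm (Q := (0 : QuadraticForm ℝ (OddIdx π → ℝ)))
    (LinearMap.proj i : Module.Dual ℝ (OddIdx π → ℝ)) (LinearMap.proj j) x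

theorem contract_algebraMap (i : OddIdx π) (r : ℝ) :
    contract i (algebraMap ℝ (Gr (OddIdx π)) r) = 0 :=
  CliffordAlgebra.contractLeft_algebraMap (0 : QuadraticForm ℝ (OddIdx π → ℝ))
    (d := LinearMap.proj i) r

theorem contract_ι_mul (i : OddIdx π) (v : OddIdx π → ℝ) (x : Gr (OddIdx π)) :
    contract i (ExteriorAlgebra.ι ℝ v * x) =
      v i • x - ExteriorAlgebra.ι ℝ v * contract i x :=
  CliffordAlgebra.contractLeft_ι_mul (Q := (0 : QuadraticForm ℝ (OddIdx π → ℝ)))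
    (d := (LinearMap.proj i : Module.Dual ℝ (OddIdx π → ℝ))) v x

theorem pderiv_evenIdx (i : EvenIdx π) (F : SuperFun π) (x : EvenIdx π → ℝ) :
    pderiv i.1 F x = fderiv ℝ F x (Pi.single i 1) := dif_pos i.2

theorem pderiv_oddIdx (i : OddIdx π) (F : SuperFun π) (x : EvenIdx π → ℝ) :
    pderiv i.1 F x = contract i (F x) := dif_neg (by rw [i.2]; decide)

theorem coordMul_evenIdx (i : EvenIdx π) (F : SuperFun π) (x : EvenIdx π → ℝ) :
    coordMul i.1 F x = x i • F x := dif_pos i.2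

theorem coordMul_oddIdx (i : OddIdx π) (F : SuperFun π) (x : EvenIdx π → ℝ) :
    coordMul i.1 F x = ExteriorAlgebra.ι ℝ (Pi.single i (1 : ℝ)) * F x :=
  dif_neg (by rw [i.2]; decide)

/-- A statement about all coordinates may be checked on even and on odd ones. -/
theorem forall_coord {P : I → Prop} (h0 : ∀ i : EvenIdx π, P i.1) (h1 : ∀ i : OddIdx π, P i.1)
    (i : I) : P i := by
  by_cases h : π i = 0
  · exact h0 ⟨i, h⟩
  · exact h1 ⟨i, eq_one_of_ne_zero h⟩

theorem contDiffOn_pderiv (hU : IsOpen U) (hF : ContDiffOn ℝ ∞ F U) (i : I) :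
    ContDiffOn ℝ ∞ (pderiv i F) U := by
  refine forall_coord (π := π) (P := fun i => ContDiffOn ℝ ∞ (pderiv i F) U)
    (fun i => ?_) (fun i => ?_) i
  · have e : pderiv i.1 F = fun x => fderiv ℝ F x (Pi.single i 1) :=
      funext fun x => pderiv_evenIdx i F x
    rw [e]
    exact (hF.fderiv_of_isOpen hU (by simp)).clm_apply contDiffOn_const
  · have e : pderiv i.1 F = fun x => contract i (F x) :=
      funext fun x => pderiv_oddIdx i F x
    rw [e]
    exact (gr_linearMap_contDiff (contract i)).comp_contDiffOn hF

theorem contDiffOn_coordMul (hF : ContDiffOn ℝ ∞ F U) (i : I) :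
    ContDiffOn ℝ ∞ (coordMul i F) U := by
  refine forall_coord (π := π) (P := fun i => ContDiffOn ℝ ∞ (coordMul i F) U)
    (fun i => ?_) (fun i => ?_) i
  · have e : coordMul i.1 F = fun x => x i • F x :=
      funext fun x => coordMul_evenIdx i F x
    rw [e]
    exact (contDiff_apply ℝ ℝ i).contDiffOn.smul hF
  · have e : coordMul i.1 F = fun x =>
        LinearMap.mulLeft ℝ (ExteriorAlgebra.ι ℝ (Pi.single i (1 : ℝ))) (F x) :=
      funext fun x => coordMul_oddIdx i F x
    rw [e]
    exact (gr_linearMap_contDiff _).comp_contDiffOn hF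

theorem hasFDerivAt_of_contDiffOn (hU : IsOpen U) (hF : ContDiffOn ℝ ∞ F U)
    {x : EvenIdx π → ℝ} (hx : x ∈ U) : HasFDerivAt F (fderiv ℝ F x) x :=
  ((hF.contDiffAt (hU.mem_nhds hx)).differentiableAt (by simp)).hasFDerivAt

theorem pderiv_even_even (hU : IsOpen U) (hF : ContDiffOn ℝ ∞ F U) {x : EvenIdx π → ℝ}
    (hx : x ∈ U) (i j : EvenIdx π) :
    pderiv i.1 (pderiv j.1 F) x = fderiv ℝ (fderiv ℝ F) x (Pi.single i 1) (Pi.single j 1) := by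
  have e : pderiv j.1 F = fun x => fderiv ℝ F x (Pi.single j 1) :=
    funext fun x => pderiv_evenIdx j F x
  have hd : DifferentiableAt ℝ (fderiv ℝ F) x :=
    (((hF.fderiv_of_isOpen hU (m := ∞) (by simp)).contDiffAt (hU.mem_nhds hx))).differentiableAt
      (by simp)
  rw [pderiv_evenIdx, e, fderiv_clm_apply hd (differentiableAt_const _)]
  simp

theorem pderiv_even_odd (hU : IsOpen U) (hF : ContDiffOn ℝ ∞ F U) {x : EvenIdx π → ℝ}
    (hx : x ∈ U) (i : EvenIdx π) (j : OddIdx π) :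
    pderiv i.1 (pderiv j.1 F) x = pderiv j.1 (pderiv i.1 F) x := by
  have e : pderiv j.1 F = fun x => contract j (F x) :=
    funext fun x => pderiv_oddIdx j F x
  rw [pderiv_evenIdx, e, pderiv_oddIdx, pderiv_evenIdx]
  have h := (gr_linearMap_hasFDerivAt (contract j) (F x)).comp x
    (hasFDerivAt_of_contDiffOn hU hF hx)
  have h2 := h.fderiv
  exact DFunLike.congr_fun h2 _

/-- Partial derivatives of smooth functions supercommute. -/
theorem pderiv_comm (hU : IsOpen U) (hF : ContDiffOn ℝ ∞ F U) {x : EvenIdx π → ℝ} (hx : x ∈ U)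
    (i j : I) : pderiv i (pderiv j F) x = sgn (π i * π j) • pderiv j (pderiv i F) x := by
  revert j
  refine forall_coord (π := π) (P := fun i => ∀ j, pderiv i (pderiv j F) x =
    sgn (π i * π j) • pderiv j (pderiv i F) x) (fun i => ?_) (fun i => ?_) i
  · refine forall_coord (π := π) (fun j => ?_) (fun j => ?_)
    · rw [i.2, pderiv_even_even hU hF hx, pderiv_even_even hU hF hx, zero_mul, sgn_zero, one_smul]
      exact (hF.contDiffAt (hU.mem_nhds hx)).isSymmSndFDerivAt
        (by rw [minSmoothness_of_isRCLikeNormedField]; exact WithTop.coe_le_coe.2 le_top) _ _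
    · rw [i.2, pderiv_even_odd hU hF hx, zero_mul, sgn_zero, one_smul]
  · refine forall_coord (π := π) (fun j => ?_) (fun j => ?_)
    · rw [j.2, ← pderiv_even_odd hU hF hx, mul_zero, sgn_zero, one_smul]
    · simp only [i.2, j.2, pderiv_oddIdx, mul_one, sgn_one, neg_smul, one_smul]
      exact contract_comm i j (F x)

theorem pderiv_congr (hU : IsOpen U) (h : Set.EqOn F G U) (i : I) :
    Set.EqOn (pderiv i F) (pderiv i G) U := by
  intro x hx
  refine forall_coord (π := π) (P := fun i => pderiv i F x = pderiv i G x)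
    (fun i => ?_) (fun i => ?_) i
  · rw [pderiv_evenIdx, pderiv_evenIdx,
      (Filter.eventuallyEq_of_mem (hU.mem_nhds hx) h).fderiv_eq]
  · rw [pderiv_oddIdx, pderiv_oddIdx, h hx]

end

/-! ### Taylor expansion at Grassmann-valued points -/

section

variable {I : Type} [Fintype I] [DecidableEq I] {π : I → ZMod 2} {N : ℕ}
  {U : Set (EvenIdx π → ℝ)} {F G : SuperFun π}

/-- The homogeneous part of degree `k` in the souls of the Taylor expansion, without the factor
`1 / k!`. -/
def taylorTerm (k : ℕ) (F : SuperFun π) (z : SPoint N π) : Gr (Fin N) :=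
  ∑ c : Fin k → EvenIdx π, z.oddHom (iteratedFDeriv ℝ k F z.body (fun j => Pi.single (c j) 1)) *
      (List.ofFn fun j => z.soul (c j)).prod

theorem eval_eq_sum (F : SuperFun π) (z : SPoint N π) : eval F z =
    ∑ k ∈ Finset.range (N + 1), ((k.factorial : ℝ)⁻¹) • taylorTerm k F z := rfl

theorem taylorTerm_zero (F : SuperFun π) (z : SPoint N π) :
    taylorTerm 0 F z = z.oddHom (F z.body) := by
  simp [taylorTerm]

theorem taylorTerm_congr {z : SPoint N π} (h : F =ᶠ[nhds z.body] G) (k : ℕ) :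
    taylorTerm k F z = taylorTerm k G z := by
  simp only [taylorTerm, (h.iteratedFDeriv ℝ k).self_of_nhds]

theorem eval_congr (hU : IsOpen U) (h : Set.EqOn F G U) {z : SPoint N π} (hz : z.body ∈ U) :
    eval F z = eval G z := by
  simp only [eval_eq_sum,
    taylorTerm_congr (Filter.eventuallyEq_of_mem (hU.mem_nhds hz) h)]

/-- The recursion for the terms of the Taylor expansion. -/
theorem taylorTerm_succ (hU : IsOpen U) (hF : ContDiffOn ℝ ∞ F U) {z : SPoint N π}
    (hz : z.body ∈ U) (k : ℕ) :
    taylorTerm (k + 1) F z = ∑ i : EvenIdx π, taylorTerm k (pderiv i.1 F) z * z.soul i := by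
  have hd : ContDiffAt ℝ ∞ (fderiv ℝ F) z.body :=
    (hF.fderiv_of_isOpen hU (m := ∞) (by simp)).contDiffAt (hU.mem_nhds hz)
  have key : ∀ (i : EvenIdx π) (m : Fin k → (EvenIdx π → ℝ)),
      iteratedFDeriv ℝ k (pderiv i.1 F) z.body m =
        iteratedFDeriv ℝ k (fderiv ℝ F) z.body m (Pi.single i 1) := by
    intro i m
    have e : pderiv i.1 F = (ContinuousLinearMap.apply ℝ (Gr (OddIdx π))
        (Pi.single i (1 : ℝ) : EvenIdx π → ℝ)) ∘ fderiv ℝ F :=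
      funext fun x => pderiv_evenIdx i F x
    rw [e, ContinuousLinearMap.iteratedFDeriv_comp_left _ hd (i := k)
      (WithTop.coe_le_coe.2 le_top)]
    rfl
  simp only [taylorTerm, Finset.sum_mul]
  rw [Finset.sum_comm, ← (Fin.snocEquiv (fun _ : Fin (k + 1) => EvenIdx π)).sum_comp,
    Fintype.sum_prod_type, Finset.sum_comm]
  refine Finset.sum_congr rfl fun c _ => Finset.sum_congr rfl fun i _ => ?_
  rw [iteratedFDeriv_succ_apply_right, key, List.ofFn_succ', List.prod_concat, mul_assoc]
  simp [Fin.snocEquiv, Fin.init_def]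

theorem taylorTerm_add (hU : IsOpen U) (hF : ContDiffOn ℝ ∞ F U) (hG : ContDiffOn ℝ ∞ G U)
    {z : SPoint N π} (hz : z.body ∈ U) (k : ℕ) :
    taylorTerm k (F + G) z = taylorTerm k F z + taylorTerm k G z := by
  have h (H : SuperFun π) (hH : ContDiffOn ℝ ∞ H U) : ContDiffAt ℝ k H z.body :=
    (hH.contDiffAt (hU.mem_nhds hz)).of_le (WithTop.coe_le_coe.2 le_top)
  simp only [taylorTerm, ← Finset.sum_add_distrib]
  refine Finset.sum_congr rfl fun c _ => ?_
  rw [iteratedFDeriv_add_apply (h F hF) (h G hG), add_apply, map_add,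
    add_mul]

theorem taylorTerm_const_smul (hU : IsOpen U) (hF : ContDiffOn ℝ ∞ F U)
    {z : SPoint N π} (hz : z.body ∈ U) (k : ℕ) (c : ℝ) :
    taylorTerm k (c • F) z = c • taylorTerm k F z := by
  have h : ContDiffAt ℝ k F z.body :=
    (hF.contDiffAt (hU.mem_nhds hz)).of_le (WithTop.coe_le_coe.2 le_top)
  simp only [taylorTerm, Finset.smul_sum]
  refine Finset.sum_congr rfl fun d _ => ?_
  rw [iteratedFDeriv_const_smul_apply h, smul_apply, map_smul,
    smul_mul_assoc]

theorem taylorTerm_mem_grFilt (hU : IsOpen U) {z : SPoint N π} (hz : z.body ∈ U) (k : ℕ) :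
    ∀ {F : SuperFun π}, ContDiffOn ℝ ∞ F U → taylorTerm k F z ∈ grFilt N k := by
  induction k with
  | zero => intro F _; rw [grFilt_zero]; trivial
  | succ k ih =>
    intro F hF
    rw [taylorTerm_succ hU hF hz]
    exact Submodule.sum_mem _ fun i _ =>
      mul_mem_grFilt (ih (contDiffOn_pderiv hU hF i.1)) (z.soul_mem_grFilt i)

theorem taylorTerm_mul_soul (hU : IsOpen U) (hF : ContDiffOn ℝ ∞ F U) {z : SPoint N π}
    (hz : z.body ∈ U) {s : Gr (Fin N)} (hs : s ∈ grFilt N 1) : taylorTerm N F z * s = 0 := by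
  have h := mul_mem_grFilt (taylorTerm_mem_grFilt hU hz N hF) hs
  exact eq_zero_of_mem_grFilt (k := N + 1) (Nat.lt_succ_self N) h

theorem eval_add (hU : IsOpen U) (hF : ContDiffOn ℝ ∞ F U) (hG : ContDiffOn ℝ ∞ G U)
    {z : SPoint N π} (hz : z.body ∈ U) : eval (F + G) z = eval F z + eval G z := by
  simp only [eval_eq_sum, taylorTerm_add hU hF hG hz, smul_add, Finset.sum_add_distrib]

theorem eval_const_smul (hU : IsOpen U) (hF : ContDiffOn ℝ ∞ F U)
    {z : SPoint N π} (hz : z.body ∈ U) (c : ℝ) : eval (c • F) z = c • eval F z := by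
  simp only [eval_eq_sum, taylorTerm_const_smul hU hF hz, Finset.smul_sum]
  refine Finset.sum_congr rfl fun k _ => smul_comm _ _ _

theorem eval_zero (z : SPoint N π) : eval (0 : SuperFun π) z = 0 := by
  have h := eval_const_smul isOpen_univ (F := (0 : SuperFun π)) contDiffOn_const
    (Set.mem_univ z.body) 0
  rwa [zero_smul, zero_smul] at h

theorem eval_sub (hU : IsOpen U) (hF : ContDiffOn ℝ ∞ F U) (hG : ContDiffOn ℝ ∞ G U)
    {z : SPoint N π} (hz : z.body ∈ U) : eval (F - G) z = eval F z - eval G z := by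
  have h : F - G = F + (-1 : ℝ) • G := by rw [neg_one_smul, sub_eq_add_neg]
  have hG' : ContDiffOn ℝ ∞ ((-1 : ℝ) • G) U := hG.const_smul (-1 : ℝ)
  rw [h, eval_add hU hF hG' hz, eval_const_smul hU hG hz, neg_one_smul,
    sub_eq_add_neg]

theorem contDiffOn_superFun_sum {ι : Type*} (s : Finset ι) {F : ι → SuperFun π}
    (hF : ∀ i ∈ s, ContDiffOn ℝ ∞ (F i) U) : ContDiffOn ℝ ∞ (∑ i ∈ s, F i) U := by
  have := ContDiffOn.sum hF
  convert this using 1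
  ext x
  simp

theorem eval_sum (hU : IsOpen U) {ι : Type*} (s : Finset ι) {F : ι → SuperFun π}
    (hF : ∀ i ∈ s, ContDiffOn ℝ ∞ (F i) U) {z : SPoint N π} (hz : z.body ∈ U) :
    eval (∑ i ∈ s, F i) z = ∑ i ∈ s, eval (F i) z := by
  classical
  induction s using Finset.induction_on with
  | empty => simp [eval_zero]
  | insert a s ha ih =>
    have h1 := hF a (Finset.mem_insert_self a s)
    have h2 : ∀ i ∈ s, ContDiffOn ℝ ∞ (F i) U := fun i hi => hF i (Finset.mem_insert_of_mem hi)
    rw [Finset.sum_insert ha, Finset.sum_insert ha,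
      eval_add hU h1 (contDiffOn_superFun_sum s h2) hz, ih h2]

/-! ### The chain rule -/

theorem oddHom_ι (z : SPoint N π) (v : OddIdx π → ℝ) :
    z.oddHom (ExteriorAlgebra.ι ℝ v) = ∑ i : OddIdx π, v i • z.val i.1 := by
  rw [SPoint.oddHom, ExteriorAlgebra.lift_ι_apply, Fintype.linearCombination_apply]

theorem oddHom_ι_mem (z : SPoint N π) (v : OddIdx π → ℝ) :
    z.oddHom (ExteriorAlgebra.ι ℝ v) ∈ grPart (Fin N) 1 := by
  rw [oddHom_ι]
  refine Submodule.sum_mem _ fun i _ => Submodule.smul_mem _ _ ?_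
  have h := z.mem i.1
  rwa [i.2] at h

/-- The derivative of the substitution of odd coordinates. -/
theorem hasDerivAt_oddHom (z δ : SPoint N π) (x : Gr (OddIdx π)) :
    HasDerivAt (fun t : ℝ => (z + t • δ).oddHom x)
      (∑ i : OddIdx π, δ.val i.1 * z.oddHom (contract i x)) 0 := by
  refine gr_induction (P := fun x => HasDerivAt (fun t : ℝ => (z + t • δ).oddHom x)
    (∑ i : OddIdx π, δ.val i.1 * z.oddHom (contract i x)) 0) (fun r => ?_) (fun a b ha hb => ?_)
    (fun v a ha => ?_) x
  · simp only [contract_algebraMap, map_zero, mul_zero, Finset.sum_const_zero, AlgHom.commutes]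
    exact hasDerivAt_const _ _
  · simp only [map_add, mul_add, Finset.sum_add_distrib]
    exact ha.add hb
  · have hv : HasDerivAt (fun t : ℝ => (z + t • δ).oddHom (ExteriorAlgebra.ι ℝ v))
        (δ.oddHom (ExteriorAlgebra.ι ℝ v)) 0 := by
      have e : (fun t : ℝ => (z + t • δ).oddHom (ExteriorAlgebra.ι ℝ v)) = fun t =>
          z.oddHom (ExteriorAlgebra.ι ℝ v) + t • δ.oddHom (ExteriorAlgebra.ι ℝ v) := by
        ext1 t
        simp only [oddHom_ι, SPoint.val_add, SPoint.val_smul, smul_add, Finset.sum_add_distrib,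
          Finset.smul_sum, smul_comm t]
      rw [e]
      simpa using ((hasDerivAt_id (0 : ℝ)).smul_const
        (δ.oddHom (ExteriorAlgebra.ι ℝ v))).const_add (z.oddHom (ExteriorAlgebra.ι ℝ v))
    have h2 : ∀ i : OddIdx π, δ.val i.1 * z.oddHom (contract i (ExteriorAlgebra.ι ℝ v * a)) =
        v i • δ.val i.1 * z.oddHom a +
          z.oddHom (ExteriorAlgebra.ι ℝ v) * (δ.val i.1 * z.oddHom (contract i a)) := by
      intro i
      have ho : δ.val i.1 ∈ grPart (Fin N) 1 := by
        have h := δ.mem i.1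
        rwa [i.2] at h
      rw [contract_ι_mul, map_sub, map_mul, map_smul, mul_sub, ← mul_assoc, ← mul_assoc,
        gr_odd_anticomm ho (oddHom_ι_mem z v)]
      simp
    simp only [map_mul]
    refine (hasDerivAt_gr_mul hv ha).congr_deriv ?_
    rw [Finset.sum_congr rfl fun i _ => h2 i, Finset.sum_add_distrib, ← Finset.sum_mul,
      ← Finset.mul_sum, ← oddHom_ι]
    simp

/-- The differential of `F` at the Grassmann-valued point `z`, applied to a family `δ` of elements
of the Grassmann algebra. -/
def dEval (F : SuperFun π) (z : SPoint N π) (δ : I → Gr (Fin N)) : Gr (Fin N) :=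
  ∑ i, δ i * eval (pderiv i F) z

theorem sum_coord {M : Type*} [AddCommMonoid M] (f : I → M) :
    ∑ i, f i = ∑ i : EvenIdx π, f i.1 + ∑ i : OddIdx π, f i.1 := by
  have h := Fintype.sum_subtype_add_sum_subtype (fun i => π i = 0) f
  rw [← h]
  congr 1
  refine Fintype.sum_equiv (Equiv.subtypeEquivRight fun i => ?_) _ _ fun i => rfl
  exact ⟨eq_one_of_ne_zero, fun h => by rw [h]; decide⟩

theorem hasDerivAt_body (hU : IsOpen U) (hF : ContDiffOn ℝ ∞ F U) {z : SPoint N π}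
    (hz : z.body ∈ U) (δ : SPoint N π) :
    HasDerivAt (fun t : ℝ => F (z + t • δ).body)
      (∑ i : EvenIdx π, δ.body i • pderiv i.1 F z.body) 0 := by
  have h1 : HasDerivAt (fun t : ℝ => (z + t • δ).body) δ.body 0 := by
    simp only [SPoint.body_add, SPoint.body_smul]
    simpa using ((hasDerivAt_id (0 : ℝ)).smul_const δ.body).const_add z.body
  have h0 : (z + (0 : ℝ) • δ).body = z.body := by simp
  have h2 := hasFDerivAt_of_contDiffOn hU hF hz
  rw [← h0] at h2
  refine (h2.comp_hasDerivAt (0 : ℝ) h1).congr_deriv ?_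
  rw [h0]
  simp only [pderiv_evenIdx]
  conv_lhs => rw [pi_eq_sum_univ' δ.body]
  rw [map_sum]
  refine Finset.sum_congr rfl fun i _ => ?_
  rw [map_smul]

end

section

variable {I : Type} [Fintype I] [DecidableEq I] {π : I → ZMod 2} {N : ℕ}
  {U : Set (EvenIdx π → ℝ)} {F G : SuperFun π}

/-- The derivative along a line of the term without souls. The substitution of odd coordinates is
linear in the value of `F`, so this value is expanded in a basis and the product rule applied. -/
theorem hasDerivAt_taylorTerm_zero (hU : IsOpen U) (hF : ContDiffOn ℝ ∞ F U) {z : SPoint N π}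
    (hz : z.body ∈ U) (δ : SPoint N π) :
    HasDerivAt (fun t : ℝ => taylorTerm 0 F (z + t • δ))
      (∑ i : EvenIdx π, δ.body i • taylorTerm 0 (pderiv i.1 F) z +
        ∑ i : OddIdx π, δ.val i.1 * taylorTerm 0 (pderiv i.1 F) z) 0 := by
  let b := Module.finBasis ℝ (Gr (OddIdx π))
  have hexp : ∀ (w : SPoint N π) (x : Gr (OddIdx π)),
      w.oddHom x = ∑ s, b.repr x s • w.oddHom (b s) := by
    intro w x
    conv_lhs => rw [← b.sum_repr x]
    simp only [map_sum, map_smul]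
  have hc : ∀ s, HasDerivAt (fun t : ℝ => b.repr (F (z + t • δ).body) s)
      (b.repr (∑ i : EvenIdx π, δ.body i • pderiv i.1 F z.body) s) 0 := fun s =>
    (LinearMap.toContinuousLinearMap (b.coord s)).hasFDerivAt.comp_hasDerivAt (0 : ℝ)
      (hasDerivAt_body hU hF hz δ)
  have h := HasDerivAt.fun_sum (u := Finset.univ) fun s _ =>
    (hc s).smul (hasDerivAt_oddHom z δ (b s))
  have h0 : (z + (0 : ℝ) • δ) = z := by simp
  simp only [taylorTerm_zero, pderiv_oddIdx]
  rw [funext fun t => hexp (z + t • δ) (F (z + t • δ).body)]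
  refine h.congr_deriv ?_
  rw [h0, Finset.sum_add_distrib, ← hexp z, add_comm]
  congr 1
  · simp only [map_sum, map_smul]
  · simp only [Finset.smul_sum]
    rw [Finset.sum_comm]
    refine Finset.sum_congr rfl fun i _ => ?_
    conv_rhs => rw [← b.sum_repr (F z.body)]
    simp only [map_sum, map_smul, Finset.mul_sum, mul_smul_comm]

theorem eventually_body_mem (hU : IsOpen U) {z : SPoint N π} (hz : z.body ∈ U)
    (δ : SPoint N π) : ∀ᶠ t : ℝ in nhds 0, (z + t • δ).body ∈ U := by
  have hc : Continuous fun t : ℝ => (z + t • δ).body := by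
    simp only [SPoint.body_add, SPoint.body_smul]
    fun_prop
  refine hc.continuousAt.eventually_mem (hU.mem_nhds ?_)
  simpa using hz

theorem taylorTerm_pderiv_comm (hU : IsOpen U) (hF : ContDiffOn ℝ ∞ F U) {z : SPoint N π}
    (hz : z.body ∈ U) (k : ℕ) (i : EvenIdx π) (j : I) :
    taylorTerm k (pderiv i.1 (pderiv j F)) z = taylorTerm k (pderiv j (pderiv i.1 F)) z := by
  refine taylorTerm_congr (Filter.eventuallyEq_of_mem (hU.mem_nhds hz) fun x hx => ?_) k
  rw [pderiv_comm hU hF hx, i.2, zero_mul, sgn_zero, one_smul]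

/-- Along a line, a term of the Taylor expansion varies with the bodies (first sum), with the souls,
which lowers the degree by one (second sum), and with the odd coordinates (third sum). -/
theorem hasDerivAt_taylorTerm (hU : IsOpen U) {z : SPoint N π} (hz : z.body ∈ U)
    (δ : SPoint N π) (k : ℕ) : ∀ {F : SuperFun π}, ContDiffOn ℝ ∞ F U →
    HasDerivAt (fun t : ℝ => taylorTerm k F (z + t • δ))
      (∑ i : EvenIdx π, δ.body i • taylorTerm k (pderiv i.1 F) z +
        k • ∑ i : EvenIdx π, taylorTerm (k - 1) (pderiv i.1 F) z * δ.soul i +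
        ∑ i : OddIdx π, δ.val i.1 * taylorTerm k (pderiv i.1 F) z) 0 := by
  induction k with
  | zero =>
    intro F hF
    simpa using hasDerivAt_taylorTerm_zero hU hF hz δ
  | succ k ih =>
    intro F hF
    have hs : ∀ i : EvenIdx π, HasDerivAt (fun t : ℝ => (z + t • δ).soul i) (δ.soul i) 0 := by
      intro i
      simp only [SPoint.soul_add, SPoint.soul_smul]
      simpa using ((hasDerivAt_id (0 : ℝ)).smul_const (δ.soul i)).const_add (z.soul i)
    have h := HasDerivAt.fun_sum (u := Finset.univ) fun (i : EvenIdx π) _ =>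
      hasDerivAt_gr_mul (ih (contDiffOn_pderiv hU hF i.1)) (hs i)
    have h0 : (z + (0 : ℝ) • δ) = z := by simp
    refine (h.congr_deriv ?_).congr_of_eventuallyEq
      ((eventually_body_mem hU hz δ).mono fun t ht => taylorTerm_succ hU hF ht k)
    have hsucc : ∀ j : I, taylorTerm (k + 1) (pderiv j F) z =
        ∑ i : EvenIdx π, taylorTerm k (pderiv j (pderiv i.1 F)) z * z.soul i := fun j => by
      rw [taylorTerm_succ hU (contDiffOn_pderiv hU hF j) hz]
      exact Finset.sum_congr rfl fun i _ => by rw [taylorTerm_pderiv_comm hU hF hz]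
    have hmid : k • ∑ j : EvenIdx π, taylorTerm k (pderiv j.1 F) z * δ.soul j =
        ∑ i : EvenIdx π, (k • ∑ j : EvenIdx π,
          taylorTerm (k - 1) (pderiv j.1 (pderiv i.1 F)) z * δ.soul j) * z.soul i := by
      rcases k with _ | k
      · simp
      · simp only [Nat.add_sub_cancel, smul_mul_assoc, ← Finset.smul_sum, Finset.sum_mul]
        congr 1
        rw [Finset.sum_comm]
        refine Finset.sum_congr rfl fun j _ => ?_
        rw [taylorTerm_succ hU (contDiffOn_pderiv hU hF j.1) hz, Finset.sum_mul]
        refine Finset.sum_congr rfl fun i _ => ?_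
        rw [taylorTerm_pderiv_comm hU hF hz, mul_assoc, mul_assoc,
          gr_even_comm (z.soul_mem_even i)]
    simp only [hsucc, h0]
    rw [Nat.add_sub_cancel, succ_nsmul, hmid]
    simp only [add_mul, Finset.sum_add_distrib, Finset.smul_sum, Finset.mul_sum, Finset.sum_mul,
      smul_mul_assoc, mul_assoc]
    rw [Finset.sum_comm (f := fun i j : EvenIdx π => δ.body j • (_ * z.soul i)),
      Finset.sum_comm (f := fun (i : EvenIdx π) (j : OddIdx π) => δ.val j.1 * (_ * z.soul i))]
    abel

/-- The factor `k` from differentiating a term of degree `k` in the souls is absorbed by the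
coefficients `1 / k!`, provided that the top term vanishes. -/
theorem sum_inv_factorial_shift {M : Type*} [AddCommGroup M] [Module ℝ M] (S : ℕ → M) (N : ℕ)
    (hS : S N = 0) : ∑ k ∈ Finset.range (N + 1), ((k.factorial : ℝ)⁻¹) • (k • S (k - 1)) =
      ∑ k ∈ Finset.range (N + 1), ((k.factorial : ℝ)⁻¹) • S k := by
  rw [Finset.sum_range_succ', Finset.sum_range_succ _ N, hS]
  simp only [zero_smul, smul_zero, add_zero, Nat.add_sub_cancel]
  refine Finset.sum_congr rfl fun k _ => ?_
  rw [← Nat.cast_smul_eq_nsmul ℝ, smul_smul, Nat.factorial_succ]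
  congr 1
  have h1 : ((k : ℝ) + 1) ≠ 0 := by positivity
  have h2 : (k.factorial : ℝ) ≠ 0 := by positivity
  push_cast
  field_simp

theorem coe_mul_eq {z : SPoint N π} (i : EvenIdx π) (x : Gr (Fin N)) :
    z.val i.1 * x = z.body i • x + x * z.soul i := by
  rw [z.val_eq_body_add_soul, add_mul, ← Algebra.smul_def, gr_even_comm (z.soul_mem_even i)]

/-- The chain rule along a line of Grassmann-valued points, at the base point. -/
theorem hasDerivAt_eval_zero (hU : IsOpen U) (hF : ContDiffOn ℝ ∞ F U) {z : SPoint N π}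
    (hz : z.body ∈ U) (δ : SPoint N π) :
    HasDerivAt (fun t : ℝ => eval F (z + t • δ)) (dEval F z δ.val) 0 := by
  have h := HasDerivAt.fun_sum (u := Finset.range (N + 1)) fun k _ =>
    (hasDerivAt_taylorTerm hU hz δ k hF).const_smul ((k.factorial : ℝ)⁻¹)
  refine h.congr_deriv ?_
  -- products of more than `N` souls vanish
  have hN : ∑ i : EvenIdx π, taylorTerm N (pderiv i.1 F) z * δ.soul i = 0 :=
    Finset.sum_eq_zero fun i _ =>
      taylorTerm_mul_soul hU (contDiffOn_pderiv hU hF i.1) hz (δ.soul_mem_grFilt i)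
  simp only [smul_add, Finset.sum_add_distrib]
  rw [sum_inv_factorial_shift
    (fun k => ∑ i : EvenIdx π, taylorTerm k (pderiv i.1 F) z * δ.soul i) N hN, dEval,
    sum_coord (π := π)]
  simp only [coe_mul_eq (z := δ), Finset.sum_add_distrib, eval_eq_sum]
  simp only [Finset.smul_sum, Finset.sum_mul, Finset.mul_sum, smul_mul_assoc, mul_smul_comm]
  congr 1
  · congr 1
    · rw [Finset.sum_comm]
      exact Finset.sum_congr rfl fun i _ => Finset.sum_congr rfl fun k _ => smul_comm _ _ _
    · rw [Finset.sum_comm]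
  · rw [Finset.sum_comm]

/-- The chain rule along a line of Grassmann-valued points. -/
theorem hasDerivAt_eval (hU : IsOpen U) (hF : ContDiffOn ℝ ∞ F U) {z : SPoint N π}
    (δ : SPoint N π) {t : ℝ} (hz : (z + t • δ).body ∈ U) :
    HasDerivAt (fun t : ℝ => eval F (z + t • δ)) (dEval F (z + t • δ) δ.val) t := by
  have h := hasDerivAt_eval_zero hU hF hz δ
  have h2 : HasDerivAt (fun s : ℝ => s - t) 1 t := (hasDerivAt_id t).sub_const t
  have h3 : HasDerivAt (fun s : ℝ => eval F (z + t • δ + s • δ)) (dEval F (z + t • δ) δ.val)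
      (t - t) := by rwa [sub_self]
  have h4 := HasDerivAt.scomp (h := fun s : ℝ => s - t) t h3 h2
  rw [one_smul] at h4
  refine h4.congr_of_eventuallyEq (Filter.Eventually.of_forall fun s => ?_)
  simp only [Function.comp]
  rw [add_assoc, ← add_smul, add_sub_cancel]

/-! ### Multiplication by coordinates -/

theorem pderiv_even_coordMul (hU : IsOpen U) (hF : ContDiffOn ℝ ∞ F U) {x : EvenIdx π → ℝ}
    (hx : x ∈ U) (i j : EvenIdx π) : pderiv j.1 (coordMul i.1 F) x =
      (if i = j then F x else 0) + coordMul i.1 (pderiv j.1 F) x := by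
  have e : coordMul i.1 F = fun x => x i • F x := funext fun x => coordMul_evenIdx i F x
  rw [pderiv_evenIdx, e, coordMul_evenIdx, pderiv_evenIdx]
  have h1 : HasFDerivAt (fun x : EvenIdx π → ℝ => x i)
      (ContinuousLinearMap.proj (R := ℝ) (φ := fun _ : EvenIdx π => ℝ) i) x :=
    (ContinuousLinearMap.proj (R := ℝ) (φ := fun _ : EvenIdx π => ℝ) i).hasFDerivAt
  rw [(h1.fun_smul (hasFDerivAt_of_contDiffOn hU hF hx)).fderiv]
  by_cases h : i = j
  · subst h; simp [add_comm]
  · simp [h, add_comm]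

theorem pderiv_even_coordMul_odd (hU : IsOpen U) (hF : ContDiffOn ℝ ∞ F U) {x : EvenIdx π → ℝ}
    (hx : x ∈ U) (i : OddIdx π) (j : EvenIdx π) : pderiv j.1 (coordMul i.1 F) x =
      coordMul i.1 (pderiv j.1 F) x := by
  have e : coordMul i.1 F = fun x => LinearMap.mulLeft ℝ
      (ExteriorAlgebra.ι ℝ (Pi.single i (1 : ℝ))) (F x) :=
    funext fun x => coordMul_oddIdx i F x
  rw [pderiv_evenIdx, e, coordMul_oddIdx, pderiv_evenIdx]
  have h := (gr_linearMap_hasFDerivAt (LinearMap.mulLeft ℝ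
      (ExteriorAlgebra.ι ℝ (Pi.single i (1 : ℝ)))) (F x)).comp x
    (hasFDerivAt_of_contDiffOn hU hF hx)
  exact DFunLike.congr_fun h.fderiv _

theorem taylorTerm_coordMul_odd (hU : IsOpen U) {z : SPoint N π}
    (hz : z.body ∈ U) (i : OddIdx π) (k : ℕ) : ∀ {F : SuperFun π}, ContDiffOn ℝ ∞ F U →
    taylorTerm k (coordMul i.1 F) z = z.val i.1 * taylorTerm k F z := by
  induction k with
  | zero =>
    intro F hF
    rw [taylorTerm_zero, taylorTerm_zero, coordMul_oddIdx, map_mul, oddHom_ι,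
      Finset.sum_eq_single i (fun j _ hj => by rw [Pi.single_eq_of_ne hj, zero_smul]) (by simp)]
    simp
  | succ k ih =>
    intro F hF
    rw [taylorTerm_succ hU (contDiffOn_coordMul hF i.1) hz, taylorTerm_succ hU hF hz,
      Finset.mul_sum]
    refine Finset.sum_congr rfl fun j _ => ?_
    rw [taylorTerm_congr (Filter.eventuallyEq_of_mem (hU.mem_nhds hz) fun x hx =>
      pderiv_even_coordMul_odd hU hF hx i j), ih (contDiffOn_pderiv hU hF j.1), mul_assoc]

/-- The Leibniz rule for the product with an even coordinate, whose derivatives of order two and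
higher vanish. -/
theorem taylorTerm_coordMul_even (hU : IsOpen U) {z : SPoint N π}
    (hz : z.body ∈ U) (i : EvenIdx π) (k : ℕ) : ∀ {F : SuperFun π}, ContDiffOn ℝ ∞ F U →
    taylorTerm k (coordMul i.1 F) z =
      z.body i • taylorTerm k F z + k • (taylorTerm (k - 1) F z * z.soul i) := by
  induction k with
  | zero =>
    intro F hF
    rw [taylorTerm_zero, taylorTerm_zero, coordMul_evenIdx, map_smul, zero_smul, add_zero]
  | succ k ih =>
    intro F hF
    have h1 : ∀ j : EvenIdx π, taylorTerm k (pderiv j.1 (coordMul i.1 F)) z =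
        (if i = j then taylorTerm k F z else 0) + (z.body i • taylorTerm k (pderiv j.1 F) z +
          k • (taylorTerm (k - 1) (pderiv j.1 F) z * z.soul i)) := by
      intro j
      rw [← ih (contDiffOn_pderiv hU hF j.1)]
      by_cases h : i = j
      · subst h
        rw [if_pos rfl, ← taylorTerm_add hU hF
          (contDiffOn_coordMul (contDiffOn_pderiv hU hF i.1) i.1) hz]
        refine taylorTerm_congr (Filter.eventuallyEq_of_mem (hU.mem_nhds hz) fun x hx => ?_) k
        rw [pderiv_even_coordMul hU hF hx, if_pos rfl]; rfl
      · rw [if_neg h, zero_add]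
        refine taylorTerm_congr (Filter.eventuallyEq_of_mem (hU.mem_nhds hz) fun x hx => ?_) k
        rw [pderiv_even_coordMul hU hF hx, if_neg h, zero_add]
    have h2 : k • ∑ j : EvenIdx π, taylorTerm (k - 1) (pderiv j.1 F) z * z.soul i * z.soul j =
        k • (taylorTerm k F z * z.soul i) := by
      rcases k with _ | k
      · simp
      · rw [Nat.add_sub_cancel, taylorTerm_succ hU hF hz k, Finset.sum_mul]
        congr 1
        refine Finset.sum_congr rfl fun j _ => ?_
        rw [mul_assoc, mul_assoc, gr_even_comm (z.soul_mem_even i)]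
    rw [taylorTerm_succ hU (contDiffOn_coordMul hF i.1) hz]
    simp only [h1, add_mul, Finset.sum_add_distrib, smul_mul_assoc, ← Finset.smul_sum]
    rw [h2, ← taylorTerm_succ hU hF hz, Nat.add_sub_cancel, succ_nsmul]
    simp only [ite_mul, zero_mul, Finset.sum_ite_eq, Finset.mem_univ, if_true]
    abel

theorem eval_coordMul (hU : IsOpen U) (hF : ContDiffOn ℝ ∞ F U) {z : SPoint N π}
    (hz : z.body ∈ U) (i : I) : eval (coordMul i F) z = z.val i * eval F z := by
  refine forall_coord (π := π) (P := fun i => eval (coordMul i F) z = z.val i * eval F z)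
    (fun i => ?_) (fun i => ?_) i
  · have hN := taylorTerm_mul_soul hU hF hz (z.soul_mem_grFilt i)
    rw [coe_mul_eq]
    simp only [eval_eq_sum, taylorTerm_coordMul_even hU hz i _ hF, smul_add,
      Finset.sum_add_distrib]
    rw [sum_inv_factorial_shift (fun k => taylorTerm k F z * z.soul i) N hN]
    simp only [Finset.smul_sum, Finset.sum_mul, smul_mul_assoc, smul_comm (z.body i)]
  · simp only [eval_eq_sum, taylorTerm_coordMul_odd hU hz i _ hF, Finset.mul_sum, mul_smul_comm]

end

/-! ### Functions that do not depend on some of the coordinates -/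

section

variable {I J : Type} [Fintype I] [DecidableEq I] [Fintype J] [DecidableEq J] {π : I → ZMod 2}
  {π' : J → ZMod 2} {N : ℕ} {U : Set (EvenIdx π → ℝ)} {F G : SuperFun π}

/-- Restriction of even coordinates along a parity-preserving map of coordinates. -/
def restrictEven (f : I → J) (hf : ∀ i, π' (f i) = π i) :
    (EvenIdx π' → ℝ) →L[ℝ] (EvenIdx π → ℝ) :=
  ContinuousLinearMap.pi fun i => ContinuousLinearMap.proj ⟨f i.1, (hf i.1).trans i.2⟩

/-- The homomorphism of Grassmann algebras induced by a parity-preserving map of coordinates. -/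
def extendOdd (f : I → J) (hf : ∀ i, π' (f i) = π i) : Gr (OddIdx π) →ₐ[ℝ] Gr (OddIdx π') :=
  ExteriorAlgebra.map (Fintype.linearCombination ℝ (fun i : OddIdx π =>
      (Pi.single (⟨f i.1, (hf i.1).trans i.2⟩ : OddIdx π') (1 : ℝ) : OddIdx π' → ℝ)))

theorem extend_apply (f : I → J) (hf : ∀ i, π' (f i) = π i) (F : SuperFun π)
    (y : EvenIdx π' → ℝ) : extend f hf F y = extendOdd f hf (F (restrictEven f hf y)) := rfl

theorem SPoint.body_comap (f : I → J) (hf : ∀ i, π' (f i) = π i) (z : SPoint N π') :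
    (z.comap f hf).body = restrictEven f hf z.body := rfl

theorem contDiffOn_extend (f : I → J) (hf : ∀ i, π' (f i) = π i) (hF : ContDiffOn ℝ ∞ F U) :
    ContDiffOn ℝ ∞ (extend f hf F) (restrictEven f hf ⁻¹' U) :=
  (gr_linearMap_contDiff (extendOdd f hf).toLinearMap).comp_contDiffOn
    (hF.comp (restrictEven f hf).contDiff.contDiffOn fun _ h => h)

theorem isOpen_restrictEven (f : I → J) (hf : ∀ i, π' (f i) = π i) (hU : IsOpen U) :
    IsOpen (restrictEven f hf ⁻¹' U) := hU.preimage (restrictEven f hf).continuous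

theorem pderiv_extend (f : I → J) (hf : ∀ i, π' (f i) = π i) (hU : IsOpen U)
    (hF : ContDiffOn ℝ ∞ F U) {y : EvenIdx π' → ℝ} (hy : restrictEven f hf y ∈ U)
    (j : EvenIdx π') : pderiv j.1 (extend f hf F) y =
      extendOdd f hf (fderiv ℝ F (restrictEven f hf y) (restrictEven f hf (Pi.single j 1))) := by
  have h := (gr_linearMap_hasFDerivAt (extendOdd f hf).toLinearMap _).comp y
    ((hasFDerivAt_of_contDiffOn hU hF hy).comp y (restrictEven f hf).hasFDerivAt)
  rw [pderiv_evenIdx]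
  exact DFunLike.congr_fun h.fderiv _

theorem oddHom_extendOdd (f : I → J) (hf : ∀ i, π' (f i) = π i) (z : SPoint N π')
    (x : Gr (OddIdx π)) : z.oddHom (extendOdd f hf x) = (z.comap f hf).oddHom x := by
  have h : z.oddHom.comp (extendOdd f hf) = (z.comap f hf).oddHom := by
    apply ExteriorAlgebra.hom_ext
    ext i
    simp only [LinearMap.comp_apply, AlgHom.toLinearMap_apply, AlgHom.comp_apply, extendOdd,
      ExteriorAlgebra.map_apply_ι, LinearMap.single_apply, oddHom_ι]
    rw [Finset.sum_eq_single ⟨f i.1, (hf i.1).trans i.2⟩ _ (by simp),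
      Finset.sum_eq_single i (fun j _ hj => by rw [Pi.single_eq_of_ne hj, zero_smul]) (by simp)]
    · simp [SPoint.comap]
    · intro j _ hj
      simp [Pi.single_eq_of_ne hj]
  exact DFunLike.congr_fun h x

theorem taylorTerm_extend (f : I → J) (hf : ∀ i, π' (f i) = π i) (hinj : Function.Injective f)
    (hU : IsOpen U) {z : SPoint N π'} (hz : (z.comap f hf).body ∈ U) (k : ℕ) :
    ∀ {F : SuperFun π}, ContDiffOn ℝ ∞ F U →
      taylorTerm k (extend f hf F) z = taylorTerm k F (z.comap f hf) := by
  induction k with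
  | zero =>
    intro F hF
    rw [taylorTerm_zero, taylorTerm_zero, extend_apply, oddHom_extendOdd, SPoint.body_comap]
  | succ k ih =>
    intro F hF
    have hz' : z.body ∈ restrictEven f hf ⁻¹' U := hz
    have hU' := isOpen_restrictEven f hf hU
    have hn := hU'.mem_nhds hz'
    rw [taylorTerm_succ hU hF hz, taylorTerm_succ hU' (contDiffOn_extend f hf hF) hz']
    symm
    refine Fintype.sum_of_injective
      (fun i : EvenIdx π => (⟨f i.1, (hf i.1).trans i.2⟩ : EvenIdx π'))
      (fun i j hij => Subtype.ext (hinj (congrArg Subtype.val hij))) _ _ (fun j hj => ?_)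
      (fun i => ?_)
    · -- the function does not depend on the coordinates outside of the range of `f`
      have h0 : taylorTerm k (pderiv j.1 (extend f hf F)) z = 0 := by
        rw [taylorTerm_congr (G := (0 : SuperFun π'))
          (Filter.eventuallyEq_of_mem hn fun y hy => ?_) k]
        · have h := taylorTerm_const_smul isOpen_univ (F := (0 : SuperFun π')) contDiffOn_const
            (Set.mem_univ z.body) k 0
          rwa [zero_smul, zero_smul] at h
        · rw [pderiv_extend f hf hU hF hy]
          have : restrictEven f hf (Pi.single j (1 : ℝ)) = 0 := by
            ext i
            exact Pi.single_eq_of_ne (fun h => hj ⟨i, h⟩) _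
          rw [this, map_zero, map_zero]; rfl
      rw [h0, zero_mul]
    · rw [← ih (contDiffOn_pderiv hU hF i.1)]
      congr 1
      refine taylorTerm_congr (Filter.eventuallyEq_of_mem hn fun y hy => ?_) k
      rw [pderiv_extend f hf hU hF hy, extend_apply, pderiv_evenIdx]
      congr 2
      ext i'
      by_cases h : i' = i
      · subst h
        rw [Pi.single_eq_same]
        exact (Pi.single_eq_same (M := fun _ : EvenIdx π' => ℝ) _ _).symm
      · rw [Pi.single_eq_of_ne h]
        exact (Pi.single_eq_of_ne (M := fun _ : EvenIdx π' => ℝ)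
          (fun h' => h (Subtype.ext (hinj (congrArg Subtype.val h')))) _).symm

/-- The value of a function that does not depend on some of the coordinates. -/
theorem eval_extend (f : I → J) (hf : ∀ i, π' (f i) = π i) (hinj : Function.Injective f)
    (hU : IsOpen U) (hF : ContDiffOn ℝ ∞ F U) {z : SPoint N π'}
    (hz : (z.comap f hf).body ∈ U) : eval (extend f hf F) z = eval F (z.comap f hf) := by
  simp only [eval_eq_sum, taylorTerm_extend f hf hinj hU hz _ hF]

theorem dEval_extend (f : I → J) (hf : ∀ i, π' (f i) = π i) (hinj : Function.Injective f)
    (hU : IsOpen U) (hF : ContDiffOn ℝ ∞ F U) {z : SPoint N π'}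
    (hz : (z.comap f hf).body ∈ U) (δ : SPoint N π') :
    dEval (extend f hf F) z δ.val = dEval F (z.comap f hf) (δ.comap f hf).val := by
  have h1 := hasDerivAt_eval_zero hU hF hz (δ.comap f hf)
  have h2 := hasDerivAt_eval_zero (isOpen_restrictEven f hf hU) (contDiffOn_extend f hf hF)
    (show z.body ∈ _ from hz) δ
  refine h2.unique (h1.congr_of_eventuallyEq ?_)
  refine (eventually_body_mem hU hz (δ.comap f hf)).mono fun t ht => ?_
  exact eval_extend f hf hinj hU hF ht

/-! ### Naturality, and the generic point -/

theorem oddHom_emb (z : SPoint N π) (x : Gr (OddIdx π)) :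
    z.emb.oddHom x = grEmb N (z.oddHom x) := by
  have h : z.emb.oddHom = (grEmb N).comp z.oddHom := by
    apply ExteriorAlgebra.hom_ext
    ext i
    simp only [LinearMap.comp_apply, AlgHom.toLinearMap_apply, AlgHom.comp_apply,
      oddHom_ι, map_sum, map_smul]
    rfl
  exact DFunLike.congr_fun h x

theorem taylorTerm_emb (hU : IsOpen U) {z : SPoint N π} (hz : z.body ∈ U) (k : ℕ) :
    ∀ {F : SuperFun π}, ContDiffOn ℝ ∞ F U →
      taylorTerm k F z.emb = grEmb N (taylorTerm k F z) := by
  have hz' : z.emb.body ∈ U := by rwa [SPoint.body_emb]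
  induction k with
  | zero =>
    intro F hF
    rw [taylorTerm_zero, taylorTerm_zero, oddHom_emb, SPoint.body_emb]
  | succ k ih =>
    intro F hF
    rw [taylorTerm_succ hU hF hz, taylorTerm_succ hU hF hz', map_sum]
    refine Finset.sum_congr rfl fun i _ => ?_
    rw [ih (contDiffOn_pderiv hU hF i.1), map_mul, SPoint.soul_emb]

/-- Evaluation is compatible with the inclusion of Grassmann algebras. -/
theorem eval_emb (hU : IsOpen U) (hF : ContDiffOn ℝ ∞ F U) {z : SPoint N π}
    (hz : z.body ∈ U) : eval F z.emb = grEmb N (eval F z) := by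
  have h0 : taylorTerm (N + 1) F z = 0 :=
    eq_zero_of_mem_grFilt (Nat.lt_succ_self N) (taylorTerm_mem_grFilt hU hz (N + 1) hF)
  rw [eval_eq_sum, Finset.sum_range_succ, taylorTerm_emb hU hz _ hF, h0, map_zero, smul_zero,
    add_zero, eval_eq_sum, map_sum]
  refine Finset.sum_congr rfl fun k _ => ?_
  rw [taylorTerm_emb hU hz _ hF, map_smul]

theorem dEval_emb (hU : IsOpen U) (hF : ContDiffOn ℝ ∞ F U) {z : SPoint N π}
    (hz : z.body ∈ U) (δ : I → Gr (Fin N)) :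
    dEval F z.emb (fun i => grEmb N (δ i)) = grEmb N (dEval F z δ) := by
  simp only [dEval, map_sum, map_mul, eval_emb hU (contDiffOn_pderiv hU hF _) hz]

/-- The generic point over the real point `x`: its odd coordinates are independent generators. -/
def genericPoint (x : EvenIdx π → ℝ) : SPoint (Nat.card (OddIdx π)) π where
  val i := if h : π i = 0 then algebraMap ℝ _ (x ⟨i, h⟩)
    else ExteriorAlgebra.ι ℝ (Pi.single
      (Finite.equivFin (OddIdx π) ⟨i, eq_one_of_ne_zero h⟩) (1 : ℝ))
  mem i := by
    by_cases h : π i = 0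
    · rw [dif_pos h, h]; exact algebraMap_mem_grPart _
    · have e : grPart (Fin (Nat.card (OddIdx π))) (π i) = grPart _ 1 :=
        congrArg _ (eq_one_of_ne_zero h)
      rw [dif_neg h, e]
      exact ι_mem_grPart _

theorem genericPoint_even (x : EvenIdx π → ℝ) (i : EvenIdx π) :
    (genericPoint x).val i.1 = algebraMap ℝ _ (x i) := dif_pos i.2

theorem genericPoint_odd (x : EvenIdx π → ℝ) (i : OddIdx π) :
    (genericPoint x).val i.1 =
      ExteriorAlgebra.ι ℝ (Pi.single (Finite.equivFin (OddIdx π) i) (1 : ℝ)) :=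
  dif_neg (by rw [i.2]; decide)

@[simp] theorem body_genericPoint (x : EvenIdx π → ℝ) : (genericPoint x).body = x := by
  ext i
  rw [SPoint.body, genericPoint_even, grBody_algebraMap]

theorem oddHom_genericPoint_injective (x : EvenIdx π → ℝ) :
    Function.Injective (genericPoint x).oddHom := by
  let e := LinearEquiv.funCongrLeft ℝ ℝ (Finite.equivFin (OddIdx π)).symm
  have h : (genericPoint x).oddHom = ExteriorAlgebra.map e.toLinearMap := by
    apply ExteriorAlgebra.hom_ext
    ext i
    simp only [LinearMap.comp_apply, AlgHom.toLinearMap_apply, oddHom_ι,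
      ExteriorAlgebra.map_apply_ι, LinearMap.single_apply, genericPoint_odd]
    rw [Finset.sum_eq_single i (fun j _ hj => by rw [Pi.single_eq_of_ne hj, zero_smul]) (by simp),
      Pi.single_eq_same, one_smul]
    congr 1
    ext j
    simp [e, LinearMap.funLeft_apply, Pi.single_apply, Equiv.symm_apply_eq]
  rw [h]
  exact ExteriorAlgebra.map_injective ⟨e.symm.toLinearMap, by ext; simp⟩

/-- The even coordinates of the generic point have no souls, so only the first term of the Taylor
expansion is left. -/
theorem eval_genericPoint (F : SuperFun π) (x : EvenIdx π → ℝ) :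
    eval F (genericPoint x) = (genericPoint x).oddHom (F x) := by
  have hs : ∀ i, (genericPoint x).soul i = 0 := fun i => by
    rw [SPoint.soul, genericPoint_even, body_genericPoint, sub_self]
  rw [eval_eq_sum, Finset.sum_range_succ', taylorTerm_zero, body_genericPoint]
  have h0 : ∀ k, taylorTerm (k + 1) F (genericPoint x) = 0 := fun k => by
    simp [taylorTerm, hs, List.ofFn_succ]
  simp [h0]

/-- A function vanishes at a real point if it vanishes at all Grassmann-valued points over it. -/
theorem eq_zero_of_eval {x : EvenIdx π → ℝ}
    (h : ∀ (N : ℕ) (z : SPoint N π), z.body = x → eval F z = 0) : F x = 0 := by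
  have h1 := h _ (genericPoint x) (body_genericPoint x)
  rw [eval_genericPoint] at h1
  exact oddHom_genericPoint_injective x (by rw [h1, map_zero])

/-! ### First and second differentials -/

@[simp] theorem dEval_add (F : SuperFun π) (z : SPoint N π) (δ η : SPoint N π) :
    dEval F z (δ + η).val = dEval F z δ.val + dEval F z η.val := by
  simp [dEval, add_mul, Finset.sum_add_distrib]

@[simp] theorem dEval_smul (F : SuperFun π) (z : SPoint N π) (c : ℝ) (δ : SPoint N π) :
    dEval F z (c • δ).val = c • dEval F z δ.val := by
  simp [dEval, Finset.smul_sum]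

@[simp] theorem dEval_esmul (F : SuperFun π) (z : SPoint N π) (c : EvenGr N) (δ : SPoint N π) :
    dEval F z (c • δ).val = (c : Gr (Fin N)) * dEval F z δ.val := by
  simp [dEval, Finset.mul_sum, mul_assoc]

theorem dEval_congr (hU : IsOpen U) (h : Set.EqOn F G U) {z : SPoint N π} (hz : z.body ∈ U)
    (δ : I → Gr (Fin N)) : dEval F z δ = dEval G z δ := by
  simp only [dEval, eval_congr hU (pderiv_congr hU h _) hz]

/-- The differential of `M` along `δ`, up to a factor, from a formula for the values of `M`. -/
theorem mul_dEval_eq (hU : IsOpen U) (hF : ContDiffOn ℝ ∞ F U) {z : SPoint N π}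
    (hz : z.body ∈ U) (δ : SPoint N π) (θ : Gr (Fin N)) {φ : ℝ → Gr (Fin N)} {φ' : Gr (Fin N)}
    (hφ : HasDerivAt φ φ' 0)
    (h : ∀ t : ℝ, (z + t • δ).body ∈ U → θ * eval F (z + t • δ) = φ t) :
    θ * dEval F z δ.val = φ' :=
  (hasDerivAt_gr_const_mul θ (hasDerivAt_eval_zero hU hF hz δ)).unique
    (hφ.congr_of_eventuallyEq ((eventually_body_mem hU hz δ).mono fun t ht => h t ht))

/-- The second differential of `F` at the Grassmann-valued point `z`. -/
def d2Eval (F : SuperFun π) (z : SPoint N π) (δ η : I → Gr (Fin N)) : Gr (Fin N) :=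
  ∑ i, δ i * dEval (pderiv i F) z η

theorem hasDerivAt_dEval (hU : IsOpen U) (hF : ContDiffOn ℝ ∞ F U) {z : SPoint N π}
    (δ : I → Gr (Fin N)) (η : SPoint N π) {t : ℝ} (hz : (z + t • η).body ∈ U) :
    HasDerivAt (fun t : ℝ => dEval F (z + t • η) δ) (d2Eval F (z + t • η) δ η.val) t :=
  HasDerivAt.fun_sum fun i _ => hasDerivAt_gr_const_mul _
    (hasDerivAt_eval hU (contDiffOn_pderiv hU hF i) η hz)

theorem hasDerivAt_dEval_zero (hU : IsOpen U) (hF : ContDiffOn ℝ ∞ F U) {z : SPoint N π}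
    (δ : I → Gr (Fin N)) (η : SPoint N π) (hz : z.body ∈ U) :
    HasDerivAt (fun t : ℝ => dEval F (z + t • η) δ) (d2Eval F z δ η.val) 0 := by
  have h := hasDerivAt_dEval hU hF (z := z) δ η (t := 0) (by simpa using hz)
  have h0 : z + (0 : ℝ) • η = z := by simp
  rwa [h0] at h

theorem d2Eval_symm (hU : IsOpen U) (hF : ContDiffOn ℝ ∞ F U) {z : SPoint N π}
    (hz : z.body ∈ U) (δ η : SPoint N π) :
    d2Eval F z δ.val η.val = d2Eval F z η.val δ.val := by
  simp only [d2Eval, dEval, Finset.mul_sum]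
  rw [Finset.sum_comm]
  refine Finset.sum_congr rfl fun j _ => Finset.sum_congr rfl fun i _ => ?_
  have h : Set.EqOn (pderiv j (pderiv i F)) (sgn (π j * π i) • pderiv i (pderiv j F)) U :=
    fun x hx => pderiv_comm hU hF hx j i
  rw [eval_congr hU h hz, eval_const_smul hU
    (contDiffOn_pderiv hU (contDiffOn_pderiv hU hF j) i) hz, ← mul_assoc, ← mul_assoc,
    gr_mul_comm_sgn (δ.mem i) (η.mem j), mul_comm (π i), smul_mul_assoc, mul_smul_comm, smul_smul,
    sgn_mul_self, one_smul]

theorem d2Eval_add_left (F : SuperFun π) (z δ δ' η : SPoint N π) :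
    d2Eval F z (δ + δ').val η.val = d2Eval F z δ.val η.val + d2Eval F z δ'.val η.val := by
  simp [d2Eval, add_mul, Finset.sum_add_distrib]

theorem d2Eval_add_right (F : SuperFun π) (z δ η η' : SPoint N π) :
    d2Eval F z δ.val (η + η').val = d2Eval F z δ.val η.val + d2Eval F z δ.val η'.val := by
  simp [d2Eval, mul_add, Finset.sum_add_distrib]

end

/-! ### Separating elements of a Grassmann algebra by odd parameters -/

section

variable {I : Type} [Fintype I] [DecidableEq I] {π : I → ZMod 2}
  {U : Set (EvenIdx π → ℝ)} {F G : SuperFun π}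

/-- A function vanishes at a real point if its values over that point vanish after multiplication
with arbitrary elements of prescribed parities. -/
theorem eq_zero_of_prod_mul_eval (hU : IsOpen U) (hF : ContDiffOn ℝ ∞ F U) {x : EvenIdx π → ℝ}
    (hx : x ∈ U) (k : ℕ) : ∀ (i : Fin k → ZMod 2)
    (_ : ∀ (N : ℕ) (z : SPoint N π), z.body = x → ∀ θ : Fin k → Gr (Fin N),
      (∀ j, θ j ∈ grPart (Fin N) (i j)) → (List.ofFn θ).prod * eval F z = 0), F x = 0 := by
  induction k with
  | zero =>
    intro i h
    exact eq_zero_of_eval fun N z hz => by simpa using h N z hz ![] (fun j => j.elim0)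
  | succ k ih =>
    intro i h
    refine ih (fun j => i j.succ) fun N z hz θ hθ => ?_
    obtain ⟨θ₀, hθ₀, hinj⟩ := exists_faithful_multiplier N (i 0)
    apply hinj
    have h1 := h (N + 1) z.emb (by rwa [SPoint.body_emb]) (Fin.cons θ₀ fun j => grEmb N (θ j))
      (fun j => by
        refine Fin.cases ?_ (fun j => ?_) j
        · simpa using hθ₀
        · simpa using grEmb_mem (hθ j))
    rw [eval_emb hU hF (by rwa [hz])] at h1
    rw [List.ofFn_succ, List.prod_cons] at h1
    simp only [Fin.cons_zero, Fin.cons_succ] at h1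
    rw [map_mul, map_list_prod, List.map_ofFn, ← mul_assoc]
    exact h1

theorem eq_zero_of_mul_eval (hU : IsOpen U) (hF : ContDiffOn ℝ ∞ F U) {x : EvenIdx π → ℝ}
    (hx : x ∈ U) (i : ZMod 2) (h : ∀ (N : ℕ) (z : SPoint N π), z.body = x →
      ∀ θ ∈ grPart (Fin N) i, θ * eval F z = 0) : F x = 0 := by
  refine eq_zero_of_prod_mul_eval hU hF hx 1 ![i] fun N z hz θ hθ => ?_
  simpa using h N z hz (θ 0) (by simpa using hθ 0)

theorem eq_zero_of_mul_mul_eval (hU : IsOpen U) (hF : ContDiffOn ℝ ∞ F U) {x : EvenIdx π → ℝ}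
    (hx : x ∈ U) (i j : ZMod 2) (h : ∀ (N : ℕ) (z : SPoint N π), z.body = x →
      ∀ θ ∈ grPart (Fin N) i, ∀ θ' ∈ grPart (Fin N) j, θ * θ' * eval F z = 0) : F x = 0 := by
  refine eq_zero_of_prod_mul_eval hU hF hx 2 ![i, j] fun N z hz θ hθ => ?_
  simpa using h N z hz (θ 0) (by simpa using hθ 0) (θ 1) (by simpa using hθ 1)

/-- The point whose only nonzero coordinate is `x`, in the place `i`. -/
def SPoint.single {N : ℕ} (i : I) (x : Gr (Fin N)) (hx : x ∈ grPart (Fin N) (π i)) :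
    SPoint N π where
  val := Pi.single i x
  mem j := by
    by_cases h : j = i
    · subst h; rwa [Pi.single_eq_same]
    · rw [Pi.single_eq_of_ne h]; exact Submodule.zero_mem _

theorem dEval_pi_single {N : ℕ} (F : SuperFun π) (z : SPoint N π) (i : I) (x : Gr (Fin N)) :
    dEval F z (Pi.single i x) = x * eval (pderiv i F) z := by
  rw [dEval, Finset.sum_eq_single i (fun j _ hj => by rw [Pi.single_eq_of_ne hj, zero_mul])
    (by simp), Pi.single_eq_same]

theorem d2Eval_pi_single {N : ℕ} (F : SuperFun π) (z : SPoint N π) (i j : I) (x y : Gr (Fin N)) :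
    d2Eval F z (Pi.single i x) (Pi.single j y) = x * (y * eval (pderiv j (pderiv i F)) z) := by
  rw [d2Eval, Finset.sum_eq_single i (fun j _ hj => by rw [Pi.single_eq_of_ne hj, zero_mul])
    (by simp), Pi.single_eq_same, dEval_pi_single]

end

/-! ### Directions of rank one -/

section

variable {N : ℕ} {R C : Type} {ρ : R → ZMod 2} {κ : C → ZMod 2}

/-- The even array of rank one with the entries `b_i c^K`. -/
def outer (b : SPoint N ρ) (c : SPoint N κ) : SPoint N (fun ij : R × C => ρ ij.1 + κ ij.2) where
  val ij := b.val ij.1 * c.val ij.2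
  mem ij := gr_mul_mem (b.mem ij.1) (c.mem ij.2)

theorem outer_val (b : SPoint N ρ) (c : SPoint N κ) (ij : R × C) :
    (outer b c).val ij = b.val ij.1 * c.val ij.2 := rfl

theorem outer_add_left (b b' : SPoint N ρ) (c : SPoint N κ) :
    outer (b + b') c = outer b c + outer b' c := by
  ext ij; exact add_mul _ _ _

theorem outer_add_right (b : SPoint N ρ) (c c' : SPoint N κ) :
    outer b (c + c') = outer b c + outer b c' := by
  ext ij; exact mul_add _ _ _

theorem outer_esmul_left (e : EvenGr N) (b : SPoint N ρ) (c : SPoint N κ) :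
    outer (e • b) c = e • outer b c := by
  ext ij; exact mul_assoc _ _ _

theorem outer_esmul_right (e : EvenGr N) (b : SPoint N ρ) (c : SPoint N κ) :
    outer b (e • c) = e • outer b c := by
  ext ij
  change b.val ij.1 * ((e : Gr (Fin N)) * c.val ij.2) = e * (b.val ij.1 * c.val ij.2)
  rw [← mul_assoc, ← mul_assoc, e.comm]

theorem outer_smul_left (t : ℝ) (b : SPoint N ρ) (c : SPoint N κ) :
    outer (t • b) c = t • outer b c := by
  ext ij; exact smul_mul_assoc t (b.val ij.1) (c.val ij.2)

theorem outer_smul_right (t : ℝ) (b : SPoint N ρ) (c : SPoint N κ) :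
    outer b (t • c) = t • outer b c := by
  ext ij; exact mul_smul_comm t (b.val ij.1) (c.val ij.2)

theorem gr_mul_mul_reverse {i j k : ZMod 2} {x y w : Gr (Fin N)} (hx : x ∈ grPart (Fin N) i)
    (hy : y ∈ grPart (Fin N) j) (hw : w ∈ grPart (Fin N) k) :
    x * y * w = sgn (i * j + i * k + j * k) • (w * y * x) := by
  rw [gr_mul_comm_sgn hx hy, smul_mul_assoc, mul_assoc, gr_mul_comm_sgn hx hw, mul_smul_comm,
    ← mul_assoc, gr_mul_comm_sgn hy hw, smul_mul_assoc, smul_smul, smul_smul, sgn_add, sgn_add]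

end

section

variable {n m r s p q N : ℕ} {L : MixedFun n m r s p q}

theorem admissible_congr {n' r' p' : ℕ} {x : EvenIdx (coordPar n m r s p q) → ℝ}
    {y : EvenIdx (coordPar n' m r' s p' q) → ℝ} (h : ∀ i k, oddEntry y i k = oddEntry x i k)
    (hx : x ∈ admissible n m r s p q) : y ∈ admissible n' m r' s p' q := by
  refine ⟨?_, ?_⟩
  · have e : (fun (k : Fin q) (i : Fin m ⊕ Fin s) => oddEntry y i k) =
      fun k i => oddEntry x i k := funext fun k => funext fun i => h i k
    rw [e]; exact hx.1
  · have e : (fun (f : Fin s) (k : Fin q) => oddEntry y (Sum.inr f) k) =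
      fun f k => oddEntry x (Sum.inr f) k := funext fun f => funext fun k => h _ k
    rw [e]; exact hx.2

theorem isOpen_admissible (n m r s p q : ℕ) : IsOpen (admissible n m r s p q) := by
  refine IsOpen.inter ?_ ?_
  · refine isOpen_setOfPred_linearIndependent.preimage
      (f := fun (x : EvenIdx (coordPar n m r s p q) → ℝ) (k : Fin q) (i : Fin m ⊕ Fin s) =>
        oddEntry x i k) ?_
    exact continuous_pi fun k => continuous_pi fun i => continuous_apply _
  · refine isOpen_setOfPred_linearIndependent.preimage
      (f := fun (x : EvenIdx (coordPar n m r s p q) → ℝ) (f : Fin s) (k : Fin q) =>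
        oddEntry x (Sum.inr f) k) ?_
    exact continuous_pi fun k => continuous_pi fun i => continuous_apply _

/-- The body of an array of rank one has no odd-odd entries, so adding it preserves
admissibility. -/
theorem admissible_add_outer {z : SPoint N (coordPar n m r s p q)}
    (hz : z.body ∈ admissible n m r s p q) (b : SPoint N (rowPar (n := n) (m := m) (r := r)
      (s := s))) (c : SPoint N (par (a := p) (b := q))) :
    (z + outer b c).body ∈ admissible n m r s p q := by
  refine admissible_congr (fun i k => ?_) hz
  have h : grBody N (b.val (Sum.map Sum.inr Sum.inr i) * c.val (Sum.inr k)) = 0 := by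
    rw [map_mul, grBody_odd (c.mem (Sum.inr k)), mul_zero]
  rw [SPoint.body_add]
  refine (congrArg (z.body _ + ·) h).trans (add_zero _)

/-- Smooth functions of admissible arrays with the second-order equations of mixed forms. -/
structure IsPreForm (L : MixedFun n m r s p q) : Prop where
  smooth : ContDiffOn ℝ ∞ L (admissible n m r s p q)
  equations : ∀ (i j : Row n m r s) (K M : Idx p q), ∀ x ∈ admissible n m r s p q,
    pderiv (i, K) (pderiv (j, M) L) x +
      sgn (rowPar i * rowPar j + (rowPar i + rowPar j) * par M) •
        pderiv (j, K) (pderiv (i, M) L) x = 0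

theorem IsMixedForm.isPreForm (hL : IsMixedForm n m r s p q L) : IsPreForm L :=
  ⟨hL.smooth, hL.equations⟩

/-- The second-order equations say that the second differential, on directions of rank one, is
skew-symmetric with respect to the row factors. -/
theorem IsPreForm.d2Eval_swap (hL : IsPreForm L) {z : SPoint N (coordPar n m r s p q)}
    (hz : z.body ∈ admissible n m r s p q) (b b' : SPoint N (rowPar (n := n) (m := m) (r := r)
      (s := s))) (c c' : SPoint N (par (a := p) (b := q))) :
    d2Eval L z (outer b c).val (outer b' c').val +
      d2Eval L z (outer b' c).val (outer b c').val = 0 := by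
  have hU := isOpen_admissible n m r s p q
  have hsm := hL.smooth
  have key : ∀ (i j : Row n m r s) (K M : Idx p q),
      eval (pderiv (i, K) (pderiv (j, M) L)) z =
        -(sgn (rowPar i * rowPar j + (rowPar i + rowPar j) * par M) •
          eval (pderiv (j, K) (pderiv (i, M) L)) z) := by
    intro i j K M
    have h : Set.EqOn (pderiv (i, K) (pderiv (j, M) L))
        ((-sgn (rowPar i * rowPar j + (rowPar i + rowPar j) * par M)) •
          pderiv (j, K) (pderiv (i, M) L)) (admissible n m r s p q) := fun x hx => by
      rw [eq_neg_of_add_eq_zero_left (hL.equations i j K M x hx), Pi.smul_apply, neg_smul]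
    rw [eval_congr hU h hz,
      eval_const_smul hU (contDiffOn_pderiv hU (contDiffOn_pderiv hU hsm _) _) hz, neg_smul]
  simp only [d2Eval, dEval, Finset.mul_sum, Fintype.sum_prod_type, outer_val]
  have hsplit : ∀ f : Row n m r s → Idx p q → Row n m r s → Idx p q → Gr (Fin N),
      ∑ j, ∑ M, ∑ i, ∑ K, f j M i K = ∑ M, ∑ K, ∑ i, ∑ j, f j M i K := by
    intro f
    rw [Finset.sum_comm]
    refine Finset.sum_congr rfl fun M _ => ?_
    rw [Finset.sum_comm' (t' := Finset.univ) (s' := fun _ => Finset.univ) (by simp)]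
    rw [Finset.sum_congr rfl fun i _ => Finset.sum_comm, Finset.sum_comm]
  rw [hsplit, hsplit, ← Finset.sum_add_distrib]
  refine Finset.sum_eq_zero fun M _ => ?_
  rw [← Finset.sum_add_distrib]
  refine Finset.sum_eq_zero fun K _ => ?_
  rw [Finset.sum_comm (f := fun i j => b'.val j * c.val M * (b.val i * c'.val K *
    eval (pderiv (i, K) (pderiv (j, M) L)) z)), ← Finset.sum_add_distrib]
  refine Finset.sum_eq_zero fun i _ => ?_
  rw [← Finset.sum_add_distrib]
  refine Finset.sum_eq_zero fun j _ => ?_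
  rw [key i j K M]
  simp only [← mul_assoc, mul_neg, mul_smul_comm]
  -- the sign in the equations is that of reversing the product of the three coefficients
  rw [gr_mul_mul_reverse (b.mem j) (c.mem M) (b'.mem i)]
  simp only [smul_mul_assoc, smul_smul]
  have hs : sgn (rowPar i * rowPar j + (rowPar i + rowPar j) * par M) *
      sgn (rowPar j * par M + rowPar j * rowPar i + par M * rowPar i) = 1 := by
    rw [← sgn_mul_self (rowPar i * rowPar j + (rowPar i + rowPar j) * par M)]
    congr 2; ring
  rw [hs, one_smul, neg_add_cancel]

theorem IsPreForm.d2Eval_same_row (hL : IsPreForm L) {z : SPoint N (coordPar n m r s p q)}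
    (hz : z.body ∈ admissible n m r s p q) (b : SPoint N (rowPar (n := n) (m := m) (r := r)
      (s := s))) (c c' : SPoint N (par (a := p) (b := q))) :
    d2Eval L z (outer b c).val (outer b c').val = 0 := by
  have h := hL.d2Eval_swap hz b b c c'
  rw [← two_smul ℝ] at h
  exact (smul_eq_zero.mp h).resolve_left two_ne_zero

theorem IsPreForm.d2Eval_same_col (hL : IsPreForm L) {z : SPoint N (coordPar n m r s p q)}
    (hz : z.body ∈ admissible n m r s p q) (b b' : SPoint N (rowPar (n := n) (m := m) (r := r)
      (s := s))) (c : SPoint N (par (a := p) (b := q))) :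
    d2Eval L z (outer b c).val (outer b' c).val = 0 := by
  have h := hL.d2Eval_swap hz b b' c c
  rw [d2Eval_symm (isOpen_admissible n m r s p q) hL.smooth hz (outer b' c) (outer b c),
    ← two_smul ℝ] at h
  exact (smul_eq_zero.mp h).resolve_left two_ne_zero

theorem IsPreForm.dEval_line (hL : IsPreForm L) {z : SPoint N (coordPar n m r s p q)}
    (hz : z.body ∈ admissible n m r s p q) (b : SPoint N (rowPar (n := n) (m := m) (r := r)
      (s := s))) (c : SPoint N (par (a := p) (b := q))) (t : ℝ) :
    dEval L (z + t • outer b c) (outer b c).val = dEval L z (outer b c).val := by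
  have hz' : ∀ t : ℝ, (z + t • outer b c).body ∈ admissible n m r s p q := fun t => by
    rw [← outer_smul_left]; exact admissible_add_outer hz _ _
  have h : ∀ t : ℝ, HasDerivAt (fun t : ℝ => dEval L (z + t • outer b c) (outer b c).val) 0 t :=
    fun t => by
      have h := hasDerivAt_dEval (isOpen_admissible n m r s p q) hL.smooth (outer b c).val
        (outer b c) (hz' t)
      rwa [hL.d2Eval_same_row (hz' t)] at h
  have h2 := is_const_of_deriv_eq_zero (fun t => (h t).differentiableAt) (fun t => (h t).deriv) t 0
  simpa using h2

/-- Functions with the second-order equations are affine in directions of rank one. -/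
theorem IsPreForm.eval_add_outer (hL : IsPreForm L) {z : SPoint N (coordPar n m r s p q)}
    (hz : z.body ∈ admissible n m r s p q) (b : SPoint N (rowPar (n := n) (m := m) (r := r)
      (s := s))) (c : SPoint N (par (a := p) (b := q))) :
    eval L (z + outer b c) = eval L z + dEval L z (outer b c).val := by
  have hz' : ∀ t : ℝ, (z + t • outer b c).body ∈ admissible n m r s p q := fun t => by
    rw [← outer_smul_left]; exact admissible_add_outer hz _ _
  have h : ∀ t : ℝ, HasDerivAt (fun t : ℝ => eval L (z + t • outer b c) -
      t • dEval L z (outer b c).val) 0 t := fun t => by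
    have h := (hasDerivAt_eval (isOpen_admissible n m r s p q) hL.smooth (outer b c) (hz' t)).sub
      ((hasDerivAt_id t).smul_const (dEval L z (outer b c).val))
    rw [hL.dEval_line hz, one_smul, sub_self] at h
    exact h
  have h2 := is_const_of_deriv_eq_zero (fun t => (h t).differentiableAt) (fun t => (h t).deriv) 1 0
  simp only [one_smul, zero_smul, add_zero, sub_zero] at h2
  rw [← h2, sub_add_cancel]

theorem IsPreForm.dEval_add_outer (hL : IsPreForm L) {z : SPoint N (coordPar n m r s p q)}
    (hz : z.body ∈ admissible n m r s p q) (b : SPoint N (rowPar (n := n) (m := m) (r := r)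
      (s := s))) (c : SPoint N (par (a := p) (b := q))) (δ : SPoint N (coordPar n m r s p q)) :
    dEval L (z + outer b c) δ.val = dEval L z δ.val + d2Eval L z (outer b c).val δ.val := by
  have hU := isOpen_admissible n m r s p q
  have h1 := hasDerivAt_eval_zero hU hL.smooth (admissible_add_outer hz b c) δ
  have h2 := (hasDerivAt_eval_zero hU hL.smooth hz δ).add
    (hasDerivAt_dEval_zero hU hL.smooth (outer b c).val δ hz)
  refine h1.unique (h2.congr_of_eventuallyEq ((eventually_body_mem hU hz δ).mono fun t ht => ?_))
  have e := hL.eval_add_outer ht b c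
  rw [add_right_comm] at e
  exact e

/-- The second-order equations hold if the second differential vanishes on rank-one directions at
all Grassmann-valued points. -/
theorem IsPreForm.of_d2Eval (hL : ContDiffOn ℝ ∞ L (admissible n m r s p q))
    (h : ∀ (N : ℕ) (z : SPoint N (coordPar n m r s p q)), z.body ∈ admissible n m r s p q →
      ∀ (b : SPoint N (rowPar (n := n) (m := m) (r := r) (s := s)))
        (c : SPoint N (par (a := p) (b := q))),
        d2Eval L z (outer b c).val (outer b c).val = 0) : IsPreForm L := by
  refine ⟨hL, fun i j K M x hx => ?_⟩
  have hU := isOpen_admissible n m r s p q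
  set σ := sgn (rowPar i * rowPar j + (rowPar i + rowPar j) * par M) with hσ
  have hs1 := contDiffOn_pderiv hU (contDiffOn_pderiv hU hL (j, M)) (i, K)
  have hs2 := contDiffOn_pderiv hU (contDiffOn_pderiv hU hL (i, M)) (j, K)
  have hs3 : ContDiffOn ℝ ∞ (σ • pderiv (j, K) (pderiv (i, M) L)) (admissible n m r s p q) :=
    hs2.const_smul σ
  -- the parameters have the parities of the two rows and the two columns
  refine eq_zero_of_prod_mul_eval (F := pderiv (i, K) (pderiv (j, M) L) +
    σ • pderiv (j, K) (pderiv (i, M) L)) hU (hs1.add hs3) hx 4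
    ![rowPar j, par M, rowPar i, par K] fun N z hz θ hθ => ?_
  have hz' : z.body ∈ admissible n m r s p q := by rwa [hz]
  let b : SPoint N (rowPar (n := n) (m := m) (r := r) (s := s)) :=
    SPoint.single j (θ 0) (by simpa using hθ 0)
  let b' : SPoint N (rowPar (n := n) (m := m) (r := r) (s := s)) :=
    SPoint.single i (θ 2) (by simpa using hθ 2)
  let c : SPoint N (par (a := p) (b := q)) := SPoint.single M (θ 1) (by simpa using hθ 1)
  let c' : SPoint N (par (a := p) (b := q)) := SPoint.single K (θ 3) (by simpa using hθ 3)
  have hsym := d2Eval_symm hU hL hz'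
  -- polarisation with respect to both factors
  have e1 := h N z hz' (b + b') c
  have e2 := h N z hz' (b + b') c'
  have e3 := h N z hz' b (c + c')
  have e4 := h N z hz' b' (c + c')
  have e5 := h N z hz' (b + b') (c + c')
  simp only [outer_add_left, outer_add_right, d2Eval_add_left, d2Eval_add_right, h N z hz', zero_add,
    add_zero] at e1 e2 e3 e4 e5
  have e6 : (2 : ℝ) • (d2Eval L z (outer b c).val (outer b' c').val +
      d2Eval L z (outer b' c).val (outer b c').val) = 0 := by
    rw [hsym (outer b' c') (outer b c), hsym (outer b c') (outer b' c)] at e5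
    rw [two_smul]
    linear_combination (norm := module) e5 - e1 - e2 - e3 - e4
  have e7 := (smul_eq_zero.mp e6).resolve_left two_ne_zero
  have houter : ∀ (i : Row n m r s) (K : Idx p q) (x y : Gr (Fin N)) hx hy,
      (outer (SPoint.single (π := rowPar (n := n) (m := m) (r := r) (s := s)) i x hx)
        (SPoint.single (π := par (a := p) (b := q)) K y hy)).val = Pi.single (i, K) (x * y) := by
    intro i K x y hx hy
    ext ⟨i', K'⟩
    rw [outer_val]
    by_cases h1 : i' = i
    · by_cases h2 : K' = K
      · subst h1 h2; simp [SPoint.single]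
      · rw [Pi.single_eq_of_ne (by simp [h2])]; simp [SPoint.single, h2]
    · rw [Pi.single_eq_of_ne (by simp [h1])]; simp [SPoint.single, h1]
  have o1 : (outer b c).val = Pi.single (j, M) (θ 0 * θ 1) := houter _ _ _ _ _ _
  have o2 : (outer b' c').val = Pi.single (i, K) (θ 2 * θ 3) := houter _ _ _ _ _ _
  have o3 : (outer b' c).val = Pi.single (i, M) (θ 2 * θ 1) := houter _ _ _ _ _ _
  have o4 : (outer b c').val = Pi.single (j, K) (θ 0 * θ 3) := houter _ _ _ _ _ _
  rw [o1, o2, o3, o4, d2Eval_pi_single, d2Eval_pi_single] at e7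
  rw [eval_add hU hs1 hs3 hz', eval_const_smul hU hs2 hz']
  have h3 := gr_mul_mul_reverse (show θ 2 ∈ _ by simpa using hθ 2)
    (show θ 1 ∈ _ by simpa using hθ 1) (show θ 0 ∈ _ by simpa using hθ 0)
  have hs : rowPar i * par M + rowPar i * rowPar j + par M * rowPar j =
      rowPar i * rowPar j + (rowPar i + rowPar j) * par M := by ring
  simp only [← mul_assoc] at e7
  rw [h3] at e7
  rw [← e7]
  simp [hs, hσ, mul_add, mul_assoc]

end

/-! ### Even supermatrices -/

section

variable {N : ℕ} {R S T C : Type} {ρ : R → ZMod 2} {τ : S → ZMod 2} {υ : T → ZMod 2}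
  {κ : C → ZMod 2}

theorem SMat.toMatrix_injective : Function.Injective (SMat.toMatrix (N := N) (ρ := ρ) (κ := κ)) :=
  fun _ _ h => SPoint.ext (funext fun ij => congrFun (congrFun h ij.1) ij.2)

theorem SMat.toMatrix_mul [Fintype S] (M : SMat N ρ τ) (M' : SMat N τ κ) :
    (SMat.mul M M').toMatrix = M.toMatrix * M'.toMatrix := rfl

theorem SMat.mul_val [Fintype S] (M : SMat N ρ τ) (M' : SMat N τ κ) (ij : R × C) :
    (SMat.mul M M').val ij = ∑ k, M.val (ij.1, k) * M'.val (k, ij.2) := rfl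

theorem SMat.mul_assoc [Fintype S] [Fintype T] (M : SMat N ρ τ) (M' : SMat N τ υ)
    (M'' : SMat N υ κ) : SMat.mul (SMat.mul M M') M'' = SMat.mul M (SMat.mul M' M'') :=
  SMat.toMatrix_injective (Matrix.mul_assoc M.toMatrix M'.toMatrix M''.toMatrix)

theorem SMat.mul_add [Fintype S] (M : SMat N ρ τ) (M' M'' : SMat N τ κ) :
    SMat.mul M (M' + M'') = SMat.mul M M' + SMat.mul M M'' :=
  SMat.toMatrix_injective (Matrix.mul_add M.toMatrix M'.toMatrix M''.toMatrix)

theorem SMat.add_mul [Fintype S] (M M' : SMat N ρ τ) (M'' : SMat N τ κ) :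
    SMat.mul (M + M') M'' = SMat.mul M M'' + SMat.mul M' M'' :=
  SMat.toMatrix_injective (Matrix.add_mul M.toMatrix M'.toMatrix M''.toMatrix)

theorem SMat.mul_smul [Fintype S] (t : ℝ) (M : SMat N ρ τ) (M' : SMat N τ κ) :
    SMat.mul M (t • M') = t • SMat.mul M M' :=
  SMat.toMatrix_injective (Matrix.mul_smul M.toMatrix t M'.toMatrix)

theorem SMat.smul_mul [Fintype S] (t : ℝ) (M : SMat N ρ τ) (M' : SMat N τ κ) :
    SMat.mul (t • M) M' = t • SMat.mul M M' :=
  SMat.toMatrix_injective (Matrix.smul_mul t M.toMatrix M'.toMatrix)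

/-- The unit supermatrix. -/
def SMat.unit (N : ℕ) [DecidableEq C] (κ : C → ZMod 2) : SMat N κ κ where
  val ij := (1 : Matrix C C (Gr (Fin N))) ij.1 ij.2
  mem ij := by
    by_cases h : ij.1 = ij.2
    · rw [h, Matrix.one_apply_eq]
      have h0 : ∀ a : ZMod 2, a + a = 0 := by decide
      rw [h0]
      exact one_mem_grPart
    · rw [Matrix.one_apply_ne h]; exact Submodule.zero_mem _

instance [Fintype C] [DecidableEq C] : Monoid (SMat N κ κ) where
  mul := SMat.mul
  one := SMat.unit N κ
  mul_assoc := SMat.mul_assoc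
  one_mul M := SMat.toMatrix_injective (_root_.one_mul M.toMatrix)
  mul_one M := SMat.toMatrix_injective (_root_.mul_one M.toMatrix)

theorem SMat.mul_eq [Fintype C] [DecidableEq C] (M M' : SMat N κ κ) : M * M' = SMat.mul M M' := rfl

theorem SMat.toMatrix_one [Fintype C] [DecidableEq C] : SMat.toMatrix (1 : SMat N κ κ) = 1 := rfl

theorem SMat.one_val [Fintype C] [DecidableEq C] (ij : C × C) :
    (1 : SMat N κ κ).val ij = if ij.1 = ij.2 then 1 else 0 := rfl

theorem SMat.mul_one' [Fintype C] [DecidableEq C] (M : SMat N ρ κ) :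
    SMat.mul M (1 : SMat N κ κ) = M := SMat.toMatrix_injective (_root_.Matrix.mul_one M.toMatrix)

theorem SMat.isUnit_toMatrix [Fintype C] [DecidableEq C] {M : SMat N κ κ} (h : IsUnit M) :
    IsUnit M.toMatrix := by
  obtain ⟨u, rfl⟩ := h
  refine ⟨⟨SMat.toMatrix u.val, SMat.toMatrix u.inv, ?_, ?_⟩, rfl⟩
  · rw [← SMat.toMatrix_mul, ← SMat.mul_eq, u.val_inv]; rfl
  · rw [← SMat.toMatrix_mul, ← SMat.mul_eq, u.inv_val]; rfl

/-- The product of a row vector and a supermatrix. -/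
def vecMul [Fintype S] (y : SPoint N τ) (h : SMat N τ κ) : SPoint N κ where
  val K := ∑ k, y.val k * h.val (k, K)
  mem K := Submodule.sum_mem _ fun k _ => by
    have h := gr_mul_mem (y.mem k) (h.mem (k, K))
    have e : ∀ a b : ZMod 2, a + (a + b) = b := by decide
    rwa [e] at h

/-- The product of a supermatrix and a column vector. -/
def mulVec [Fintype S] (h : SMat N ρ τ) (c : SPoint N τ) : SPoint N ρ where
  val i := ∑ k, h.val (i, k) * c.val k
  mem i := Submodule.sum_mem _ fun k _ => by
    have h := gr_mul_mem (h.mem (i, k)) (c.mem k)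
    have e : ∀ a b : ZMod 2, a + b + b = a := by decide
    rwa [e] at h

theorem mulVec_val [Fintype S] (h : SMat N ρ τ) (c : SPoint N τ) (i : R) :
    (mulVec h c).val i = ∑ k, h.val (i, k) * c.val k := rfl

theorem vecMul_val [Fintype S] (y : SPoint N τ) (h : SMat N τ κ) (K : C) :
    (vecMul y h).val K = ∑ k, y.val k * h.val (k, K) := rfl

theorem SMat.mul_outer [Fintype S] (z : SMat N ρ τ) (c : SPoint N τ) (y : SPoint N κ) :
    SMat.mul z (outer c y) = outer (mulVec z c) y := by
  ext ij
  simp only [SMat.mul_val, outer_val, mulVec_val, Finset.sum_mul, _root_.mul_assoc]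

theorem SMat.outer_mul [Fintype S] (b : SPoint N ρ) (y : SPoint N τ) (h : SMat N τ κ) :
    SMat.mul (outer b y) h = outer b (vecMul y h) := by
  ext ij
  simp only [SMat.mul_val, outer_val, vecMul_val, Finset.mul_sum, _root_.mul_assoc]

theorem vecMul_one [Fintype C] [DecidableEq C] (y : SPoint N κ) :
    vecMul y (1 : SMat N κ κ) = y := by
  ext K
  simp [vecMul_val, SMat.one_val]

theorem vecMul_mul [Fintype S] [Fintype T] (y : SPoint N τ) (h : SMat N τ υ) (h' : SMat N υ κ) :
    vecMul y (SMat.mul h h') = vecMul (vecMul y h) h' := by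
  ext K
  simp only [vecMul_val, SMat.mul_val, Finset.sum_mul, Finset.mul_sum, _root_.mul_assoc]
  exact Finset.sum_comm

end

/-! ### Blocks and Berezinians -/

section

variable {N a b : ℕ}

/-- Even supermatrices of size `a|b`. -/
abbrev SSq (N a b : ℕ) : Type := SMat N (par (a := a) (b := b)) (par (a := a) (b := b))

/-- The block-diagonal supermatrix with blocks `A`, `D`. -/
def blockDiag (A : Matrix (Fin a) (Fin a) (EvenGr N)) (D : Matrix (Fin b) (Fin b) (EvenGr N)) :
    SSq N a b where
  val
    | (Sum.inl i, Sum.inl j) => (A i j : Gr (Fin N))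
    | (Sum.inr i, Sum.inr j) => (D i j : Gr (Fin N))
    | (Sum.inl _, Sum.inr _) => 0
    | (Sum.inr _, Sum.inl _) => 0
  mem := by
    rintro ⟨i | i, j | j⟩
    · exact coe_mem_grPart _ (add_zero 0)
    · exact Submodule.zero_mem _
    · exact Submodule.zero_mem _
    · exact coe_mem_grPart _ (show (1 : ZMod 2) + 1 = 0 by decide)

/-- The block-unitriangular supermatrix with the even-odd block `x`. -/
def blockUpper (x : Fin a → Fin b → Gr (Fin N)) (hx : ∀ i j, x i j ∈ grPart (Fin N) 1) :
    SSq N a b where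
  val
    | (Sum.inl i, Sum.inl j) => (1 : Matrix _ _ _) i j
    | (Sum.inr i, Sum.inr j) => (1 : Matrix _ _ _) i j
    | (Sum.inl i, Sum.inr j) => x i j
    | (Sum.inr _, Sum.inl _) => 0
  mem := by
    rintro ⟨i | i, j | j⟩
    · have h := (1 : SSq N a b).mem (Sum.inl i, Sum.inl j)
      simpa [SMat.one_val, Matrix.one_apply] using h
    · exact hx i j
    · exact Submodule.zero_mem _
    · have h := (1 : SSq N a b).mem (Sum.inr i, Sum.inr j)
      simpa [SMat.one_val, Matrix.one_apply] using h

/-- The block-unitriangular supermatrix with the odd-even block `y`. -/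
def blockLower (y : Fin b → Fin a → Gr (Fin N)) (hy : ∀ i j, y i j ∈ grPart (Fin N) 1) :
    SSq N a b where
  val
    | (Sum.inl i, Sum.inl j) => (1 : Matrix _ _ _) i j
    | (Sum.inr i, Sum.inr j) => (1 : Matrix _ _ _) i j
    | (Sum.inl _, Sum.inr _) => 0
    | (Sum.inr i, Sum.inl j) => y i j
  mem := by
    rintro ⟨i | i, j | j⟩
    · have h := (1 : SSq N a b).mem (Sum.inl i, Sum.inl j)
      simpa [SMat.one_val, Matrix.one_apply] using h
    · exact Submodule.zero_mem _
    · exact hy i j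
    · have h := (1 : SSq N a b).mem (Sum.inr i, Sum.inr j)
      simpa [SMat.one_val, Matrix.one_apply] using h

/-- The inclusion of the even part, on matrices. -/
def coeMat {ι : Type} [Fintype ι] [DecidableEq ι] :
    Matrix ι ι (EvenGr N) →+* Matrix ι ι (Gr (Fin N)) :=
  RingHom.mapMatrix (CliffordAlgebra.even (0 : QuadraticForm ℝ (Fin N → ℝ))).val.toRingHom

theorem toMatrix_blockDiag (A : Matrix (Fin a) (Fin a) (EvenGr N))
    (D : Matrix (Fin b) (Fin b) (EvenGr N)) :
    (blockDiag A D).toMatrix = Matrix.fromBlocks (coeMat A) 0 0 (coeMat D) := by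
  ext (i | i) (j | j) <;> rfl

theorem toMatrix_blockUpper (x : Fin a → Fin b → Gr (Fin N)) (hx) :
    (blockUpper x hx).toMatrix = Matrix.fromBlocks 1 (Matrix.of x) 0 1 := by
  ext (i | i) (j | j) <;> rfl

theorem toMatrix_blockLower (y : Fin b → Fin a → Gr (Fin N)) (hy) :
    (blockLower y hy).toMatrix = Matrix.fromBlocks 1 0 (Matrix.of y) 1 := by
  ext (i | i) (j | j) <;> rfl

theorem blockDiag_one : blockDiag (1 : Matrix (Fin a) (Fin a) (EvenGr N))
    (1 : Matrix (Fin b) (Fin b) (EvenGr N)) = 1 := by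
  apply SMat.toMatrix_injective
  rw [toMatrix_blockDiag, map_one, map_one, Matrix.fromBlocks_one]; rfl

theorem blockDiag_mul (A A' : Matrix (Fin a) (Fin a) (EvenGr N))
    (D D' : Matrix (Fin b) (Fin b) (EvenGr N)) :
    blockDiag A D * blockDiag A' D' = blockDiag (A * A') (D * D') := by
  apply SMat.toMatrix_injective
  rw [SMat.mul_eq, SMat.toMatrix_mul, toMatrix_blockDiag, toMatrix_blockDiag, toMatrix_blockDiag,
    Matrix.fromBlocks_multiply, map_mul, map_mul]
  simp

theorem isUnit_blockDiag {A : Matrix (Fin a) (Fin a) (EvenGr N)}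
    {D : Matrix (Fin b) (Fin b) (EvenGr N)} (hA : IsUnit A.det) (hD : IsUnit D.det) :
    IsUnit (blockDiag A D) :=
  ⟨⟨blockDiag A D, blockDiag A⁻¹ D⁻¹,
    by rw [blockDiag_mul, Matrix.mul_nonsing_inv _ hA, Matrix.mul_nonsing_inv _ hD, blockDiag_one],
    by rw [blockDiag_mul, Matrix.nonsing_inv_mul _ hA, Matrix.nonsing_inv_mul _ hD,
      blockDiag_one]⟩, rfl⟩

theorem isUnit_blockUpper (x : Fin a → Fin b → Gr (Fin N)) (hx) : IsUnit (blockUpper x hx) := by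
  refine ⟨⟨blockUpper x hx, blockUpper (-x) (fun i j => Submodule.neg_mem _ (hx i j)), ?_, ?_⟩,
    rfl⟩ <;>
  · apply SMat.toMatrix_injective
    rw [SMat.mul_eq, SMat.toMatrix_mul, toMatrix_blockUpper, toMatrix_blockUpper,
      Matrix.fromBlocks_multiply, SMat.toMatrix_one, ← Matrix.fromBlocks_one]
    have : Matrix.of (-x) = -Matrix.of x := rfl
    simp only [this, Matrix.mul_zero, Matrix.zero_mul, Matrix.one_mul, Matrix.mul_one, add_zero,
      zero_add, neg_add_cancel, add_neg_cancel]

theorem isUnit_blockLower (y : Fin b → Fin a → Gr (Fin N)) (hy) : IsUnit (blockLower y hy) := by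
  refine ⟨⟨blockLower y hy, blockLower (-y) (fun i j => Submodule.neg_mem _ (hy i j)), ?_, ?_⟩,
    rfl⟩ <;>
  · apply SMat.toMatrix_injective
    rw [SMat.mul_eq, SMat.toMatrix_mul, toMatrix_blockLower, toMatrix_blockLower,
      Matrix.fromBlocks_multiply, SMat.toMatrix_one, ← Matrix.fromBlocks_one]
    have : Matrix.of (-y) = -Matrix.of y := rfl
    simp only [this, Matrix.mul_zero, Matrix.zero_mul, Matrix.one_mul, Matrix.mul_one, add_zero,
      zero_add, neg_add_cancel, add_neg_cancel]

theorem schurCorrection_eq_zero {g : SSq N a b}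
    (h : (∀ i k, g.val (Sum.inl i, Sum.inr k) = 0) ∨ ∀ l j, g.val (Sum.inr l, Sum.inl j) = 0) :
    schurCorrection g = 0 := by
  refine Matrix.ext fun i j => Subtype.ext ?_
  change ∑ k, ∑ l, g.val (Sum.inl i, Sum.inr k) * ((oddBlock g)⁻¹ k l : Gr (Fin N)) *
      g.val (Sum.inr l, Sum.inl j) = 0
  refine Finset.sum_eq_zero fun k _ => Finset.sum_eq_zero fun l _ => ?_
  rcases h with h | h <;> simp [h]

theorem evenBlock_of_one {g : SSq N a b}
    (h : ∀ i j, g.val (Sum.inl i, Sum.inl j) = (1 : Matrix _ _ _) i j) : evenBlock g = 1 := by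
  ext i j
  refine (h i j).trans ?_
  by_cases hij : i = j <;> simp [hij, Matrix.one_apply]

theorem oddBlock_of_one {g : SSq N a b}
    (h : ∀ i j, g.val (Sum.inr i, Sum.inr j) = (1 : Matrix _ _ _) i j) : oddBlock g = 1 := by
  ext i j
  refine (h i j).trans ?_
  by_cases hij : i = j <;> simp [hij, Matrix.one_apply]

theorem ber_blockDiag (A : Matrix (Fin a) (Fin a) (EvenGr N))
    (D : Matrix (Fin b) (Fin b) (EvenGr N)) :
    ber (blockDiag A D) = A.det * Ring.inverse D.det := by
  rw [ber, schurCorrection_eq_zero (Or.inl fun _ _ => rfl), sub_zero]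
  rfl

theorem ber_blockUpper (x : Fin a → Fin b → Gr (Fin N)) (hx) : ber (blockUpper x hx) = 1 := by
  rw [ber, schurCorrection_eq_zero (Or.inr fun _ _ => rfl), evenBlock_of_one fun _ _ => rfl,
    oddBlock_of_one fun _ _ => rfl]
  simp

theorem ber_blockLower (y : Fin b → Fin a → Gr (Fin N)) (hy) : ber (blockLower y hy) = 1 := by
  rw [ber, schurCorrection_eq_zero (Or.inl fun _ _ => rfl), evenBlock_of_one fun _ _ => rfl,
    oddBlock_of_one fun _ _ => rfl]
  simp

theorem ber_one : ber (1 : SSq N a b) = 1 := by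
  rw [← blockDiag_one, ber_blockDiag]; simp

/-- The underlying real matrix of a supermatrix. -/
def bodyMat {ι : Type} [Fintype ι] [DecidableEq ι] (N : ℕ) :
    Matrix ι ι (Gr (Fin N)) →+* Matrix ι ι ℝ := RingHom.mapMatrix (grBody N).toRingHom

/-- The diagonal blocks of an invertible supermatrix, and the numerator of its Berezinian, are
invertible. -/
theorem isUnit_blocks {g : SSq N a b} (hg : IsUnit g.toMatrix) :
    IsUnit (oddBlock g).det ∧ IsUnit (evenBlock g - schurCorrection g).det := by
  have h1 := (hg.map (bodyMat N))
  -- odd elements have no body, so the underlying real matrix is block-diagonal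
  have h2 : bodyMat N g.toMatrix = Matrix.fromBlocks ((evenBlock g).map (evenBody N)) 0 0
      ((oddBlock g).map (evenBody N)) := by
    ext (i | i) (j | j)
    · rfl
    · exact grBody_odd (g.mem (Sum.inl i, Sum.inr j))
    · exact grBody_odd (g.mem (Sum.inr i, Sum.inl j))
    · rfl
  rw [h2, Matrix.isUnit_iff_isUnit_det, Matrix.det_fromBlocks_zero₂₁, IsUnit.mul_iff] at h1
  have h3 : (evenBlock g - schurCorrection g).map (evenBody N) = (evenBlock g).map (evenBody N) := by
    ext i j
    rw [Matrix.map_apply, Matrix.sub_apply, map_sub, Matrix.map_apply, sub_eq_self]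
    change grBody N (∑ k, ∑ l, g.val (Sum.inl i, Sum.inr k) * ((oddBlock g)⁻¹ k l : Gr (Fin N)) *
      g.val (Sum.inr l, Sum.inl j)) = 0
    simp only [map_sum, map_mul]
    refine Finset.sum_eq_zero fun k _ => Finset.sum_eq_zero fun l _ => ?_
    rw [grBody_odd (g.mem (Sum.inl i, Sum.inr k)), zero_mul, zero_mul]
  constructor
  · apply isUnit_of_evenBody_ne_zero
    rw [RingHom.map_det]
    exact h1.2.ne_zero
  · apply isUnit_of_evenBody_ne_zero
    rw [RingHom.map_det, RingHom.mapMatrix_apply, h3]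
    exact h1.1.ne_zero

theorem sum_mul_coe_mem {x : Fin b → Gr (Fin N)} (hx : ∀ i, x i ∈ grPart (Fin N) 1)
    (e : Fin b → EvenGr N) : ∑ k, x k * (e k : Gr (Fin N)) ∈ grPart (Fin N) 1 :=
  Submodule.sum_mem _ fun k _ => by
    have h := gr_mul_mem (hx k) (e k).2
    rwa [add_zero] at h

/-- An invertible supermatrix is the product of a block-upper, a block-diagonal and a block-lower
one; the Berezinian can be read off. -/
theorem exists_blockDecomposition {g : SSq N a b} (hg : IsUnit g.toMatrix) :
    ∃ x hx y hy, g = blockUpper x hx *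
      blockDiag (evenBlock g - schurCorrection g) (oddBlock g) * blockLower y hy := by
  have hD := (isUnit_blocks hg).1
  set D := oddBlock g
  refine ⟨fun i j => ∑ k, g.val (Sum.inl i, Sum.inr k) * (D⁻¹ k j : Gr (Fin N)),
    fun i j => sum_mul_coe_mem (fun k => g.mem (Sum.inl i, Sum.inr k)) _,
    fun i j => ∑ k, g.val (Sum.inr k, Sum.inl j) * (D⁻¹ i k : Gr (Fin N)),
    fun i j => sum_mul_coe_mem (fun k => g.mem (Sum.inr k, Sum.inl j)) _, ?_⟩
  apply SMat.toMatrix_injective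
  rw [SMat.mul_eq, SMat.mul_eq, SMat.toMatrix_mul, SMat.toMatrix_mul, toMatrix_blockDiag,
    toMatrix_blockUpper, toMatrix_blockLower, Matrix.fromBlocks_multiply,
    Matrix.fromBlocks_multiply]
  set B : Matrix (Fin a) (Fin b) (Gr (Fin N)) := fun i k => g.val (Sum.inl i, Sum.inr k) with hB
  set C : Matrix (Fin b) (Fin a) (Gr (Fin N)) := fun i k => g.val (Sum.inr i, Sum.inl k) with hC
  have hx : (Matrix.of fun i j => ∑ k, g.val (Sum.inl i, Sum.inr k) * (D⁻¹ k j : Gr (Fin N))) =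
      B * coeMat D⁻¹ := rfl
  have hy : (Matrix.of fun i j => ∑ k, g.val (Sum.inr k, Sum.inl j) * (D⁻¹ i k : Gr (Fin N))) =
      coeMat D⁻¹ * C := by
    ext i j
    rw [Matrix.mul_apply, Matrix.of_apply]
    exact Finset.sum_congr rfl fun k _ => ((D⁻¹ i k).comm _).symm
  have h1 : coeMat D⁻¹ * coeMat D = 1 := by
    rw [← map_mul, Matrix.nonsing_inv_mul _ hD, map_one]
  have h2 : coeMat D * coeMat D⁻¹ = 1 := by
    rw [← map_mul, Matrix.mul_nonsing_inv _ hD, map_one]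
  have hS : coeMat (schurCorrection g) = B * coeMat D⁻¹ * C := by
    ext i j
    simp only [Matrix.mul_apply, Finset.sum_mul]
    rw [Finset.sum_comm]
    rfl
  have hg' : g.toMatrix = Matrix.fromBlocks (coeMat (evenBlock g)) B C (coeMat D) := by
    ext (i | i) (j | j) <;> rfl
  rw [hx, hy, hg', map_sub, hS]
  simp only [Matrix.one_mul, Matrix.mul_one, Matrix.mul_zero, Matrix.zero_mul, zero_add, add_zero]
  congr 1
  · rw [Matrix.mul_assoc (B * _), ← Matrix.mul_assoc (coeMat D), h2, Matrix.one_mul]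
    abel
  · rw [Matrix.mul_assoc, h1, Matrix.mul_one]
  · rw [← Matrix.mul_assoc, h2, Matrix.one_mul]

end

/-! ### Elementary supermatrices -/

section

variable {N a b : ℕ}

theorem det_one_add_single_same {ι R : Type*} [Fintype ι] [DecidableEq ι] [CommRing R] (i : ι)
    (x : R) : (1 + Matrix.single i i x : Matrix ι ι R).det = 1 + x := by
  have h : (1 + Matrix.single i i x : Matrix ι ι R) =
      Matrix.diagonal (Function.update 1 i (1 + x)) := by
    ext j k
    by_cases hjk : j = k
    · subst hjk
      by_cases hij : i = j
      · subst hij; simp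
      · simp [hij, Function.update_of_ne (Ne.symm hij)]
    · rw [Matrix.diagonal_apply_ne _ hjk, Matrix.add_apply, Matrix.one_apply_ne hjk,
        Matrix.single_apply, if_neg (fun h => hjk (h.1.symm.trans h.2)), zero_add]
  rw [h, Matrix.det_diagonal, Finset.prod_update_of_mem (Finset.mem_univ i)]
  simp

theorem ring_inverse_eq {R : Type*} [CommRing R] {x y : R} (h : x * y = 1) :
    Ring.inverse x = y := by
  have := Ring.inverse_unit (⟨x, y, h, by rw [mul_comm, h]⟩ : Rˣ)
  exact this

/-- The product of two elements of the same parity, as an even element. -/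
def evenMul {i : ZMod 2} {x y : Gr (Fin N)} (hx : x ∈ grPart (Fin N) i)
    (hy : y ∈ grPart (Fin N) i) : EvenGr N :=
  ⟨x * y, by
    have h := gr_mul_mem hx hy
    have e : ∀ i : ZMod 2, i + i = 0 := by decide
    rwa [e] at h⟩

/-- The elementary supermatrix with the entry `x * y` in row `K` and column `M`, added to the
unit matrix. -/
def elementary (K M : Idx a b) {x y : Gr (Fin N)} (hx : x ∈ grPart (Fin N) (par K))
    (hy : y ∈ grPart (Fin N) (par M)) : SSq N a b :=
  1 + outer (SPoint.single (π := par) K x hx) (SPoint.single (π := par) M y hy)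

theorem elementary_val (K M : Idx a b) {x y : Gr (Fin N)} (hx : x ∈ grPart (Fin N) (par K))
    (hy : y ∈ grPart (Fin N) (par M)) (i j : Idx a b) : (elementary K M hx hy).val (i, j) =
      (if i = j then 1 else 0) + if i = K ∧ j = M then x * y else 0 := by
  change (if i = j then (1 : Gr (Fin N)) else 0) +
    (Pi.single K x : Idx a b → Gr (Fin N)) i * (Pi.single M y : Idx a b → Gr (Fin N)) j = _
  congr 1
  by_cases h1 : i = K
  · by_cases h2 : j = M
    · simp [h1, h2]
    · simp [h2]
  · simp [h1]

/-- The Berezinian of an elementary supermatrix. -/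
theorem ber_elementary (K M : Idx a b) {x y : Gr (Fin N)} (hx : x ∈ grPart (Fin N) (par K))
    (hy : y ∈ grPart (Fin N) (par M)) (h : 1 + grBody N (y * x) ≠ 0) :
    IsUnit (elementary K M hx hy) ∧
      (ber (elementary K M hx hy) : Gr (Fin N)) = 1 + if K = M then y * x else 0 := by
  rcases K with i | i <;> rcases M with j | j
  · -- in the even-even block the determinant is `1 + x y` or `1`
    set ξ : EvenGr N := evenMul (i := 0) hx hy with hξ
    have hc : x * y = y * x := gr_even_comm hx y
    have e : elementary (Sum.inl i) (Sum.inl j) hx hy =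
        blockDiag (1 + Matrix.single i j ξ) (1 : Matrix (Fin b) (Fin b) (EvenGr N)) := by
      ext ⟨i' | i', j' | j'⟩ <;> rw [elementary_val]
      · change _ = (((1 : Matrix (Fin a) (Fin a) (EvenGr N)) i' j' +
          Matrix.single i j ξ i' j' : EvenGr N) : Gr (Fin N))
        rw [Matrix.one_apply, Matrix.single_apply]
        by_cases h1 : i' = j' <;> by_cases h2 : i = i' ∧ j = j'
        all_goals simp [h1, h2, hξ, evenMul, eq_comm]
        all_goals aesop
      · simp [blockDiag]
      · simp [blockDiag]
      · simp [blockDiag, Matrix.one_apply]; split_ifs; all_goals simp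
    rw [e, ber_blockDiag]
    by_cases hij : i = j
    · subst hij
      have hu : IsUnit (1 + ξ) := by
        apply isUnit_of_evenBody_ne_zero
        rw [map_add, map_one, evenBody_apply, hξ]
        change 1 + grBody N (x * y) ≠ 0
        rwa [hc]
      refine ⟨isUnit_blockDiag ?_ (by simp), ?_⟩
      · rwa [det_one_add_single_same]
      · rw [det_one_add_single_same]
        simp [hξ, evenMul, hc]
    · have hd : (1 + Matrix.single i j ξ).det = 1 := Matrix.det_transvection_of_ne i j hij ξ
      refine ⟨isUnit_blockDiag ?_ (by simp), ?_⟩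
      · rw [hd]; exact isUnit_one
      · rw [hd]; simp [hij]
  · have hm : x * y ∈ grPart (Fin N) 1 := by
      have := gr_mul_mem hx hy
      rwa [show par (a := a) (b := b) (Sum.inl i) + par (a := a) (b := b) (Sum.inr j) = 1 from
        zero_add 1] at this
    have e : elementary (Sum.inl i) (Sum.inr j) hx hy =
        blockUpper (fun i' j' => if i' = i ∧ j' = j then x * y else 0) (fun i' j' => by
          by_cases h : i' = i ∧ j' = j
          · rwa [if_pos h]
          · rw [if_neg h]; exact Submodule.zero_mem _) := by
      ext ⟨i' | i', j' | j'⟩ <;> rw [elementary_val] <;> simp [blockUpper, Matrix.one_apply]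
    rw [e, ber_blockUpper]
    exact ⟨isUnit_blockUpper _ _, by simp⟩
  · have hm : x * y ∈ grPart (Fin N) 1 := by
      have := gr_mul_mem hx hy
      rwa [show par (a := a) (b := b) (Sum.inr i) + par (a := a) (b := b) (Sum.inl j) = 1 from
        add_zero 1] at this
    have e : elementary (Sum.inr i) (Sum.inl j) hx hy =
        blockLower (fun i' j' => if i' = i ∧ j' = j then x * y else 0) (fun i' j' => by
          by_cases h : i' = i ∧ j' = j
          · rwa [if_pos h]
          · rw [if_neg h]; exact Submodule.zero_mem _) := by
      ext ⟨i' | i', j' | j'⟩ <;> rw [elementary_val] <;> simp [blockLower, Matrix.one_apply]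
    rw [e, ber_blockLower]
    exact ⟨isUnit_blockLower _ _, by simp⟩
  · -- in the odd-odd block the entry `x y = -y x` has square zero, and the determinant is inverted
    set ξ : EvenGr N := evenMul (i := 1) hx hy with hξ
    have hc : x * y = -(y * x) := gr_odd_anticomm hx hy
    have hsq : ξ * ξ = 0 := by
      apply Subtype.ext
      change x * y * (x * y) = 0
      rw [mul_assoc, ← mul_assoc y, gr_odd_anticomm hy hx, neg_mul, mul_neg, mul_assoc x,
        gr_odd_sq hy, mul_zero, mul_zero, neg_zero]
    have hinv : (1 + ξ) * (1 - ξ) = 1 := by linear_combination -hsq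
    have e : elementary (Sum.inr i) (Sum.inr j) hx hy =
        blockDiag (1 : Matrix (Fin a) (Fin a) (EvenGr N)) (1 + Matrix.single i j ξ) := by
      ext ⟨i' | i', j' | j'⟩ <;> rw [elementary_val]
      · simp [blockDiag, Matrix.one_apply]; split_ifs; all_goals simp
      · simp [blockDiag]
      · simp [blockDiag]
      · change _ = (((1 : Matrix (Fin b) (Fin b) (EvenGr N)) i' j' +
          Matrix.single i j ξ i' j' : EvenGr N) : Gr (Fin N))
        rw [Matrix.one_apply, Matrix.single_apply]
        by_cases h1 : i' = j' <;> by_cases h2 : i = i' ∧ j = j'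
        all_goals simp [h1, h2, hξ, evenMul, eq_comm]
        all_goals aesop
    rw [e, ber_blockDiag]
    by_cases hij : i = j
    · subst hij
      have hu : IsUnit (1 + ξ) := ⟨⟨1 + ξ, 1 - ξ, hinv, by rw [mul_comm, hinv]⟩, rfl⟩
      refine ⟨isUnit_blockDiag (by simp) ?_, ?_⟩
      · rwa [det_one_add_single_same]
      · rw [det_one_add_single_same, ring_inverse_eq hinv]
        simp [hξ, evenMul, hc]
    · have hd : (1 + Matrix.single i j ξ).det = 1 := Matrix.det_transvection_of_ne i j hij ξ
      refine ⟨isUnit_blockDiag (by simp) ?_, ?_⟩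
      · rw [hd]; exact isUnit_one
      · rw [hd]; simp [hij]

/-- The inclusion of even parts of Grassmann algebras. -/
def evenEmb (N : ℕ) : EvenGr N →+* EvenGr (N + 1) where
  toFun c := ⟨grEmb N c, grEmb_mem c.2⟩
  map_one' := Subtype.ext (map_one (grEmb N))
  map_mul' _ _ := Subtype.ext (map_mul (grEmb N) _ _)
  map_zero' := Subtype.ext (map_zero (grEmb N))
  map_add' _ _ := Subtype.ext (map_add (grEmb N) _ _)

theorem coe_evenEmb (c : EvenGr N) : (evenEmb N c : Gr (Fin (N + 1))) = grEmb N c := rfl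

/-- Berezinians are compatible with the inclusion of Grassmann algebras. -/
theorem ber_emb {g : SSq N a b} (hg : IsUnit g.toMatrix) :
    ber (SPoint.emb g : SSq (N + 1) a b) = evenEmb N (ber g) := by
  have hD := (isUnit_blocks hg).1
  have h1 : oddBlock (SPoint.emb g : SSq (N + 1) a b) = (evenEmb N).mapMatrix (oddBlock g) := rfl
  have h2 : (oddBlock (SPoint.emb g : SSq (N + 1) a b))⁻¹ =
      (evenEmb N).mapMatrix (oddBlock g)⁻¹ := by
    apply Matrix.inv_eq_right_inv
    rw [h1, ← map_mul, Matrix.mul_nonsing_inv _ hD, map_one]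
  have h3 : schurCorrection (SPoint.emb g : SSq (N + 1) a b) =
      (evenEmb N).mapMatrix (schurCorrection g) := by
    refine Matrix.ext fun i j => Subtype.ext ?_
    change ∑ k, ∑ l, grEmb N (g.val (Sum.inl i, Sum.inr k)) *
      ((oddBlock (SPoint.emb g : SSq (N + 1) a b))⁻¹ k l : Gr (Fin (N + 1))) *
      grEmb N (g.val (Sum.inr l, Sum.inl j)) = grEmb N (∑ k, ∑ l, g.val (Sum.inl i, Sum.inr k) *
        ((oddBlock g)⁻¹ k l : Gr (Fin N)) * g.val (Sum.inr l, Sum.inl j))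
    rw [h2]
    simp only [map_sum, map_mul]
    rfl
  have h4 : evenBlock (SPoint.emb g : SSq (N + 1) a b) = (evenEmb N).mapMatrix (evenBlock g) := rfl
  rw [ber, ber, h1, h3, h4, map_mul, ← map_sub, ← RingHom.map_det, ← RingHom.map_det]
  congr 1
  obtain ⟨u, hu⟩ := hD
  rw [← hu, Ring.inverse_unit]
  apply ring_inverse_eq
  rw [← map_mul, Units.mul_inv, map_one]

end

/-! ### Bordered supermatrices -/

section

variable {N k l : ℕ}

@[elab_as_elim]
theorem idx_cases {P : Idx (k + 1) l → Prop} (old : ∀ K : Idx k l, P (oldCol K)) (new : P newCol)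
    (K : Idx (k + 1) l) : P K := by
  rcases K with i | j
  · refine Fin.lastCases new (fun i => ?_) i
    exact old (Sum.inl i)
  · exact old (Sum.inr j)

theorem sum_idx_succ {M : Type*} [AddCommMonoid M] (f : Idx (k + 1) l → M) :
    ∑ K, f K = ∑ K : Idx k l, f (oldCol K) + f newCol := by
  rw [Fintype.sum_sum_type, Fin.sum_univ_castSucc, Fintype.sum_sum_type]
  exact add_right_comm _ _ _

/-- The index of an old column, if it is old. -/
def splitIdx : Idx (k + 1) l → Option (Idx k l)
  | Sum.inl i => Fin.lastCases (motive := fun _ => Option (Idx k l)) none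
      (fun i => some (Sum.inl i)) i
  | Sum.inr j => some (Sum.inr j)

@[simp] theorem splitIdx_oldCol (K : Idx k l) : splitIdx (oldCol K) = some K := by
  rcases K with i | j
  · simp [splitIdx, oldCol]
  · rfl

@[simp] theorem splitIdx_newCol : splitIdx (newCol : Idx (k + 1) l) = none := by
  simp [splitIdx, newCol]

theorem par_newCol : par (newCol : Idx (k + 1) l) = 0 := rfl

/-- The supermatrix with the blocks `(h c ; y e)`, where `c` is a last even column and `y` a last
even row. -/
def border (h : SSq N k l) (c y : SPoint N (par (a := k) (b := l))) (e : EvenGr N) :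
    SSq N (k + 1) l where
  val KM := match splitIdx KM.1, splitIdx KM.2 with
    | some K, some M => h.val (K, M)
    | some K, none => c.val K
    | none, some M => y.val M
    | none, none => e
  mem := by
    rintro ⟨K, M⟩
    induction K using idx_cases <;> induction M using idx_cases
    · simpa [par_oldCol] using h.mem (_, _)
    · simpa [par_oldCol, par_newCol] using c.mem _
    · simpa [par_oldCol, par_newCol] using y.mem _
    · simp only [splitIdx_newCol, par_newCol, add_zero]
      exact e.2

variable (h h' : SSq N k l) (c c' y y' : SPoint N (par (a := k) (b := l))) (e e' : EvenGr N)

@[simp] theorem border_old_old (K M : Idx k l) :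
    (border h c y e).val (oldCol K, oldCol M) = h.val (K, M) := by simp [border]
@[simp] theorem border_old_new (K : Idx k l) :
    (border h c y e).val (oldCol K, newCol) = c.val K := by simp [border]
@[simp] theorem border_new_old (M : Idx k l) :
    (border h c y e).val (newCol, oldCol M) = y.val M := by simp [border]
@[simp] theorem border_new_new : (border h c y e).val (newCol, newCol) = e := by simp [border]

/-- The contraction of a row vector with a column vector. -/
def pairing (y c : SPoint N (par (a := k) (b := l))) : EvenGr N :=
  ∑ K, evenMul (y.mem K) (c.mem K)

theorem coe_pairing : (pairing y c : Gr (Fin N)) = ∑ K, y.val K * c.val K := by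
  rw [pairing, AddSubmonoidClass.coe_finsetSum]; rfl

theorem border_mul : border h c y e * border h' c' y' e' =
    border (h * h' + outer c y') (mulVec h c' + e' • c) (vecMul y h' + e • y')
      (pairing y c' + e * e') := by
  ext ⟨K, M⟩
  rw [SMat.mul_eq, SMat.mul_val, sum_idx_succ]
  induction K using idx_cases <;> induction M using idx_cases
  · simp [SMat.mul_eq, SMat.mul_val, outer_val]
  · simp [mulVec_val, EvenGr.comm]
  · simp [vecMul_val]
  · simp [coe_pairing]

theorem outer_zero_left {R C : Type} {ρ : R → ZMod 2} {κ : C → ZMod 2} (y : SPoint N κ) :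
    outer (0 : SPoint N ρ) y = 0 := by
  ext ij; exact zero_mul _

theorem outer_zero_right {R C : Type} {ρ : R → ZMod 2} {κ : C → ZMod 2} (y : SPoint N ρ) :
    outer y (0 : SPoint N κ) = 0 := by
  ext ij; exact mul_zero _

theorem mulVec_zero {R S : Type} [Fintype S] {ρ : R → ZMod 2} {κ : S → ZMod 2}
    (h : SMat N ρ κ) : mulVec h (0 : SPoint N κ) = 0 := by
  ext i; simp [mulVec_val]

theorem vecMul_zero {R S : Type} [Fintype S] {ρ : R → ZMod 2} {κ : S → ZMod 2}
    (h : SMat N κ ρ) : vecMul (0 : SPoint N κ) h = 0 := by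
  ext i; simp [vecMul_val]

theorem esmul_zero {R : Type} {ρ : R → ZMod 2} (e : EvenGr N) : e • (0 : SPoint N ρ) = 0 := by
  ext i; simp

theorem one_esmul {R : Type} {ρ : R → ZMod 2} (z : SPoint N ρ) : (1 : EvenGr N) • z = z := by
  ext i; simp

theorem mul_esmul {R : Type} {ρ : R → ZMod 2} (e e' : EvenGr N) (z : SPoint N ρ) :
    (e * e') • z = e • e' • z := by
  ext i; simp [mul_assoc]

theorem pairing_zero_left : pairing (0 : SPoint N (par (a := k) (b := l))) c = 0 :=
  Subtype.ext (by simp [coe_pairing])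

theorem pairing_zero_right : pairing y (0 : SPoint N (par (a := k) (b := l))) = 0 :=
  Subtype.ext (by simp [coe_pairing])

/-- The factorisation of a bordered supermatrix whose corner entry is invertible. -/
theorem border_factor (d : EvenGr N) (hd : d * e = 1) :
    border (h + outer (d • c) y) c y e =
      border 1 (d • c) 0 1 * (border h 0 0 1 * (border 1 0 0 e * border 1 0 (d • y) 1)) := by
  simp only [border_mul, outer_zero_left, mulVec_zero, vecMul_zero, esmul_zero,
    one_esmul, mul_one, one_mul, add_zero, zero_add, pairing_zero_right,
    ← mul_esmul, mul_comm e d, hd]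

end

/-! ### Generators of the general linear supergroup -/

section

variable {N k l : ℕ}

/-- The determinant of a matrix with an invertible corner entry, by the Schur complement. -/
theorem det_eq_mul_det_schur {R : Type*} [CommRing R] (A : Matrix (Fin (k + 1)) (Fin (k + 1)) R)
    (d : R) (hd : d * A (Fin.last k) (Fin.last k) = 1) :
    A.det = (Matrix.of fun i j : Fin k => A i.castSucc j.castSucc -
      d * A i.castSucc (Fin.last k) * A (Fin.last k) j.castSucc).det *
        A (Fin.last k) (Fin.last k) := by
  set B : Matrix (Fin (k + 1)) (Fin (k + 1)) R := Matrix.of fun i j =>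
    A i j - (Fin.lastCases (motive := fun _ => R) 0
      (fun i => d * A i.castSucc (Fin.last k)) i) * A (Fin.last k) j with hB
  have h1 : A.det = B.det := by
    refine Matrix.det_eq_of_forall_row_eq_smul_add_const
      (fun i => Fin.lastCases (motive := fun _ => R) 0
        (fun i => d * A i.castSucc (Fin.last k)) i) (Fin.last k) (by simp) fun i j => ?_
    simp [hB]
  rw [h1, Matrix.det_succ_column B (Fin.last k), Fin.sum_univ_castSucc, Finset.sum_eq_zero]
  · have h2 : B.submatrix (Fin.last k).succAbove (Fin.last k).succAbove =
        Matrix.of fun i j : Fin k => A i.castSucc j.castSucc -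
          d * A i.castSucc (Fin.last k) * A (Fin.last k) j.castSucc := by
      ext i j
      simp [hB]
    have h3 : B (Fin.last k) (Fin.last k) = A (Fin.last k) (Fin.last k) := by simp [hB]
    rw [h2, h3, zero_add, Even.neg_one_pow (Even.add_self _), one_mul, mul_comm]
  · intro i _
    have h4 : B i.castSucc (Fin.last k) = 0 := by
      simp [hB]
      linear_combination -(A i.castSucc (Fin.last k)) * hd
    rw [h4, mul_zero, zero_mul]

theorem exists_unit_in_last_column {A : Matrix (Fin (k + 1)) (Fin (k + 1)) (EvenGr N)}
    (hA : IsUnit A.det) : ∃ i, IsUnit (A i (Fin.last k)) := by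
  by_contra hcon
  push Not at hcon
  have h1 : ∀ i, evenBody N (A i (Fin.last k)) = 0 := fun i => by
    by_contra h
    exact hcon i (isUnit_of_evenBody_ne_zero h)
  have h2 := evenBody_ne_zero_of_isUnit hA
  rw [RingHom.map_det] at h2
  exact h2 (Matrix.det_eq_zero_of_column_eq_zero (Fin.last k) h1)

variable (𝒬 : Submonoid (SSq N (k + 1) l × EvenGr N))

/-- The type of generators of the general linear supergroup of size `k+1|l` in terms of the one of
size `k|l`: a multiplicative relation that contains the invertible supermatrices of size `k|l`,
the scalings of the last even coordinate and the two kinds of unipotent bordered matrices. -/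
structure BorderGenerators : Prop where
  old : ∀ h : SSq N k l, IsUnit h.toMatrix → (border h 0 0 1, ber h) ∈ 𝒬
  corner : ∀ d : EvenGr N, IsUnit d → (border 1 0 0 d, d) ∈ 𝒬
  col : ∀ c, (border 1 c 0 1, 1) ∈ 𝒬
  row : ∀ y, (border 1 0 y 1, 1) ∈ 𝒬

variable {𝒬}

theorem BorderGenerators.mem_border (hQ : BorderGenerators 𝒬) {h : SSq N k l}
    (hh : IsUnit h.toMatrix) (c y : SPoint N (par (a := k) (b := l))) {d e : EvenGr N}
    (hd : d * e = 1) : (border (h + outer (d • c) y) c y e, ber h * e) ∈ 𝒬 := by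
  have he : IsUnit e := ⟨⟨e, d, by rw [mul_comm, hd], hd⟩, rfl⟩
  rw [border_factor h c y e d hd]
  have := 𝒬.mul_mem (hQ.col (d • c)) (𝒬.mul_mem (hQ.old h hh)
    (𝒬.mul_mem (hQ.corner e he) (hQ.row (d • y))))
  simpa using this

theorem BorderGenerators.mem_blockUpper (hQ : BorderGenerators 𝒬)
    (x : Fin (k + 1) → Fin l → Gr (Fin N)) (hx) : (blockUpper x hx, 1) ∈ 𝒬 := by
  let x' : Fin k → Fin l → Gr (Fin N) := fun i j => x i.castSucc j
  let y : SPoint N (par (a := k) (b := l)) := ⟨Sum.elim 0 (x (Fin.last k)), by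
    rintro (i | j)
    · exact Submodule.zero_mem _
    · exact hx _ _⟩
  have h := 𝒬.mul_mem (hQ.old (blockUpper x' fun i j => hx _ _)
    (SMat.isUnit_toMatrix (isUnit_blockUpper _ _))) (hQ.row y)
  rw [ber_blockUpper, Prod.mk_mul_mk, border_mul] at h
  convert h using 2
  · simp only [outer_zero_left, mulVec_zero, esmul_zero, vecMul_zero, one_esmul, mul_one, add_zero,
      zero_add, pairing_zero_left]
    ext ⟨K, M⟩
    induction K using idx_cases with
    | old K =>
      induction M using idx_cases with
      | old M => rw [border_old_old]; rcases K with i | i <;> rcases M with j | j <;>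
          simp [blockUpper, oldCol, x', Matrix.one_apply]
      | new => rw [border_old_new]; rcases K with i | i <;>
          simp [blockUpper, oldCol, newCol, Matrix.one_apply, (Fin.castSucc_lt_last _).ne]
    | new =>
      induction M using idx_cases with
      | old M => rw [border_new_old]; rcases M with j | j <;>
          simp [blockUpper, oldCol, newCol, y, Matrix.one_apply, (Fin.castSucc_lt_last _).ne']
      | new => rw [border_new_new]; simp [blockUpper, newCol]
  · simp

theorem BorderGenerators.mem_blockLower (hQ : BorderGenerators 𝒬)
    (x : Fin l → Fin (k + 1) → Gr (Fin N)) (hx) : (blockLower x hx, 1) ∈ 𝒬 := by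
  let x' : Fin l → Fin k → Gr (Fin N) := fun i j => x i j.castSucc
  let y : SPoint N (par (a := k) (b := l)) := ⟨Sum.elim 0 (fun i => x i (Fin.last k)), by
    rintro (i | j)
    · exact Submodule.zero_mem _
    · exact hx _ _⟩
  have h := 𝒬.mul_mem (hQ.col y) (hQ.old (blockLower x' fun i j => hx _ _)
    (SMat.isUnit_toMatrix (isUnit_blockLower _ _)))
  rw [ber_blockLower, Prod.mk_mul_mk, border_mul] at h
  convert h using 2
  · simp only [outer_zero_right, mulVec_zero, esmul_zero, vecMul_zero, one_esmul, one_mul, mul_one,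
      add_zero, zero_add, pairing_zero_left]
    ext ⟨K, M⟩
    induction K using idx_cases with
    | old K =>
      induction M using idx_cases with
      | old M => rw [border_old_old]; rcases K with i | i <;> rcases M with j | j <;>
          simp [blockLower, oldCol, x', Matrix.one_apply]
      | new => rw [border_old_new]; rcases K with i | i <;>
          simp [blockLower, oldCol, newCol, y, Matrix.one_apply, (Fin.castSucc_lt_last _).ne]
    | new =>
      induction M using idx_cases with
      | old M => rw [border_new_old]; rcases M with j | j <;>
          simp [blockLower, oldCol, newCol, Matrix.one_apply, (Fin.castSucc_lt_last _).ne']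
      | new => rw [border_new_new]; simp [blockLower, newCol]
  · simp

theorem BorderGenerators.mem_blockDiag_odd (hQ : BorderGenerators 𝒬)
    {D : Matrix (Fin l) (Fin l) (EvenGr N)} (hD : IsUnit D.det) :
    (blockDiag 1 D, Ring.inverse D.det) ∈ 𝒬 := by
  have h := hQ.old (blockDiag 1 D) (SMat.isUnit_toMatrix (isUnit_blockDiag (by simp) hD))
  rw [ber_blockDiag, Matrix.det_one, one_mul] at h
  convert h using 2
  ext ⟨K, M⟩
  induction K using idx_cases with
  | old K =>
    induction M using idx_cases with
    | old M => rw [border_old_old]; rcases K with i | i <;> rcases M with j | j <;>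
        simp [blockDiag, oldCol, Matrix.one_apply]
    | new => rw [border_old_new]; rcases K with i | i <;>
        simp [blockDiag, oldCol, newCol, Matrix.one_apply, (Fin.castSucc_lt_last _).ne]
  | new =>
    induction M using idx_cases with
    | old M => rw [border_new_old]; rcases M with j | j <;>
        simp [blockDiag, oldCol, newCol, Matrix.one_apply, (Fin.castSucc_lt_last _).ne']
    | new => rw [border_new_new]; simp [blockDiag, newCol]

/-- An even block with invertible corner entry is a bordered matrix with the Schur complement as its
old block. -/
theorem BorderGenerators.mem_blockDiag_of_corner (hQ : BorderGenerators 𝒬)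
    {A : Matrix (Fin (k + 1)) (Fin (k + 1)) (EvenGr N)} (hA : IsUnit A.det)
    (hu : IsUnit (A (Fin.last k) (Fin.last k))) :
    (blockDiag A (1 : Matrix (Fin l) (Fin l) (EvenGr N)), A.det) ∈ 𝒬 := by
  obtain ⟨d, hd⟩ : ∃ d, d * A (Fin.last k) (Fin.last k) = 1 := by
    obtain ⟨u, hu⟩ := hu
    exact ⟨↑u⁻¹, by rw [← hu, Units.inv_mul]⟩
  have hdet := det_eq_mul_det_schur A d hd
  set A' := Matrix.of fun i j : Fin k => A i.castSucc j.castSucc -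
      d * A i.castSucc (Fin.last k) * A (Fin.last k) j.castSucc with hA'
  have hu' : IsUnit A'.det := by
    rw [hdet, IsUnit.mul_iff] at hA
    exact hA.1
  let c : SPoint N (par (a := k) (b := l)) :=
      ⟨Sum.elim (fun i => (A i.castSucc (Fin.last k) : Gr (Fin N))) 0, by
    rintro (i | j)
    · exact coe_mem_grPart _ rfl
    · exact Submodule.zero_mem _⟩
  let y : SPoint N (par (a := k) (b := l)) :=
      ⟨Sum.elim (fun i => (A (Fin.last k) i.castSucc : Gr (Fin N))) 0, by
    rintro (i | j)
    · exact coe_mem_grPart _ rfl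
    · exact Submodule.zero_mem _⟩
  have h := hQ.mem_border (h := blockDiag A' 1)
    (SMat.isUnit_toMatrix (isUnit_blockDiag hu' (by simp))) c y hd
  rw [ber_blockDiag, Matrix.det_one, Ring.inverse_one, mul_one, ← hdet] at h
  convert h using 2
  ext ⟨K, M⟩
  induction K using idx_cases with
  | old K =>
    induction M using idx_cases with
    | old M => rw [border_old_old]; rcases K with i | i <;> rcases M with j | j <;>
        simp [blockDiag, oldCol, hA', outer_val, c, y, Matrix.one_apply]
    | new => rw [border_old_new]; rcases K with i | i <;> simp [blockDiag, oldCol, newCol, c]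
  | new =>
    induction M using idx_cases with
    | old M => rw [border_new_old]; rcases M with j | j <;> simp [blockDiag, oldCol, newCol, y]
    | new => rw [border_new_new]; simp [blockDiag, newCol]

/-- If the corner entry is not invertible, some entry of the last column is; adding its row to the
last row makes the corner entry invertible. -/
theorem BorderGenerators.mem_blockDiag_even (hQ : BorderGenerators 𝒬)
    {A : Matrix (Fin (k + 1)) (Fin (k + 1)) (EvenGr N)} (hA : IsUnit A.det) :
    (blockDiag A (1 : Matrix (Fin l) (Fin l) (EvenGr N)), A.det) ∈ 𝒬 := by
  by_cases hu : IsUnit (A (Fin.last k) (Fin.last k))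
  · exact hQ.mem_blockDiag_of_corner hA hu
  · obtain ⟨i, hi⟩ := exists_unit_in_last_column hA
    have hne : Fin.last k ≠ i := fun h => hu (h ▸ hi)
    have ht : ∀ t : EvenGr N, (Matrix.transvection (Fin.last k) i t).det = 1 := fun t =>
      Matrix.det_transvection_of_ne _ _ hne t
    have h1 := hQ.mem_blockDiag_of_corner (A := Matrix.transvection (Fin.last k) i (-1))
      (by rw [ht]; exact isUnit_one) (by simp [Matrix.transvection, hne.symm])
    have hdet : (Matrix.transvection (Fin.last k) i 1 * A).det = A.det := by
      rw [Matrix.det_mul, ht, one_mul]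
    have h2 := hQ.mem_blockDiag_of_corner (A := Matrix.transvection (Fin.last k) i 1 * A)
      (by rwa [hdet]) (by
        rw [Matrix.transvection_mul_apply_same, one_mul]
        apply isUnit_of_evenBody_ne_zero
        have h0 : evenBody N (A (Fin.last k) (Fin.last k)) = 0 := by
          by_contra h
          exact hu (isUnit_of_evenBody_ne_zero h)
        rw [map_add, h0, zero_add]
        exact evenBody_ne_zero_of_isUnit hi)
    have h3 := 𝒬.mul_mem h1 h2
    rw [Prod.mk_mul_mk, ht, hdet, one_mul, blockDiag_mul, ← Matrix.mul_assoc,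
      Matrix.transvection_mul_transvection_same _ _ hne, neg_add_cancel, Matrix.transvection_zero,
      Matrix.one_mul, Matrix.one_mul] at h3
    exact h3

/-- A multiplicative relation between supermatrices and even elements that contains the pairs
`(g, Ber g)` for the bordered generators contains them for all invertible `g`. -/
theorem BorderGenerators.mem (hQ : BorderGenerators 𝒬) {g : SSq N (k + 1) l}
    (hg : IsUnit g.toMatrix) : (g, ber g) ∈ 𝒬 := by
  obtain ⟨hD, hA⟩ := isUnit_blocks hg
  obtain ⟨x, hx, y, hy, he⟩ := exists_blockDecomposition hg
  have h := 𝒬.mul_mem (𝒬.mul_mem (hQ.mem_blockUpper x hx)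
    (𝒬.mul_mem (hQ.mem_blockDiag_even hA) (hQ.mem_blockDiag_odd hD))) (hQ.mem_blockLower y hy)
  rw [Prod.mk_mul_mk, Prod.mk_mul_mk, Prod.mk_mul_mk, blockDiag_mul, Matrix.mul_one,
    Matrix.one_mul, ← he, one_mul, mul_one] at h
  exact h

end

/-! ### Admissibility and the group actions -/

section

variable {n m r s p q N : ℕ}

/-- The odd-odd part of a real array. -/
def oddMat (x : EvenIdx (coordPar n m r s p q) → ℝ) : Matrix (Fin m ⊕ Fin s) (Fin q) ℝ :=
  fun i k => oddEntry x i k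

theorem mem_admissible_iff {x : EvenIdx (coordPar n m r s p q) → ℝ} :
    x ∈ admissible n m r s p q ↔ Function.Injective (oddMat x).mulVec ∧
      Function.Injective fun v => Matrix.vecMul v ((oddMat x).submatrix Sum.inr id) :=
  and_congr Matrix.mulVec_injective_iff.symm Matrix.vecMul_injective_iff.symm

theorem oddMat_mul (z : SPoint N (coordPar n m r s p q)) (h : SSq N p q) :
    oddMat (SPoint.body (SMat.mul z h)) = oddMat z.body * (oddBlock h).map (evenBody N) := by
  ext i k
  have h0 : ∀ K : Fin p, grBody N (z.val (Sum.map Sum.inr Sum.inr i, Sum.inl K)) = 0 := fun K =>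
    grBody_odd (by
      have := z.mem (Sum.map Sum.inr Sum.inr i, Sum.inl K)
      rcases i with i | i <;> exact this)
  change grBody N (∑ K, z.val (_, K) * h.val (K, Sum.inr k)) = _
  rw [Fintype.sum_sum_type, map_add, map_sum, map_sum, Matrix.mul_apply]
  simp only [map_mul, h0, zero_mul, Finset.sum_const_zero, zero_add]
  rfl

theorem admissible_mul {z : SPoint N (coordPar n m r s p q)}
    (hz : z.body ∈ admissible n m r s p q) {h : SSq N p q} (hh : IsUnit h.toMatrix) :
    SPoint.body (SMat.mul z h) ∈ admissible n m r s p q := by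
  rw [mem_admissible_iff] at hz ⊢
  have hD : IsUnit ((oddBlock h).map (evenBody N)) := by
    rw [Matrix.isUnit_iff_isUnit_det]
    have := (isUnit_blocks hh).1.map (evenBody N)
    rwa [RingHom.map_det] at this
  rw [oddMat_mul]
  constructor
  · have h1 := hz.1.comp (Matrix.mulVec_injective_of_isUnit hD)
    intro v w hvw
    apply h1
    simpa [← Matrix.mulVec_mulVec] using hvw
  · have h1 := (Matrix.vecMul_injective_of_isUnit hD).comp hz.2
    intro v w hvw
    apply h1
    have e : (oddMat z.body * (oddBlock h).map (evenBody N)).submatrix Sum.inr id =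
      (oddMat z.body).submatrix Sum.inr id * (oddBlock h).map (evenBody N) := rfl
    simpa [e, ← Matrix.vecMul_vecMul] using hvw

variable (a : SMat N (par (a := n) (b := m)) (par (a := r) (b := s))) (g : SSq N r s)

/-- The supermatrix of the transformation `(p, w) ↦ (p + a w, g w)` of columns. -/
def leftMat : SMat N (rowPar (n := n) (m := m) (r := r) (s := s))
    (rowPar (n := n) (m := m) (r := r) (s := s)) where
  val
    | (Sum.inl A, Sum.inl B) => (1 : SSq N n m).val (A, B)
    | (Sum.inl A, Sum.inr F) => a.val (A, F)
    | (Sum.inr _, Sum.inl _) => 0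
    | (Sum.inr F, Sum.inr G) => g.val (F, G)
  mem := by
    rintro ⟨A | F, B | G⟩
    · exact (1 : SSq N n m).mem (A, B)
    · exact a.mem (A, G)
    · exact Submodule.zero_mem _
    · exact g.mem (F, G)

theorem leftAct_eq_mul (z : SPoint N (coordPar n m r s p q)) :
    leftAct a g z = SMat.mul (leftMat a g) z := by
  ext ⟨A | F, K⟩
  · rw [SMat.mul_val, Fintype.sum_sum_type]
    simp [leftAct, leftMat, SMat.one_val]
  · rw [SMat.mul_val, Fintype.sum_sum_type]
    simp [leftAct, leftMat]

theorem leftMat_mul_leftMat (g' : SSq N r s) :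
    leftMat (0 : SMat N (par (a := n) (b := m)) par) (g * g') =
      SMat.mul (leftMat 0 g) (leftMat 0 g') := by
  ext ⟨A | F, B | G⟩ <;> rw [SMat.mul_val, Fintype.sum_sum_type]
  · simp [leftMat, SMat.one_val]
  · simp [leftMat]
  · simp [leftMat]
  · simp [leftMat, SMat.mul_eq, SMat.mul_val]

theorem leftMat_eq_mul : leftMat a g = SMat.mul (leftMat 0 g) (leftMat a 1) := by
  ext ⟨A | F, B | G⟩ <;> rw [SMat.mul_val, Fintype.sum_sum_type]
  · simp [leftMat, SMat.one_val]
  · simp [leftMat, SMat.one_val]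
  · simp [leftMat]
  · simp [leftMat, SMat.one_val]

/-- The odd-odd part of the real matrix underlying `leftMat a g`. -/
def oddLeftMat : Matrix (Fin m ⊕ Fin s) (Fin m ⊕ Fin s) ℝ :=
  Matrix.fromBlocks (1 : Matrix (Fin m) (Fin m) ℝ)
    (Matrix.of fun A F => grBody N (a.val (Sum.inr A, Sum.inr F))) (0 : Matrix (Fin s) (Fin m) ℝ)
    ((oddBlock g).map (evenBody N))

theorem oddMat_leftAct (z : SPoint N (coordPar n m r s p q)) :
    oddMat (leftAct a g z).body =
      oddLeftMat a g * oddMat z.body := by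
  ext (A | F) k
  · have h0 : ∀ F : Fin r, grBody N (a.val (Sum.inr A, Sum.inl F)) = 0 := fun F =>
      grBody_odd (a.mem (Sum.inr A, Sum.inl F))
    change grBody N (z.val (Sum.inl (Sum.inr A), Sum.inr k) +
      ∑ F, a.val (Sum.inr A, F) * z.val (Sum.inr F, Sum.inr k)) = _
    rw [Fintype.sum_sum_type, map_add, map_add, map_sum, map_sum, Matrix.mul_apply,
      Fintype.sum_sum_type]
    simp only [map_mul, h0, zero_mul, Finset.sum_const_zero, zero_add, oddLeftMat,
      Matrix.fromBlocks_apply₁₁, Matrix.fromBlocks_apply₁₂, Matrix.one_apply, ite_mul, one_mul,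
      Finset.sum_ite_eq, Finset.mem_univ, if_true]
    rfl
  · have h0 : ∀ G : Fin r, grBody N (g.val (Sum.inr F, Sum.inl G)) = 0 := fun G =>
      grBody_odd (g.mem (Sum.inr F, Sum.inl G))
    change grBody N (∑ G, g.val (Sum.inr F, G) * z.val (Sum.inr G, Sum.inr k)) = _
    rw [Fintype.sum_sum_type, map_add, map_sum, map_sum, Matrix.mul_apply, Fintype.sum_sum_type]
    simp only [map_mul, h0, zero_mul, Finset.sum_const_zero, zero_add, oddLeftMat,
      Matrix.fromBlocks_apply₂₁, Matrix.fromBlocks_apply₂₂, Matrix.zero_apply]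
    rfl

variable {g} in
theorem admissible_leftAct {z : SPoint N (coordPar n m r s p q)}
    (hz : z.body ∈ admissible n m r s p q) (hg : IsUnit g.toMatrix) :
    (leftAct a g z).body ∈ admissible n m r s p q := by
  rw [mem_admissible_iff] at hz ⊢
  have hD : IsUnit ((oddBlock g).map (evenBody N)) := by
    rw [Matrix.isUnit_iff_isUnit_det]
    have := (isUnit_blocks hg).1.map (evenBody N)
    rwa [RingHom.map_det] at this
  rw [oddMat_leftAct]
  constructor
  · have hT : IsUnit (oddLeftMat a g) := by
      rw [Matrix.isUnit_iff_isUnit_det, oddLeftMat, Matrix.det_fromBlocks_zero₂₁, Matrix.det_one,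
        one_mul]
      exact (Matrix.isUnit_iff_isUnit_det _).mp hD
    have h1 := (Matrix.mulVec_injective_of_isUnit hT).comp hz.1
    intro v w hvw
    apply h1
    simpa [← Matrix.mulVec_mulVec] using hvw
  · have h1 := hz.2.comp (Matrix.vecMul_injective_of_isUnit hD)
    have e : (oddLeftMat a g * oddMat z.body).submatrix Sum.inr id =
        (oddBlock g).map (evenBody N) * (oddMat z.body).submatrix Sum.inr id := by
      ext i k
      rw [Matrix.submatrix_apply, Matrix.mul_apply, Fintype.sum_sum_type, Matrix.mul_apply]
      simp [oddLeftMat]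
    intro v w hvw
    apply h1
    simpa [e, ← Matrix.vecMul_vecMul] using hvw

end

/-! ### Infinitesimal equivariance -/

section

variable {I : Type} [Fintype I] [DecidableEq I] {π : I → ZMod 2} {N : ℕ}

theorem SPoint.sum_single (z : SPoint N π) : ∑ i, SPoint.single i (z.val i) (z.mem i) = z := by
  apply SPoint.val_injective
  refine (map_sum (SPoint.valHom (π := π) (N := N)) _ _).trans (funext fun j => ?_)
  rw [Finset.sum_apply]
  exact (Finset.sum_pi_single j _ _).trans (by simp)

/-- Additive identities for points can be checked on points with a single coordinate. -/
theorem SPoint.single_induction {P : SPoint N π → Prop} (h0 : P 0)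
    (hadd : ∀ z w, P z → P w → P (z + w)) (hsingle : ∀ i x hx, P (SPoint.single i x hx))
    (z : SPoint N π) : P z := by
  rw [← z.sum_single]
  exact Finset.sum_induction _ P hadd h0 fun i _ => hsingle _ _ _

end

section

variable {N : ℕ} {R S C : Type} [Fintype S] {ρ : R → ZMod 2} {τ : S → ZMod 2} {κ : C → ZMod 2}

theorem mulVec_add (h : SMat N ρ τ) (c c' : SPoint N τ) :
    mulVec h (c + c') = mulVec h c + mulVec h c' := by
  ext i; simp [mulVec_val, mul_add, Finset.sum_add_distrib]

theorem vecMul_add (y y' : SPoint N τ) (h : SMat N τ κ) :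
    vecMul (y + y') h = vecMul y h + vecMul y' h := by
  ext i; simp [vecMul_val, add_mul, Finset.sum_add_distrib]

theorem mulVec_smul (t : ℝ) (h : SMat N ρ τ) (c : SPoint N τ) :
    mulVec h (t • c) = t • mulVec h c := by
  ext i; simp [mulVec_val, Finset.smul_sum]

variable {k l : ℕ}

theorem pairing_add_left (y y' c : SPoint N (par (a := k) (b := l))) :
    pairing (y + y') c = pairing y c + pairing y' c :=
  Subtype.ext (by
    rw [Subalgebra.coe_add]
    simp [coe_pairing, add_mul, Finset.sum_add_distrib])

theorem pairing_add_right (y c c' : SPoint N (par (a := k) (b := l))) :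
    pairing y (c + c') = pairing y c + pairing y c' :=
  Subtype.ext (by
    rw [Subalgebra.coe_add]
    simp [coe_pairing, mul_add, Finset.sum_add_distrib])

theorem SPoint.smul_single {I : Type} [Fintype I] [DecidableEq I] {π : I → ZMod 2} (t : ℝ) (i : I)
    (x : Gr (Fin N)) (hx) : t • SPoint.single (π := π) i x hx =
      SPoint.single i (t • x) (Submodule.smul_mem _ t hx) := by
  apply SPoint.val_injective
  exact (Pi.single_smul (f := fun _ => Gr (Fin N)) i t x).symm

theorem pairing_single (K M : Idx k l) {x y : Gr (Fin N)} (hx : x ∈ grPart (Fin N) (par K))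
    (hy : y ∈ grPart (Fin N) (par M)) :
    (pairing (SPoint.single (π := par) M y hy) (SPoint.single (π := par) K x hx) : Gr (Fin N)) =
      if K = M then y * x else 0 := by
  rw [coe_pairing]
  simp only [SPoint.single]
  by_cases h : K = M
  · subst h
    rw [Finset.sum_eq_single K (fun j _ hj => by rw [Pi.single_eq_of_ne hj, zero_mul]) (by simp)]
    simp
  · rw [if_neg h]
    refine Finset.sum_eq_zero fun j _ => ?_
    by_cases hj : j = M
    · rw [Pi.single_eq_of_ne (i' := j) (i := K) (fun h' => h (h'.symm.trans hj)), mul_zero]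
    · rw [Pi.single_eq_of_ne hj, zero_mul]

end

section

variable {n m r s p q N : ℕ} {L : MixedFun n m r s p q}

/-- The infinitesimal form of the equivariance with respect to columns. -/
theorem IsMixedForm.dEval_outer_mulVec (hL : IsMixedForm n m r s p q L)
    {z : SPoint N (coordPar n m r s p q)} (hz : z.body ∈ admissible n m r s p q)
    (c y : SPoint N (par (a := p) (b := q))) :
    dEval L z (outer (mulVec z c) y).val = pairing y c * eval L z := by
  -- the condition on `y * x` makes the elementary matrix invertible
  have key : ∀ (K M : Idx p q) (x y : Gr (Fin N)) (hx : x ∈ grPart (Fin N) (par K))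
      (hy : y ∈ grPart (Fin N) (par M)), 1 + grBody N (y * x) ≠ 0 →
      dEval L z (outer (mulVec z (SPoint.single (π := par) K x hx))
        (SPoint.single (π := par) M y hy)).val =
        pairing (SPoint.single (π := par) M y hy) (SPoint.single (π := par) K x hx) * eval L z := by
    intro K M x y hx hy h
    obtain ⟨hu, hb⟩ := ber_elementary K M hx hy h
    have h1 := hL.right_equivariant N z _ hz (SMat.isUnit_toMatrix hu)
    rw [elementary, SMat.mul_add, SMat.mul_one', SMat.mul_outer,
      hL.isPreForm.eval_add_outer hz] at h1
    rw [elementary] at hb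
    rw [hb, mul_add, mul_one, add_right_inj, ← pairing_single K M hx hy, ← EvenGr.comm] at h1
    exact h1
  induction c using SPoint.single_induction with
  | h0 => rw [mulVec_zero, outer_zero_left, pairing_zero_right]; simp [dEval]
  | hadd c c' h1 h2 =>
    rw [mulVec_add, outer_add_left, pairing_add_right, Subalgebra.coe_add, add_mul, dEval_add, h1,
      h2]
  | hsingle K x hx =>
    induction y using SPoint.single_induction with
    | h0 => rw [outer_zero_right, pairing_zero_left]; simp [dEval]
    | hadd y y' h1 h2 =>
      rw [outer_add_right, pairing_add_left, Subalgebra.coe_add, add_mul, dEval_add, h1, h2]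
    | hsingle M y hy =>
      -- if the condition fails for `x`, it holds for `-x`, and both sides are linear in `x`
      by_cases h : 1 + grBody N (y * x) = 0
      · have h1 := key K M (-x) y (Submodule.neg_mem _ hx) hy (by
          rw [mul_neg, map_neg]
          linarith)
        have e : SPoint.single (π := par) K (-x) (Submodule.neg_mem _ hx) =
            (-1 : ℝ) • SPoint.single (π := par) K x hx := by
          rw [SPoint.smul_single]; simp
        rw [pairing_single] at h1 ⊢
        rw [e, mulVec_smul, outer_smul_left, dEval_smul] at h1
        split_ifs at h1 ⊢ with h2
        · rw [mul_neg, neg_mul, neg_one_smul, neg_inj] at h1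
          exact h1
        · rw [zero_mul, neg_one_smul, neg_eq_zero] at h1
          rw [zero_mul, h1]
      · exact key K M x y hx hy h

/-- The row vector `c^F` as a combination of rows of an array. -/
def wVec (c : SPoint N (par (a := r) (b := s))) :
    SPoint N (rowPar (n := n) (m := m) (r := r) (s := s)) where
  val := Sum.elim 0 c.val
  mem := by
    rintro (A | F)
    · exact Submodule.zero_mem _
    · exact c.mem F

/-- The part of a column in the rows of `ℝ^{r|s}`. -/
def wPart (b : SPoint N (rowPar (n := n) (m := m) (r := r) (s := s))) :
    SPoint N (par (a := r) (b := s)) where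
  val F := b.val (Sum.inr F)
  mem F := b.mem (Sum.inr F)

/-- A column with components in the rows of `V`. -/
def pVec (b : SPoint N (par (a := n) (b := m))) :
    SPoint N (rowPar (n := n) (m := m) (r := r) (s := s)) where
  val := Sum.elim b.val 0
  mem := by
    rintro (A | F)
    · exact b.mem A
    · exact Submodule.zero_mem _

/-- The part of a column in the rows of `V`. -/
def pPart (b : SPoint N (rowPar (n := n) (m := m) (r := r) (s := s))) :
    SPoint N (par (a := n) (b := m)) where
  val A := b.val (Sum.inl A)
  mem A := b.mem (Sum.inl A)

theorem pVec_add_wVec (b : SPoint N (rowPar (n := n) (m := m) (r := r) (s := s))) :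
    pVec (pPart b) + wVec (wPart b) = b := by
  ext (A | F)
  · exact add_zero _
  · exact zero_add _

theorem wVec_add (c c' : SPoint N (par (a := r) (b := s))) :
    wVec (n := n) (m := m) (c + c') = wVec c + wVec c' := by
  ext (A | F)
  · exact (add_zero _).symm
  · rfl

theorem wVec_zero : wVec (n := n) (m := m) (0 : SPoint N (par (a := r) (b := s))) = 0 := by
  ext (A | F) <;> rfl

theorem wVec_smul (t : ℝ) (c : SPoint N (par (a := r) (b := s))) :
    wVec (n := n) (m := m) (t • c) = t • wVec c := by
  ext (A | F)
  · exact (smul_zero t : t • (0 : Gr (Fin N)) = 0).symm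
  · rfl

theorem vecMul_wVec_val (c : SPoint N (par (a := r) (b := s)))
    (z : SPoint N (coordPar n m r s p q)) (K : Idx p q) :
    (vecMul (wVec c) z).val K = ∑ F, c.val F * z.val (Sum.inr F, K) := by
  rw [vecMul_val, Fintype.sum_sum_type]
  simp [wVec]

/-- The infinitesimal form of the invariance with respect to `p ↦ p + a w`. -/
theorem IsMixedForm.dEval_outer_pVec (hL : IsMixedForm n m r s p q L)
    {z : SPoint N (coordPar n m r s p q)} (hz : z.body ∈ admissible n m r s p q)
    (b : SPoint N (par (a := n) (b := m))) (c : SPoint N (par (a := r) (b := s))) :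
    dEval L z (outer (pVec b) (vecMul (wVec c) z)).val = 0 := by
  have h1 := hL.left_equivariant N z (outer b c) 1 hz (SMat.isUnit_toMatrix isUnit_one)
  have e : leftAct (outer b c) 1 z = z + outer (pVec b) (vecMul (wVec c) z) := by
    ext ⟨B | G, K⟩
    · rw [SPoint.val_add, outer_val, vecMul_wVec_val]
      simp [leftAct, outer_val, pVec, mul_add, Finset.mul_sum, mul_assoc]
    · simp [leftAct, SMat.one_val, outer_val, pVec]
  rw [e, hL.isPreForm.eval_add_outer hz, ber_one, OneMemClass.coe_one, mul_one, add_eq_left] at h1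
  exact h1

/-- The infinitesimal form of the equivariance with respect to `w ↦ g w`. -/
theorem IsMixedForm.dEval_outer_wVec (hL : IsMixedForm n m r s p q L)
    {z : SPoint N (coordPar n m r s p q)} (hz : z.body ∈ admissible n m r s p q)
    (b c : SPoint N (par (a := r) (b := s))) :
    dEval L z (outer (wVec b) (vecMul (wVec c) z)).val = pairing c b * eval L z := by
  -- the condition on `x * y` makes the elementary matrix invertible
  have key : ∀ (G F : Idx r s) (y x : Gr (Fin N)) (hy : y ∈ grPart (Fin N) (par G))
      (hx : x ∈ grPart (Fin N) (par F)), 1 + grBody N (x * y) ≠ 0 →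
      dEval L z (outer (wVec (SPoint.single (π := par) G y hy))
        (vecMul (wVec (SPoint.single (π := par) F x hx)) z)).val =
        pairing (SPoint.single (π := par) F x hx) (SPoint.single (π := par) G y hy) *
          eval L z := by
    intro G F y x hy hx h
    obtain ⟨hu, hb⟩ := ber_elementary G F hy hx h
    have h1 := hL.left_equivariant N z 0 _ hz (SMat.isUnit_toMatrix hu)
    have e : leftAct 0 (elementary G F hy hx) z =
        z + outer (wVec (SPoint.single (π := par) G y hy))
          (vecMul (wVec (SPoint.single (π := par) F x hx)) z) := by
      ext ⟨B | H, K⟩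
      · simp [leftAct, outer_val, wVec]
      · rw [SPoint.val_add, outer_val, vecMul_wVec_val]
        simp [leftAct, elementary, SMat.one_val, outer_val, wVec, mul_add, Finset.mul_sum,
          mul_assoc, add_mul, Finset.sum_add_distrib]
    rw [e, hL.isPreForm.eval_add_outer hz, hb, mul_add, mul_one, add_right_inj,
      ← pairing_single G F hy hx, ← EvenGr.comm] at h1
    exact h1
  induction c using SPoint.single_induction with
  | h0 =>
    rw [wVec_zero, vecMul_zero, outer_zero_right, pairing_zero_left]; simp [dEval]
  | hadd c c' h1 h2 =>
    rw [wVec_add, vecMul_add, outer_add_right, pairing_add_left, Subalgebra.coe_add, add_mul,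
      dEval_add, h1, h2]
  | hsingle F x hx =>
    induction b using SPoint.single_induction with
    | h0 => rw [wVec_zero, outer_zero_left, pairing_zero_right]; simp [dEval]
    | hadd b b' h1 h2 =>
      rw [wVec_add, outer_add_left, pairing_add_right, Subalgebra.coe_add, add_mul, dEval_add, h1,
        h2]
    | hsingle G y hy =>
      -- if the condition fails for `y`, it holds for `-y`, and both sides are linear in `y`
      by_cases h : 1 + grBody N (x * y) = 0
      · have h1 := key G F (-y) x (Submodule.neg_mem _ hy) hx (by
          rw [mul_neg, map_neg]
          linarith)
        have e : SPoint.single (π := par) G (-y) (Submodule.neg_mem _ hy) =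
            (-1 : ℝ) • SPoint.single (π := par) G y hy := by
          rw [SPoint.smul_single]; simp
        rw [pairing_single] at h1 ⊢
        rw [e, wVec_smul, outer_smul_left, dEval_smul] at h1
        split_ifs at h1 ⊢ with h2
        · rw [mul_neg, neg_mul, neg_one_smul, neg_inj] at h1
          exact h1
        · rw [zero_mul, neg_one_smul, neg_eq_zero] at h1
          rw [zero_mul, h1]
      · exact key G F y x hy hx h

/-- The infinitesimal form of the equivariance with respect to rows. -/
theorem IsMixedForm.dEval_outer_vecMul (hL : IsMixedForm n m r s p q L)
    {z : SPoint N (coordPar n m r s p q)} (hz : z.body ∈ admissible n m r s p q)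
    (b : SPoint N (rowPar (n := n) (m := m) (r := r) (s := s)))
    (c : SPoint N (par (a := r) (b := s))) :
    dEval L z (outer b (vecMul (wVec c) z)).val = pairing c (wPart b) * eval L z := by
  conv_lhs => rw [← pVec_add_wVec b]
  rw [outer_add_left, dEval_add, hL.dEval_outer_pVec hz, hL.dEval_outer_wVec hz, zero_add]

end

/-! ### Bordered values of mixed forms -/

section

variable {n m r s p q N : ℕ} {L : MixedFun n m r s p q}

/-- For an array `(z ζ ; y e)` with one more column and one more row, the value
`e L(z) - dL(z; ζ ⊗ y)`.  As `L` is affine in directions of rank one, this is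
`e L(z - ζ e⁻¹ y)` when `e` is invertible. -/
def bordered (L : MixedFun n m r s p q) (z : SPoint N (coordPar n m r s p q))
    (ζ : SPoint N (rowPar (n := n) (m := m) (r := r) (s := s)))
    (y : SPoint N (par (a := p) (b := q))) (e : EvenGr N) : Gr (Fin N) :=
  e * eval L z - dEval L z (outer ζ y).val

variable {z : SPoint N (coordPar n m r s p q)}

theorem IsMixedForm.dEval_mul (hL : IsMixedForm n m r s p q L)
    (hz : z.body ∈ admissible n m r s p q) {h : SSq N p q} (hh : IsUnit h.toMatrix)
    (δ : SPoint N (coordPar n m r s p q)) :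
    dEval L (SMat.mul z h) (SPoint.val (SMat.mul δ h)) = dEval L z δ.val * ber h := by
  have hU := isOpen_admissible n m r s p q
  have h1 := hasDerivAt_eval_zero hU hL.smooth (admissible_mul hz hh) (SMat.mul δ h)
  have h2 := hasDerivAt_gr_mul_const (hasDerivAt_eval_zero hU hL.smooth hz δ) (ber h : Gr (Fin N))
  refine h1.unique (h2.congr_of_eventuallyEq ((eventually_body_mem hU hz δ).mono fun t ht => ?_))
  have e : SMat.mul z h + t • SMat.mul δ h = SMat.mul (z + t • δ) h := by
    rw [← SMat.smul_mul]; exact (SMat.add_mul z (t • δ) h).symm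
  exact (congrArg (eval L) e).trans (hL.right_equivariant N _ h ht hh)

theorem IsMixedForm.dEval_leftAct (hL : IsMixedForm n m r s p q L)
    (hz : z.body ∈ admissible n m r s p q) (a : SMat N (par (a := n) (b := m)) par)
    {g : SSq N r s} (hg : IsUnit g.toMatrix) (δ : SPoint N (coordPar n m r s p q)) :
    dEval L (leftAct a g z) (leftAct a g δ).val = dEval L z δ.val * ber g := by
  have hU := isOpen_admissible n m r s p q
  have h1 := hasDerivAt_eval_zero hU hL.smooth (admissible_leftAct a hz hg) (leftAct a g δ)
  have h2 := hasDerivAt_gr_mul_const (hasDerivAt_eval_zero hU hL.smooth hz δ) (ber g : Gr (Fin N))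
  refine h1.unique (h2.congr_of_eventuallyEq ((eventually_body_mem hU hz δ).mono fun t ht => ?_))
  have e : leftAct a g z + t • leftAct a g δ = leftAct a g (z + t • δ) := by
    simp only [leftAct_eq_mul]
    rw [← SMat.mul_smul]; exact (SMat.mul_add _ z (t • δ)).symm
  exact (congrArg (eval L) e).trans (hL.left_equivariant N _ a g ht hg)

theorem leftAct_outer (a : SMat N (par (a := n) (b := m)) par) (g : SSq N r s)
    (b : SPoint N (rowPar (n := n) (m := m) (r := r) (s := s)))
    (c : SPoint N (par (a := p) (b := q))) :
    leftAct a g (outer b c) = outer (mulVec (leftMat a g) b) c := by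
  rw [leftAct_eq_mul, SMat.mul_outer]

variable (ζ b : SPoint N (rowPar (n := n) (m := m) (r := r) (s := s)))
  (y c : SPoint N (par (a := p) (b := q))) (e e' : EvenGr N)

theorem IsMixedForm.bordered_mul (hL : IsMixedForm n m r s p q L)
    (hz : z.body ∈ admissible n m r s p q) {h : SSq N p q} (hh : IsUnit h.toMatrix) :
    bordered L (SMat.mul z h) ζ (vecMul y h) e = bordered L z ζ y e * ber h := by
  rw [bordered, hL.right_equivariant N z h hz hh, ← SMat.outer_mul, hL.dEval_mul hz hh, bordered,
    sub_mul, mul_assoc]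

theorem IsMixedForm.bordered_leftAct (hL : IsMixedForm n m r s p q L)
    (hz : z.body ∈ admissible n m r s p q) (a : SMat N (par (a := n) (b := m)) par)
    {g : SSq N r s} (hg : IsUnit g.toMatrix) :
    bordered L (leftAct a g z) (mulVec (leftMat a g) ζ) y e = bordered L z ζ y e * ber g := by
  rw [bordered, hL.left_equivariant N z a g hz hg, ← leftAct_outer, hL.dEval_leftAct hz a hg,
    bordered, sub_mul, mul_assoc]

theorem bordered_esmul_col :
    bordered L z (e' • ζ) y (e' * e) = e' * bordered L z ζ y e := by
  rw [bordered, outer_esmul_left, dEval_esmul, bordered, mul_sub, Subalgebra.coe_mul, mul_assoc]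

theorem bordered_esmul_row :
    bordered L z ζ (e' • y) (e' * e) = e' * bordered L z ζ y e := by
  rw [bordered, outer_esmul_right, dEval_esmul, bordered, mul_sub, Subalgebra.coe_mul, mul_assoc]

theorem bordered_add_row (y' : SPoint N (par (a := p) (b := q))) :
    bordered L z ζ (y + y') (e + e') = bordered L z ζ y e + bordered L z ζ y' e' := by
  rw [bordered, outer_add_right, dEval_add, Subalgebra.coe_add, bordered, bordered, add_mul]
  abel

theorem bordered_add_col :
    bordered L z (ζ + b) y (e + e') = bordered L z ζ y e + bordered L z b y e' := by
  rw [bordered, outer_add_left, dEval_add, Subalgebra.coe_add, bordered, bordered, add_mul]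
  abel

/-- Adding a combination of the other columns to the last column. -/
theorem IsMixedForm.bordered_add_mulVec (hL : IsMixedForm n m r s p q L)
    (hz : z.body ∈ admissible n m r s p q) :
    bordered L z (ζ + mulVec z c) y (e + pairing y c) = bordered L z ζ y e := by
  rw [bordered_add_col, add_eq_left, bordered, hL.dEval_outer_mulVec hz, sub_self]

/-- Adding a combination of the rows of `w` to the last row. -/
theorem IsMixedForm.bordered_add_vecMul (hL : IsMixedForm n m r s p q L)
    (hz : z.body ∈ admissible n m r s p q) (c : SPoint N (par (a := r) (b := s))) :
    bordered L z ζ (y + vecMul (wVec c) z) (e + pairing c (wPart ζ)) = bordered L z ζ y e := by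
  rw [bordered_add_row, add_eq_left, bordered, hL.dEval_outer_vecMul hz, sub_self]

/-- Adding multiples of the last column to the other columns. -/
theorem IsPreForm.bordered_add_outer_row (hL : IsPreForm L)
    (hz : z.body ∈ admissible n m r s p q) :
    bordered L (z + outer ζ c) ζ (y + e • c) e = bordered L z ζ y e := by
  rw [bordered, hL.eval_add_outer hz, hL.dEval_add_outer hz, hL.d2Eval_same_row hz, add_zero,
    outer_add_right, outer_esmul_right, dEval_add, dEval_esmul, bordered, mul_add]
  abel

/-- Adding multiples of the last row to the other rows. -/
theorem IsPreForm.bordered_add_outer_col (hL : IsPreForm L)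
    (hz : z.body ∈ admissible n m r s p q) :
    bordered L (z + outer b y) (ζ + e • b) y e = bordered L z ζ y e := by
  rw [bordered, hL.eval_add_outer hz, hL.dEval_add_outer hz, hL.d2Eval_same_col hz, add_zero,
    outer_add_left, outer_esmul_left, dEval_add, dEval_esmul, bordered, mul_add]
  abel

end

/-! ### Arrays with an additional row or column -/

section

variable {n m r s p q N : ℕ}

/-- The array without its last even column. -/
def dropCol (Z : SPoint N (coordPar n m r s (p + 1) q)) : SPoint N (coordPar n m r s p q) :=
  Z.comap (fun iK : Row n m r s × Idx p q => (iK.1, oldCol iK.2))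
    (fun iK => by rw [coordPar, coordPar, par_oldCol])

/-- The last even column of an array. -/
def lastCol (Z : SPoint N (coordPar n m r s (p + 1) q)) :
    SPoint N (rowPar (n := n) (m := m) (r := r) (s := s)) where
  val i := Z.val (i, newCol)
  mem i := by
    have h := Z.mem (i, newCol)
    rwa [coordPar, par_newCol, add_zero] at h

/-- The array without its last even row. -/
def dropRow (Z : SPoint N (coordPar n m (r + 1) s p q)) : SPoint N (coordPar n m r s p q) :=
  Z.comap (fun iK : Row n m r s × Idx p q => (oldRow iK.1, iK.2))
    (fun iK => by rw [coordPar, coordPar, rowPar_oldRow])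

/-- The last even row of an array. -/
def lastRow (Z : SPoint N (coordPar n m (r + 1) s p q)) : SPoint N (par (a := p) (b := q)) where
  val K := Z.val (newRow, K)
  mem K := by
    have h := Z.mem (newRow, K)
    rwa [coordPar, show rowPar (newRow : Row n m (r + 1) s) = 0 from rfl, zero_add] at h

/-- A row vector without its last even component. -/
def initRow (Y : SPoint N (par (a := p + 1) (b := q))) : SPoint N (par (a := p) (b := q)) :=
  Y.comap oldCol par_oldCol

/-- The last even component of a row vector. -/
def corner (Y : SPoint N (par (a := p + 1) (b := q))) : EvenGr N := ⟨Y.val newCol, Y.mem newCol⟩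

theorem dropCol_val (Z : SPoint N (coordPar n m r s (p + 1) q)) (i : Row n m r s) (K : Idx p q) :
    (dropCol Z).val (i, K) = Z.val (i, oldCol K) := rfl
theorem lastCol_val (Z : SPoint N (coordPar n m r s (p + 1) q)) (i : Row n m r s) :
    (lastCol Z).val i = Z.val (i, newCol) := rfl
theorem lastRow_val (Z : SPoint N (coordPar n m (r + 1) s p q)) (K : Idx p q) :
    (lastRow Z).val K = Z.val (newRow, K) := rfl
theorem initRow_val (Y : SPoint N (par (a := p + 1) (b := q))) (K : Idx p q) :
    (initRow Y).val K = Y.val (oldCol K) := rfl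
theorem coe_corner (Y : SPoint N (par (a := p + 1) (b := q))) :
    (corner Y : Gr (Fin N)) = Y.val newCol := rfl

theorem admissible_dropCol {Z : SPoint N (coordPar n m r s (p + 1) q)} :
    (dropCol Z).body ∈ admissible n m r s p q ↔ Z.body ∈ admissible n m r s (p + 1) q :=
  ⟨admissible_congr fun i k => by rcases i with i | i <;> rfl,
    admissible_congr fun i k => by rcases i with i | i <;> rfl⟩

theorem admissible_dropRow {Z : SPoint N (coordPar n m (r + 1) s p q)} :
    (dropRow Z).body ∈ admissible n m r s p q ↔ Z.body ∈ admissible n m (r + 1) s p q :=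
  ⟨admissible_congr fun i k => by rcases i with i | i <;> rfl,
    admissible_congr fun i k => by rcases i with i | i <;> rfl⟩

variable (h : SSq N p q) (c y : SPoint N (par (a := p) (b := q))) (e : EvenGr N)
  (Z : SPoint N (coordPar n m r s (p + 1) q)) (Y : SPoint N (par (a := p + 1) (b := q)))

theorem dropCol_mul_border : dropCol (SMat.mul Z (border h c y e)) =
    SMat.mul (dropCol Z) h + outer (lastCol Z) y := by
  ext ⟨i, K⟩
  rw [dropCol_val, SMat.mul_val, sum_idx_succ]
  simp [SMat.mul_val, outer_val, dropCol_val, lastCol_val]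

theorem lastCol_mul_border : lastCol (SMat.mul Z (border h c y e)) =
    e • lastCol Z + mulVec (dropCol Z) c := by
  ext i
  rw [lastCol_val, SMat.mul_val, sum_idx_succ]
  simp [mulVec_val, dropCol_val, lastCol_val, EvenGr.comm, add_comm]

theorem initRow_vecMul_border : initRow (vecMul Y (border h c y e)) =
    vecMul (initRow Y) h + corner Y • y := by
  ext K
  rw [initRow_val, vecMul_val, sum_idx_succ]
  simp [vecMul_val, initRow_val, coe_corner]

theorem corner_vecMul_border : corner (vecMul Y (border h c y e)) =
    e * corner Y + pairing (initRow Y) c := by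
  apply Subtype.ext
  rw [coe_corner, vecMul_val, sum_idx_succ, Subalgebra.coe_add, Subalgebra.coe_mul, EvenGr.comm]
  simp [coe_pairing, initRow_val, coe_corner, add_comm]

theorem dropCol_leftAct (a : SMat N (par (a := n) (b := m)) par) (g : SSq N r s) :
    dropCol (leftAct a g Z) = leftAct a g (dropCol Z) := by
  ext ⟨A | F, K⟩ <;> rfl

theorem lastCol_leftAct (a : SMat N (par (a := n) (b := m)) par) (g : SSq N r s) :
    lastCol (leftAct a g Z) = mulVec (leftMat a g) (lastCol Z) := by
  ext i
  rw [leftAct_eq_mul]; rfl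

/-- The value of the bordered form on the array with the rows of `Z` and the last row `Y`. -/
def borderedAt (L : MixedFun n m r s p q) (Z : SPoint N (coordPar n m r s (p + 1) q))
    (Y : SPoint N (par (a := p + 1) (b := q))) : Gr (Fin N) :=
  bordered L (dropCol Z) (lastCol Z) (initRow Y) (corner Y)

/-- The pairs of a transformation of the columns and the factor by which it changes the bordered
values. -/
def columnFactors (N : ℕ) (L : MixedFun n m r s p q) :
    Submonoid (SSq N (p + 1) q × EvenGr N) where
  carrier := {hc | ∀ (Z : SPoint N (coordPar n m r s (p + 1) q)) Y,
    (dropCol Z).body ∈ admissible n m r s p q →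
      (dropCol (SMat.mul Z hc.1)).body ∈ admissible n m r s p q ∧
      borderedAt L (SMat.mul Z hc.1) (vecMul Y hc.1) = borderedAt L Z Y * hc.2}
  one_mem' Z Y hZ := by
    simp only [Prod.fst_one, Prod.snd_one, SMat.mul_one', vecMul_one]
    exact ⟨hZ, by simp⟩
  mul_mem' := by
    rintro ⟨h, c⟩ ⟨h', c'⟩ hQ hQ' Z Y hZ
    obtain ⟨h1, h2⟩ := hQ Z Y hZ
    obtain ⟨h3, h4⟩ := hQ' (SMat.mul Z h) (vecMul Y h) h1
    simp only [Prod.mk_mul_mk, SMat.mul_eq, ← SMat.mul_assoc, vecMul_mul]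
    refine ⟨h3, h4.trans ?_⟩
    rw [h2, Subalgebra.coe_mul, mul_assoc]

theorem IsMixedForm.borderGenerators_columnFactors {L : MixedFun n m r s p q}
    (hL : IsMixedForm n m r s p q L) : BorderGenerators (columnFactors N L) where
  old h hh Z Y hZ := by
    simp only [borderedAt, dropCol_mul_border, lastCol_mul_border, initRow_vecMul_border,
      corner_vecMul_border, outer_zero_right, mulVec_zero, esmul_zero, pairing_zero_right,
      add_zero, one_esmul, one_mul]
    exact ⟨admissible_mul hZ hh, hL.bordered_mul _ _ _ hZ hh⟩
  corner d _ Z Y hZ := by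
    simp only [borderedAt, dropCol_mul_border, lastCol_mul_border, initRow_vecMul_border,
      corner_vecMul_border, outer_zero_right, mulVec_zero, esmul_zero, pairing_zero_right,
      add_zero, SMat.mul_one', vecMul_one, bordered_esmul_col]
    exact ⟨hZ, d.comm _⟩
  col c Z Y hZ := by
    simp only [borderedAt, dropCol_mul_border, lastCol_mul_border, initRow_vecMul_border,
      corner_vecMul_border, outer_zero_right, esmul_zero,
      add_zero, SMat.mul_one', vecMul_one, one_esmul, one_mul]
    exact ⟨hZ, by rw [hL.bordered_add_mulVec _ _ _ _ hZ, OneMemClass.coe_one, mul_one]⟩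
  row y Z Y hZ := by
    simp only [borderedAt, dropCol_mul_border, lastCol_mul_border, initRow_vecMul_border,
      corner_vecMul_border, mulVec_zero, pairing_zero_right,
      add_zero, SMat.mul_one', vecMul_one, one_esmul, one_mul]
    exact ⟨admissible_add_outer hZ _ _, by
      rw [hL.isPreForm.bordered_add_outer_row _ _ _ _ hZ, OneMemClass.coe_one, mul_one]⟩

/-- Bordered values are equivariant with respect to all columns, including the added one. -/
theorem IsMixedForm.borderedAt_mul {L : MixedFun n m r s p q} (hL : IsMixedForm n m r s p q L)
    {Z : SPoint N (coordPar n m r s (p + 1) q)} (hZ : Z.body ∈ admissible n m r s (p + 1) q)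
    (Y : SPoint N (par (a := p + 1) (b := q))) {h : SSq N (p + 1) q} (hh : IsUnit h.toMatrix) :
    borderedAt L (SMat.mul Z h) (vecMul Y h) = borderedAt L Z Y * ber h :=
  (hL.borderGenerators_columnFactors.mem hh Z Y (admissible_dropCol.mpr hZ)).2

theorem IsMixedForm.borderedAt_leftAct {L : MixedFun n m r s p q}
    (hL : IsMixedForm n m r s p q L)
    {Z : SPoint N (coordPar n m r s (p + 1) q)} (hZ : Z.body ∈ admissible n m r s (p + 1) q)
    (Y : SPoint N (par (a := p + 1) (b := q))) (a : SMat N (par (a := n) (b := m)) par)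
    {g : SSq N r s} (hg : IsUnit g.toMatrix) :
    borderedAt L (leftAct a g Z) Y = borderedAt L Z Y * ber g := by
  rw [borderedAt, dropCol_leftAct, lastCol_leftAct,
    hL.bordered_leftAct _ _ _ (admissible_dropCol.mpr hZ) a hg]
  rfl

/-- Adding a combination of the rows of `w` to the last row. -/
theorem IsMixedForm.borderedAt_add_vecMul {L : MixedFun n m r s p q}
    (hL : IsMixedForm n m r s p q L)
    {Z : SPoint N (coordPar n m r s (p + 1) q)} (hZ : Z.body ∈ admissible n m r s (p + 1) q)
    (Y : SPoint N (par (a := p + 1) (b := q))) (c : SPoint N (par (a := r) (b := s))) :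
    borderedAt L Z (Y + vecMul (wVec c) Z) = borderedAt L Z Y := by
  rw [borderedAt, borderedAt, ← hL.bordered_add_vecMul (lastCol Z) (initRow Y) (corner Y)
    (admissible_dropCol.mpr hZ) c]
  congr 1
  apply Subtype.ext
  rw [Subalgebra.coe_add, coe_corner, coe_pairing, SPoint.val_add, vecMul_wVec_val]
  rfl

theorem borderedAt_esmul (L : MixedFun n m r s p q) (Z : SPoint N (coordPar n m r s (p + 1) q))
    (Y : SPoint N (par (a := p + 1) (b := q))) (e : EvenGr N) :
    borderedAt L Z (e • Y) = e * borderedAt L Z Y := by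
  have e1 : initRow (e • Y) = e • initRow Y := by
    ext K
    rfl
  have e2 : corner (e • Y) = e * corner Y := Subtype.ext rfl
  rw [borderedAt, e1, e2, bordered_esmul_row, borderedAt]

/-- Adding multiples of the last row to the other rows. -/
theorem IsPreForm.borderedAt_add_outer {L : MixedFun n m r s p q} (hL : IsPreForm L)
    {Z : SPoint N (coordPar n m r s (p + 1) q)} (hZ : Z.body ∈ admissible n m r s (p + 1) q)
    (Y : SPoint N (par (a := p + 1) (b := q)))
    (b : SPoint N (rowPar (n := n) (m := m) (r := r) (s := s))) :
    borderedAt L (Z + outer b Y) Y = borderedAt L Z Y := by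
  have e1 : dropCol (Z + outer b Y) = dropCol Z + outer b (initRow Y) := by
    ext ⟨i, K⟩
    rfl
  have e2 : lastCol (Z + outer b Y) = lastCol Z + corner Y • b := by
    ext i
    exact congrArg (Z.val (i, newCol) + ·) ((corner Y).comm (b.val i)).symm
  rw [borderedAt, e1, e2, hL.bordered_add_outer_col _ _ _ _ (admissible_dropCol.mpr hZ), borderedAt]

end

/-! ### Transformations of the rows of an array with an additional row -/

section

variable {n m r s p q N : ℕ} (Z : SPoint N (coordPar n m (r + 1) s p q))

theorem dropRow_leftAct_border (g : SSq N r s) (c y : SPoint N (par (a := r) (b := s)))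
    (e : EvenGr N) : dropRow (leftAct 0 (border g c y e) Z) =
      leftAct 0 g (dropRow Z) + outer (wVec c) (lastRow Z) := by
  ext ⟨A | F, K⟩
  · change Z.val _ + ∑ F, 0 * _ = Z.val _ + ∑ F, 0 * _ + 0 * _
    simp only [zero_mul, Finset.sum_const_zero, add_zero]
    rfl
  · change ∑ G, (border g c y e).val (oldCol F, G) * Z.val (Sum.inr G, K) =
      ∑ G, g.val (F, G) * Z.val (Sum.inr (oldCol G), K) + c.val F * Z.val (Sum.inr newCol, K)
    rw [sum_idx_succ]
    simp

theorem lastRow_leftAct_border (g : SSq N r s) (c y : SPoint N (par (a := r) (b := s)))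
    (e : EvenGr N) : lastRow (leftAct 0 (border g c y e) Z) =
      e • lastRow Z + vecMul (wVec y) (dropRow Z) := by
  ext K
  rw [SPoint.val_add, vecMul_wVec_val]
  change ∑ G, (border g c y e).val (newCol, G) * Z.val (Sum.inr G, K) =
      e * Z.val (Sum.inr newCol, K) + ∑ G, y.val G * Z.val (Sum.inr (oldCol G), K)
  rw [sum_idx_succ]
  simp [add_comm]

theorem dropRow_leftAct_one (a : SMat N (par (a := n) (b := m)) (par (a := r + 1) (b := s))) :
    ∃ (a' : SMat N (par (a := n) (b := m)) (par (a := r) (b := s))) (b : SPoint N par),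
      dropRow (leftAct a 1 Z) = leftAct a' 1 (dropRow Z) + outer (pVec b) (lastRow Z) := by
  refine ⟨⟨fun AF => a.val (AF.1, oldCol AF.2), fun AF => ?_⟩,
    ⟨fun A => a.val (A, newCol), fun A => ?_⟩, ?_⟩
  · have := a.mem (AF.1, oldCol AF.2)
    rwa [par_oldCol] at this
  · have := a.mem (A, newCol)
    rwa [par_newCol, add_zero] at this
  · ext ⟨A | F, K⟩
    · change Z.val _ + ∑ G, a.val (A, G) * Z.val (Sum.inr G, K) =
        Z.val _ + ∑ G, a.val (A, oldCol G) * Z.val (Sum.inr (oldCol G), K) +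
          a.val (A, newCol) * Z.val (Sum.inr newCol, K)
      rw [sum_idx_succ, add_assoc]
      rfl
    · change ∑ G, (1 : SSq N (r + 1) s).val (oldCol F, G) * Z.val (Sum.inr G, K) =
        ∑ G, (1 : SSq N r s).val (F, G) * Z.val (Sum.inr (oldCol G), K) + 0 * _
      simp [SMat.one_val]

theorem lastRow_leftAct_one (a : SMat N (par (a := n) (b := m)) (par (a := r + 1) (b := s))) :
    lastRow (leftAct a 1 Z) = lastRow Z := by
  ext K
  change ∑ G, (1 : SSq N (r + 1) s).val (newCol, G) * Z.val (Sum.inr G, K) = Z.val _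
  simp [SMat.one_val]
  rfl

theorem leftAct_zero_one (z : SPoint N (coordPar n m r s p q)) :
    leftAct (0 : SMat N (par (a := n) (b := m)) par) 1 z = z := by
  ext ⟨A | F, K⟩
  · simp [leftAct]
  · simp [leftAct, SMat.one_val]

/-- The pairs of a transformation of the rows of `w` and the factor by which it changes a function
of arrays with an additional row. -/
def rowFactors (Φ : SPoint N (coordPar n m r s p q) → SPoint N (par (a := p) (b := q)) →
    Gr (Fin N)) : Submonoid (SSq N (r + 1) s × EvenGr N) where
  carrier := {gc | ∀ Z : SPoint N (coordPar n m (r + 1) s p q),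
    (dropRow Z).body ∈ admissible n m r s p q →
      (dropRow (leftAct 0 gc.1 Z)).body ∈ admissible n m r s p q ∧
      Φ (dropRow (leftAct 0 gc.1 Z)) (lastRow (leftAct 0 gc.1 Z)) =
        Φ (dropRow Z) (lastRow Z) * gc.2}
  one_mem' Z hZ := by
    simp only [Prod.fst_one, Prod.snd_one, leftAct_zero_one]
    exact ⟨hZ, by simp⟩
  mul_mem' := by
    rintro ⟨g, c⟩ ⟨g', c'⟩ hQ hQ' Z hZ
    obtain ⟨h1, h2⟩ := hQ' Z hZ
    obtain ⟨h3, h4⟩ := hQ (leftAct 0 g' Z) h1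
    have e : leftAct 0 (g * g') Z = leftAct 0 g (leftAct 0 g' Z) := by
      simp only [leftAct_eq_mul]
      rw [leftMat_mul_leftMat, SMat.mul_assoc]
    simp only [Prod.mk_mul_mk, e]
    refine ⟨h3, h4.trans ?_⟩
    rw [h2, mul_comm c c', Subalgebra.coe_mul, mul_assoc]

/-- Equivariance with respect to the rows of an array with an additional row, from the behaviour
under elementary transformations. -/
theorem leftAct_factor (Φ : SPoint N (coordPar n m r s p q) → SPoint N (par (a := p) (b := q)) →
      Gr (Fin N))
    (hold : ∀ z y, z.body ∈ admissible n m r s p q → ∀ a g, IsUnit g.toMatrix →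
      Φ (leftAct a g z) y = Φ z y * ber g)
    (hcorner : ∀ z y, z.body ∈ admissible n m r s p q → ∀ e : EvenGr N, Φ z (e • y) = e * Φ z y)
    (hrow : ∀ z y, z.body ∈ admissible n m r s p q → ∀ c, Φ z (y + vecMul (wVec c) z) = Φ z y)
    (hcol : ∀ z y, z.body ∈ admissible n m r s p q → ∀ b, Φ (z + outer b y) y = Φ z y)
    {Z : SPoint N (coordPar n m (r + 1) s p q)} (hZ : Z.body ∈ admissible n m (r + 1) s p q)
    (a : SMat N (par (a := n) (b := m)) (par (a := r + 1) (b := s))) {g : SSq N (r + 1) s}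
    (hg : IsUnit g.toMatrix) :
    Φ (dropRow (leftAct a g Z)) (lastRow (leftAct a g Z)) = Φ (dropRow Z) (lastRow Z) * ber g := by
  have hgen : BorderGenerators (rowFactors Φ) :=
    { old := fun g hg Z hZ => by
        simp only [dropRow_leftAct_border, lastRow_leftAct_border, wVec_zero, outer_zero_left,
          vecMul_zero, add_zero, one_esmul]
        exact ⟨admissible_leftAct _ hZ hg, hold _ _ hZ _ _ hg⟩
      corner := fun d _ Z hZ => by
        simp only [dropRow_leftAct_border, lastRow_leftAct_border, wVec_zero, outer_zero_left,
          vecMul_zero, add_zero, leftAct_zero_one]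
        exact ⟨hZ, (hcorner _ _ hZ d).trans (d.comm _)⟩
      col := fun c Z hZ => by
        simp only [dropRow_leftAct_border, lastRow_leftAct_border, wVec_zero,
          vecMul_zero, add_zero, leftAct_zero_one, one_esmul]
        exact ⟨admissible_add_outer hZ _ _, (hcol _ _ hZ _).trans (by simp)⟩
      row := fun y Z hZ => by
        simp only [dropRow_leftAct_border, lastRow_leftAct_border, wVec_zero, outer_zero_left,
          add_zero, leftAct_zero_one, one_esmul]
        exact ⟨hZ, (hrow _ _ hZ _).trans (by simp)⟩ }
  have hZ' := admissible_dropRow.mpr hZ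
  have e : leftAct a g Z = leftAct 0 g (leftAct a 1 Z) := by
    simp only [leftAct_eq_mul]
    rw [← SMat.mul_assoc, ← leftMat_eq_mul]
  obtain ⟨a', b, hab⟩ := dropRow_leftAct_one Z a
  have h1 := admissible_leftAct (g := 1) a' hZ' (SMat.isUnit_toMatrix isUnit_one)
  have h2 : (dropRow (leftAct a 1 Z)).body ∈ admissible n m r s p q := by
    rw [hab]; exact admissible_add_outer h1 _ _
  rw [e, (hgen.mem hg _ h2).2, lastRow_leftAct_one, hab, hcol _ _ h1,
    hold _ _ hZ' _ _ (SMat.isUnit_toMatrix isUnit_one), ber_one, OneMemClass.coe_one, mul_one]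

end

/-! ### Values of the operators at Grassmann-valued points -/

section

variable {I J : Type} [Fintype I] [DecidableEq I] [Fintype J] [DecidableEq J] {π : I → ZMod 2}
  {π' : J → ZMod 2} {N : ℕ} {U : Set (EvenIdx π → ℝ)} {F : SuperFun π}

theorem SPoint.comap_single (f : I → J) (hf : ∀ i, π' (f i) = π i) (hinj : Function.Injective f)
    (i : I) (x : Gr (Fin N)) (hx : x ∈ grPart (Fin N) (π i)) :
    (SPoint.single (π := π') (f i) x (by rwa [hf])).comap f hf = SPoint.single i x hx := by
  ext j
  change (Pi.single (f i) x : J → Gr (Fin N)) (f j) = (Pi.single i x : I → Gr (Fin N)) j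
  by_cases h : j = i
  · subst h; simp
  · rw [Pi.single_eq_of_ne h, Pi.single_eq_of_ne (hinj.ne h)]

theorem eval_pderiv_extend (f : I → J) (hf : ∀ i, π' (f i) = π i) (hinj : Function.Injective f)
    (hU : IsOpen U) (hF : ContDiffOn ℝ ∞ F U) {z : SPoint N π'}
    (hz : (z.comap f hf).body ∈ U) (i : I) :
    eval (pderiv (f i) (extend f hf F)) z = eval (pderiv i F) (z.comap f hf) := by
  have hU' := isOpen_restrictEven f hf hU
  have hE := contDiffOn_extend f hf hF
  -- both sides are compared after multiplication with a parameter of the parity of `i`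
  obtain ⟨θ, hθ, hinj'⟩ := exists_faithful_multiplier N (π i)
  rw [← sub_eq_zero]
  apply hinj'
  have hz' : (z.emb.comap f hf).body ∈ U := by rwa [SPoint.body_comap, SPoint.body_emb]
  have h := dEval_extend f hf hinj hU hF hz' (SPoint.single (π := π') (f i) θ (by rwa [hf]))
  have e1 : dEval (extend f hf F) z.emb
      (SPoint.single (π := π') (f i) θ (by rwa [hf])).val = θ *
        eval (pderiv (f i) (extend f hf F)) z.emb := dEval_pi_single _ _ _ _
  have e2 : dEval F (z.emb.comap f hf) (SPoint.single i θ hθ).val =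
      θ * eval (pderiv i F) (z.comap f hf).emb := dEval_pi_single _ _ _ _
  rw [SPoint.comap_single f hf hinj i θ hθ, e1, e2,
    eval_emb hU' (contDiffOn_pderiv hU' hE _) (z := z) hz,
    eval_emb hU (contDiffOn_pderiv hU hF _) hz] at h
  rw [map_sub, mul_sub, h, sub_self]

theorem d2Eval_smul_left (F : SuperFun π) (z : SPoint N π) (t : ℝ) (δ η : SPoint N π) :
    d2Eval F z (t • δ).val η.val = t • d2Eval F z δ.val η.val := by
  simp [d2Eval, Finset.smul_sum]

theorem d2Eval_emb (hU : IsOpen U) (hF : ContDiffOn ℝ ∞ F U) {z : SPoint N π}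
    (hz : z.body ∈ U) (δ η : SPoint N π) :
    d2Eval F z.emb δ.emb.val η.emb.val = grEmb N (d2Eval F z δ.val η.val) := by
  simp only [d2Eval, map_sum, map_mul, ← dEval_emb hU (contDiffOn_pderiv hU hF _) hz]
  rfl

end

section

variable {n m r s p q N : ℕ} {L : MixedFun n m r s p q}

theorem oldCol_injective : Function.Injective (oldCol : Idx p q → Idx (p + 1) q) :=
  Sum.map_injective.mpr ⟨Fin.castSucc_injective p, Function.injective_id⟩

theorem oldRow_injective : Function.Injective (oldRow : Row n m r s → Row n m (r + 1) s) :=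
  Sum.map_injective.mpr ⟨Function.injective_id,
    Sum.map_injective.mpr ⟨Fin.castSucc_injective r, Function.injective_id⟩⟩

theorem colMap_injective : Function.Injective
    (fun iK : Row n m r s × Idx p q => (iK.1, (oldCol iK.2 : Idx (p + 1) q))) :=
  Function.Injective.prodMap Function.injective_id oldCol_injective

theorem rowMap_injective : Function.Injective
    (fun iK : Row n m r s × Idx p q => ((oldRow iK.1 : Row n m (r + 1) s), iK.2)) :=
  Function.Injective.prodMap oldRow_injective Function.injective_id

theorem contDiffOn_addCol (hL : ContDiffOn ℝ ∞ L (admissible n m r s p q)) :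
    ContDiffOn ℝ ∞ (addCol L) (admissible n m r s (p + 1) q) :=
  (contDiffOn_extend _ _ hL).mono fun _ hx =>
    admissible_congr (fun i k => by rcases i with i | i <;> rfl) hx

theorem contDiffOn_addRow (hL : ContDiffOn ℝ ∞ L (admissible n m r s p q)) :
    ContDiffOn ℝ ∞ (addRow L) (admissible n m (r + 1) s p q) :=
  (contDiffOn_extend _ _ hL).mono fun _ hx =>
    admissible_congr (fun i k => by rcases i with i | i <;> rfl) hx

theorem eval_addCol (hL : ContDiffOn ℝ ∞ L (admissible n m r s p q))
    {Z : SPoint N (coordPar n m r s (p + 1) q)} (hZ : Z.body ∈ admissible n m r s (p + 1) q) :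
    eval (addCol L) Z = eval L (dropCol Z) :=
  eval_extend _ _ colMap_injective (isOpen_admissible n m r s p q) hL (admissible_dropCol.mpr hZ)

theorem eval_addRow (hL : ContDiffOn ℝ ∞ L (admissible n m r s p q))
    {Z : SPoint N (coordPar n m (r + 1) s p q)} (hZ : Z.body ∈ admissible n m (r + 1) s p q) :
    eval (addRow L) Z = eval L (dropRow Z) :=
  eval_extend _ _ rowMap_injective (isOpen_admissible n m r s p q) hL (admissible_dropRow.mpr hZ)

theorem eval_pderiv_addCol (hL : ContDiffOn ℝ ∞ L (admissible n m r s p q))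
    {Z : SPoint N (coordPar n m r s (p + 1) q)} (hZ : Z.body ∈ admissible n m r s (p + 1) q)
    (j : Row n m r s) (K : Idx p q) :
    eval (pderiv (j, oldCol K) (addCol L)) Z = eval (pderiv (j, K) L) (dropCol Z) :=
  eval_pderiv_extend (fun iK : Row n m r s × Idx p q => (iK.1, (oldCol iK.2 : Idx (p + 1) q)))
    _ colMap_injective (isOpen_admissible n m r s p q) hL (admissible_dropCol.mpr hZ) (j, K)

theorem eval_pderiv_addRow (hL : ContDiffOn ℝ ∞ L (admissible n m r s p q))
    {Z : SPoint N (coordPar n m (r + 1) s p q)} (hZ : Z.body ∈ admissible n m (r + 1) s p q)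
    (j : Row n m r s) (K : Idx p q) :
    eval (pderiv (oldRow j, K) (addRow L)) Z = eval (pderiv (j, K) L) (dropRow Z) :=
  eval_pderiv_extend (fun iK : Row n m r s × Idx p q => ((oldRow iK.1 : Row n m (r + 1) s), iK.2))
    _ rowMap_injective (isOpen_admissible n m r s p q) hL (admissible_dropRow.mpr hZ) (j, K)

theorem borderedAt_eq (L : MixedFun n m r s p q) (Z : SPoint N (coordPar n m r s (p + 1) q))
    (Y : SPoint N (par (a := p + 1) (b := q))) :
    borderedAt L Z Y = Y.val newCol * eval L (dropCol Z) -
      ∑ j : Row n m r s, ∑ K : Idx p q, sgn (rowPar j * par K) •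
        (Y.val (oldCol K) * (Z.val (j, newCol) * eval (pderiv (j, K) L) (dropCol Z))) := by
  rw [borderedAt, bordered, coe_corner, dEval, Fintype.sum_prod_type]
  congr 1
  refine Finset.sum_congr rfl fun j _ => Finset.sum_congr rfl fun K _ => ?_
  rw [outer_val, gr_mul_comm_sgn ((lastCol Z).mem j) ((initRow Y).mem K), smul_mul_assoc, mul_assoc]
  rfl

/-- The vector with the components `θ f_A`, where `f` is supported on the indices with the parity
of `θ`. -/
def paramVec {i : ZMod 2} (f : Idx n m → ℝ) (hf : ∀ A, par A ≠ i → f A = 0) {θ : Gr (Fin N)}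
    (hθ : θ ∈ grPart (Fin N) i) : SPoint N (par (a := n) (b := m)) where
  val A := f A • θ
  mem A := by
    by_cases h : par A = i
    · rw [h]; exact Submodule.smul_mem _ _ hθ
    · rw [hf A h, zero_smul]; exact Submodule.zero_mem _

/-- The combination of the rows of `V` with the coefficients `ν`. -/
def pRow (ν : SPoint N (par (a := n) (b := m))) (z : SPoint N (coordPar n m r s p q)) :
    SPoint N (par (a := p) (b := q)) := vecMul (pVec ν) z

theorem pRow_val (ν : SPoint N (par (a := n) (b := m))) (z : SPoint N (coordPar n m r s p q))
    (K : Idx p q) : (pRow ν z).val K = ∑ A, ν.val A * z.val (Sum.inl A, K) := by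
  rw [pRow, vecMul_val, Fintype.sum_sum_type]
  simp [pVec]

variable {V : Type*} [AddCommGroup V] [Module ℝ V] {b : Module.Basis (Idx n m) ℝ V}

theorem contDiffOn_eVec_term (hL : ContDiffOn ℝ ∞ L (admissible n m r s p q)) (A : Idx n m)
    (j : Row n m r s) (K : Idx p q) :
    ContDiffOn ℝ ∞ (sgn (rowPar j * par K) • coordMul (Sum.inl A, oldCol K) (coordMul (j, newCol)
          (pderiv (j, oldCol K) (addCol L)))) (admissible n m r s (p + 1) q) :=
  (contDiffOn_coordMul (contDiffOn_coordMul (contDiffOn_pderiv (isOpen_admissible _ _ _ _ _ _)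
    (contDiffOn_addCol hL) _) _) _).const_smul (sgn (rowPar j * par K))

theorem contDiffOn_eVec_summand (hL : ContDiffOn ℝ ∞ L (admissible n m r s p q)) (A : Idx n m) :
    ContDiffOn ℝ ∞ (coordMul (Sum.inl A, newCol) (addCol L) -
      ∑ j : Row n m r s, ∑ K : Idx p q, sgn (rowPar j * par K) •
        coordMul (Sum.inl A, oldCol K) (coordMul (j, newCol)
          (pderiv (j, oldCol K) (addCol L)))) (admissible n m r s (p + 1) q) :=
  (contDiffOn_coordMul (contDiffOn_addCol hL) _).sub
    (contDiffOn_superFun_sum _ fun j _ => contDiffOn_superFun_sum _ fun K _ =>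
      contDiffOn_eVec_term hL A j K)

theorem contDiffOn_eVec (hL : ContDiffOn ℝ ∞ L (admissible n m r s p q)) (u : V) :
    ContDiffOn ℝ ∞ (eVec b u L) (admissible n m r s (p + 1) q) :=
  (contDiffOn_superFun_sum _ fun A _ =>
    (contDiffOn_eVec_summand hL A).const_smul (b.repr u A)).const_smul ((-1 : ℝ) ^ r)

/-- Up to the sign `(-1)^r`, the value of `e(u) L`, multiplied by a parameter of the parity of `u`,
is the bordered value for the row `u^A p_A`. -/
theorem mul_eval_eVec (hL : ContDiffOn ℝ ∞ L (admissible n m r s p q)) {u : V} {i : ZMod 2}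
    (hu : ∀ A, par A ≠ i → b.repr u A = 0) {Z : SPoint N (coordPar n m r s (p + 1) q)}
    (hZ : Z.body ∈ admissible n m r s (p + 1) q) {θ : Gr (Fin N)} (hθ : θ ∈ grPart (Fin N) i) :
    θ * eval (eVec b u L) Z =
      (-1 : ℝ) ^ r • borderedAt L Z (pRow (paramVec (b.repr u) hu hθ) Z) := by
  have hU := isOpen_admissible n m r s (p + 1) q
  have hadd := contDiffOn_addCol hL
  have h1 : ∀ A ∈ Finset.univ, ContDiffOn ℝ ∞ (b.repr u A •
      (coordMul (Sum.inl A, newCol) (addCol L) -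
        ∑ j : Row n m r s, ∑ K : Idx p q, sgn (rowPar j * par K) •
        coordMul (Sum.inl A, oldCol K) (coordMul (j, newCol)
          (pderiv (j, oldCol K) (addCol L))))) (admissible n m r s (p + 1) q) :=
    fun A _ => (contDiffOn_eVec_summand hL A).const_smul (b.repr u A)
  rw [eVec, eval_const_smul hU (contDiffOn_superFun_sum _ h1) hZ, eval_sum hU _ h1 hZ, mul_smul_comm,
    borderedAt_eq]
  congr 1
  have h2 : ∀ A, eval (b.repr u A • (coordMul (Sum.inl A, newCol) (addCol L) -
        ∑ j : Row n m r s, ∑ K : Idx p q, sgn (rowPar j * par K) •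
        coordMul (Sum.inl A, oldCol K) (coordMul (j, newCol)
          (pderiv (j, oldCol K) (addCol L))))) Z =
      b.repr u A • (Z.val (Sum.inl A, newCol) * eval L (dropCol Z) -
        ∑ j : Row n m r s, ∑ K : Idx p q, sgn (rowPar j * par K) •
          (Z.val (Sum.inl A, oldCol K) *
            (Z.val (j, newCol) * eval (pderiv (j, K) L) (dropCol Z)))) := by
    intro A
    rw [eval_const_smul hU (contDiffOn_eVec_summand hL A) hZ,
      eval_sub hU (contDiffOn_coordMul hadd _) (contDiffOn_superFun_sum _ fun j _ =>
        contDiffOn_superFun_sum _ fun K _ => contDiffOn_eVec_term hL A j K) hZ,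
      eval_coordMul hU hadd hZ, eval_addCol hL hZ,
      eval_sum hU _ (fun j _ => contDiffOn_superFun_sum _ fun K _ =>
        contDiffOn_eVec_term hL A j K) hZ]
    congr 2
    refine Finset.sum_congr rfl fun j _ => ?_
    rw [eval_sum hU _ (fun K _ => contDiffOn_eVec_term hL A j K) hZ]
    refine Finset.sum_congr rfl fun K _ => ?_
    have h3 := contDiffOn_pderiv hU hadd (j, oldCol K)
    rw [eval_const_smul hU (contDiffOn_coordMul (contDiffOn_coordMul h3 _) _) hZ,
      eval_coordMul hU (contDiffOn_coordMul h3 _) hZ, eval_coordMul hU h3 hZ,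
      eval_pderiv_addCol hL hZ]
  simp only [h2, pRow_val, Finset.sum_mul, Finset.smul_sum]
  rw [Finset.mul_sum]
  simp only [mul_smul_comm, mul_sub, smul_sub, Finset.sum_sub_distrib, Finset.mul_sum,
    Finset.smul_sum, paramVec, smul_mul_assoc, mul_assoc]
  congr 1
  rw [Finset.sum_comm]
  refine Finset.sum_congr rfl fun j _ => ?_
  rw [Finset.sum_comm]
  refine Finset.sum_congr rfl fun K _ => Finset.sum_congr rfl fun A _ => smul_comm _ _ _

theorem contDiffOn_eCov_term (hL : ContDiffOn ℝ ∞ L (admissible n m r s p q)) (A : Idx n m)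
    (K : Idx p q) (x : ℝ) : ContDiffOn ℝ ∞ (x •
      coordMul (newRow, K) (pderiv (Sum.inl A, K) (addRow L))) (admissible n m (r + 1) s p q) :=
  (contDiffOn_coordMul (contDiffOn_pderiv (isOpen_admissible _ _ _ _ _ _)
    (contDiffOn_addRow hL) _) _).const_smul x

theorem contDiffOn_eCov (hL : ContDiffOn ℝ ∞ L (admissible n m r s p q)) (i : ZMod 2)
    (α : Module.Dual ℝ V) : ContDiffOn ℝ ∞ (eCov b i α L) (admissible n m (r + 1) s p q) :=
  (contDiffOn_superFun_sum _ fun A _ => contDiffOn_superFun_sum _ fun K _ =>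
    contDiffOn_eCov_term hL A K _).const_smul ((-1 : ℝ) ^ r)

/-- Up to the sign `(-1)^r`, the value of `e(α) L`, multiplied by a parameter of the parity of `α`,
is the derivative of `L` along the direction with the rows `α_A w_{r+1}`. -/
theorem mul_eval_eCov (hL : ContDiffOn ℝ ∞ L (admissible n m r s p q)) {i : ZMod 2}
    {α : Module.Dual ℝ V} (hα : ∀ A, par A ≠ i → α (b A) * sgn (i * par A) = 0)
    {Z : SPoint N (coordPar n m (r + 1) s p q)} (hZ : Z.body ∈ admissible n m (r + 1) s p q)
    {θ : Gr (Fin N)} (hθ : θ ∈ grPart (Fin N) i) :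
    θ * eval (eCov b i α L) Z = (-1 : ℝ) ^ r • dEval L (dropRow Z) (outer (pVec
      (paramVec (fun A => α (b A) * sgn (i * par A)) hα hθ)) (lastRow Z)).val := by
  have hU := isOpen_admissible n m (r + 1) s p q
  have hadd := contDiffOn_addRow hL
  rw [eCov, eval_const_smul hU (contDiffOn_superFun_sum _ fun A _ =>
    contDiffOn_superFun_sum _ fun K _ => contDiffOn_eCov_term hL A K _) hZ,
    eval_sum hU _ (fun A _ => contDiffOn_superFun_sum _ fun K _ =>
      contDiffOn_eCov_term hL A K _) hZ, mul_smul_comm, dEval, Fintype.sum_prod_type]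
  congr 1
  rw [Finset.mul_sum]
  refine Eq.trans ?_ (Fintype.sum_sum_type _).symm
  have h0 : ∑ F : Idx r s, ∑ K : Idx p q, (outer (pVec
      (paramVec (fun A => α (b A) * sgn (i * par A)) hα hθ)) (lastRow Z)).val (Sum.inr F, K) *
        eval (pderiv (Sum.inr F, K) L) (dropRow Z) = 0 := by
    refine Finset.sum_eq_zero fun F _ => Finset.sum_eq_zero fun K _ => ?_
    rw [outer_val]
    simp [pVec]
  rw [h0, add_zero]
  refine Finset.sum_congr rfl fun A _ => ?_
  rw [eval_sum hU _ (fun K _ => contDiffOn_eCov_term hL A K _) hZ, Finset.mul_sum]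
  refine Finset.sum_congr rfl fun K _ => ?_
  have h3 := contDiffOn_pderiv hU hadd (Sum.inl A, K)
  have h4 : eval (pderiv (Sum.inl A, K) (addRow L)) Z = eval (pderiv (Sum.inl A, K) L) (dropRow Z) :=
    eval_pderiv_addRow hL hZ (Sum.inl A) K
  rw [eval_const_smul hU (contDiffOn_coordMul h3 _) hZ, eval_coordMul hU h3 hZ, h4, outer_val,
    mul_smul_comm, ← mul_assoc, ← smul_mul_assoc, ← smul_mul_assoc]
  rfl

/-- The explicit formula for the stability map: the bordered values for the last row. -/
def sigmaFun (L : MixedFun n m r s p q) : MixedFun n m (r + 1) s (p + 1) q :=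
  coordMul (newRow, newCol) (addRow (addCol L)) -
    ∑ j : Row n m r s, ∑ K : Idx p q, sgn (rowPar j * par K) •
      coordMul (newRow, oldCol K) (coordMul (oldRow j, newCol)
        (pderiv (oldRow j, oldCol K) (addRow (addCol L))))

theorem contDiffOn_sigmaFun_term (hL : ContDiffOn ℝ ∞ L (admissible n m r s p q))
    (j : Row n m r s) (K : Idx p q) :
    ContDiffOn ℝ ∞ (sgn (rowPar j * par K) • coordMul (newRow, oldCol K)
      (coordMul (oldRow j, newCol) (pderiv (oldRow j, oldCol K) (addRow (addCol L)))))
      (admissible n m (r + 1) s (p + 1) q) :=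
  (contDiffOn_coordMul (contDiffOn_coordMul (contDiffOn_pderiv (isOpen_admissible _ _ _ _ _ _)
    (contDiffOn_addRow (contDiffOn_addCol hL)) _) _) _).const_smul (sgn (rowPar j * par K))

theorem contDiffOn_sigmaFun (hL : ContDiffOn ℝ ∞ L (admissible n m r s p q)) :
    ContDiffOn ℝ ∞ (sigmaFun L) (admissible n m (r + 1) s (p + 1) q) :=
  (contDiffOn_coordMul (contDiffOn_addRow (contDiffOn_addCol hL)) _).sub
    (contDiffOn_superFun_sum _ fun j _ => contDiffOn_superFun_sum _ fun K _ =>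
      contDiffOn_sigmaFun_term hL j K)

theorem eval_sigmaFun (hL : ContDiffOn ℝ ∞ L (admissible n m r s p q))
    {Z : SPoint N (coordPar n m (r + 1) s (p + 1) q)}
    (hZ : Z.body ∈ admissible n m (r + 1) s (p + 1) q) :
    eval (sigmaFun L) Z = borderedAt L (dropRow Z) (lastRow Z) := by
  have hU := isOpen_admissible n m (r + 1) s (p + 1) q
  have hadd := contDiffOn_addRow (contDiffOn_addCol hL)
  have hZ' := admissible_dropRow.mpr hZ
  rw [sigmaFun, eval_sub hU (contDiffOn_coordMul hadd _) (contDiffOn_superFun_sum _ fun j _ =>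
        contDiffOn_superFun_sum _ fun K _ => contDiffOn_sigmaFun_term hL j K) hZ,
    eval_coordMul hU hadd hZ, eval_addRow (contDiffOn_addCol hL) hZ, eval_addCol hL hZ',
    eval_sum hU _ (fun j _ => contDiffOn_superFun_sum _ fun K _ =>
        contDiffOn_sigmaFun_term hL j K) hZ, borderedAt_eq, lastRow_val]
  congr 1
  refine Finset.sum_congr rfl fun j _ => ?_
  rw [eval_sum hU _ (fun K _ => contDiffOn_sigmaFun_term hL j K) hZ]
  refine Finset.sum_congr rfl fun K _ => ?_
  have h3 := contDiffOn_pderiv hU hadd (oldRow j, oldCol K)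
  rw [eval_const_smul hU (contDiffOn_coordMul (contDiffOn_coordMul h3 _) _) hZ,
    eval_coordMul hU (contDiffOn_coordMul h3 _) hZ, eval_coordMul hU h3 hZ,
    eval_pderiv_addRow (contDiffOn_addCol hL) hZ, eval_pderiv_addCol hL hZ']
  rfl

end

/-! ### The operators preserve mixed forms -/

section

variable {n m r s p q : ℕ}

/-- The properties of a mixed form can be checked after multiplication with parameters of a given
parity; the second-order equations mean that the function is affine in directions of rank one. -/
theorem IsMixedForm.of_mul_eval {F : MixedFun n m r s p q} (i : ZMod 2)
    (hF : ContDiffOn ℝ ∞ F (admissible n m r s p q))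
    (hright : ∀ (N : ℕ), ∀ θ ∈ grPart (Fin N) i, ∀ (z : SPoint N (coordPar n m r s p q))
      (h : SSq N p q), z.body ∈ admissible n m r s p q → IsUnit h.toMatrix →
      θ * eval F (SMat.mul z h) = θ * eval F z * ber h)
    (hleft : ∀ (N : ℕ), ∀ θ ∈ grPart (Fin N) i, ∀ (z : SPoint N (coordPar n m r s p q))
      (a : SMat N (par (a := n) (b := m)) (par (a := r) (b := s))) (g : SSq N r s),
      z.body ∈ admissible n m r s p q → IsUnit g.toMatrix →
      θ * eval F (leftAct a g z) = θ * eval F z * ber g)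
    (haffine : ∀ (N : ℕ), ∀ θ ∈ grPart (Fin N) i, ∀ (z : SPoint N (coordPar n m r s p q))
      (b : SPoint N (rowPar (n := n) (m := m) (r := r) (s := s)))
      (c : SPoint N (par (a := p) (b := q))), z.body ∈ admissible n m r s p q →
      ∃ X, ∀ t : ℝ, θ * eval F (z + t • outer b c) = θ * eval F z + t • X) :
    IsMixedForm n m r s p q F := by
  have hU := isOpen_admissible n m r s p q
  have hpre : IsPreForm F := by
    refine IsPreForm.of_d2Eval hF fun N z hz b c => ?_
    obtain ⟨θ, hθ, hinj⟩ := exists_faithful_multiplier N i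
    apply hinj
    rw [← d2Eval_emb hU hF hz]
    have hz' : z.emb.body ∈ admissible n m r s p q := by rwa [SPoint.body_emb]
    have hzt : ∀ t : ℝ, (z.emb + t • outer b.emb c.emb).body ∈ admissible n m r s p q := fun t => by
      rw [← outer_smul_left]; exact admissible_add_outer hz' _ _
    obtain ⟨X, hX⟩ := haffine (N + 1) θ hθ z.emb b.emb c.emb hz'
    have e : SPoint.emb (outer b c) = outer b.emb c.emb := by
      ext ij
      exact map_mul (grEmb N) _ _
    have h1 : ∀ t : ℝ, θ * dEval F (z.emb + t • outer b.emb c.emb) (outer b.emb c.emb).val = X := by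
      intro t
      have h2 := hasDerivAt_gr_const_mul θ (hasDerivAt_eval hU hF (outer b.emb c.emb) (hzt t))
      simp only [hX] at h2
      have h3 := ((hasDerivAt_id t).smul_const X).const_add (θ * eval F z.emb)
      rw [one_smul] at h3
      exact h2.unique h3
    have h4 := hasDerivAt_gr_const_mul θ
      (hasDerivAt_dEval_zero hU hF (outer b.emb c.emb).val (outer b.emb c.emb) hz')
    simp only [h1] at h4
    rw [e]
    exact h4.unique (hasDerivAt_const 0 X)
  refine ⟨hF, fun N z h hz hh => ?_, fun N z a g hz hg => ?_, hpre.equations⟩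
  · obtain ⟨θ, hθ, hinj⟩ := exists_faithful_multiplier N i
    rw [← sub_eq_zero]
    apply hinj
    have hz' : z.emb.body ∈ admissible n m r s p q := by rwa [SPoint.body_emb]
    have e : SPoint.emb (SMat.mul z h) = SMat.mul z.emb (SPoint.emb h) := by
      ext ij
      change grEmb N (∑ K, z.val (ij.1, K) * h.val (K, ij.2)) =
        ∑ K, grEmb N (z.val (ij.1, K)) * grEmb N (h.val (K, ij.2))
      simp only [map_sum, map_mul]
    have hh' : IsUnit (SMat.toMatrix (SPoint.emb h : SSq (N + 1) p q)) :=
      hh.map (grEmb N).toRingHom.mapMatrix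
    have h1 := hright (N + 1) θ hθ z.emb (SPoint.emb h) hz' hh'
    rw [← e, eval_emb hU hF (admissible_mul hz hh), eval_emb hU hF hz, ber_emb hh, coe_evenEmb,
      mul_assoc, ← map_mul] at h1
    rw [map_sub, mul_sub, h1, sub_self]
  · obtain ⟨θ, hθ, hinj⟩ := exists_faithful_multiplier N i
    rw [← sub_eq_zero]
    apply hinj
    have hz' : z.emb.body ∈ admissible n m r s p q := by rwa [SPoint.body_emb]
    have e : (leftAct a g z).emb = leftAct (SPoint.emb a) (SPoint.emb g) z.emb := by
      ext ⟨A | F, K⟩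
      · exact (map_add (grEmb N) _ _).trans (congrArg _ ((map_sum (grEmb N) _ _).trans
          (Finset.sum_congr rfl fun K _ => map_mul (grEmb N) _ _)))
      · change grEmb N (∑ G, g.val (F, G) * z.val (Sum.inr G, K)) =
          ∑ G, grEmb N (g.val (F, G)) * grEmb N (z.val (Sum.inr G, K))
        simp only [map_sum, map_mul]
    have hg' : IsUnit (SMat.toMatrix (SPoint.emb g : SSq (N + 1) r s)) :=
      hg.map (grEmb N).toRingHom.mapMatrix
    have h1 := hleft (N + 1) θ hθ z.emb (SPoint.emb a) (SPoint.emb g) hz' hg'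
    rw [← e, eval_emb hU hF (admissible_leftAct a hz hg), eval_emb hU hF hz, ber_emb hg,
      coe_evenEmb, mul_assoc, ← map_mul] at h1
    rw [map_sub, mul_sub, h1, sub_self]

variable {N : ℕ} {L : MixedFun n m r s p q}

/-- The contraction of a row of coefficients with a column. -/
def rowPairing (ν b : SPoint N (rowPar (n := n) (m := m) (r := r) (s := s))) : EvenGr N :=
  ∑ i, evenMul (ν.mem i) (b.mem i)

theorem coe_rowPairing (ν b : SPoint N (rowPar (n := n) (m := m) (r := r) (s := s))) :
    (rowPairing ν b : Gr (Fin N)) = ∑ i, ν.val i * b.val i := by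
  rw [rowPairing, AddSubmonoidClass.coe_finsetSum]; rfl

theorem vecMul_outer (ν b : SPoint N (rowPar (n := n) (m := m) (r := r) (s := s)))
    (c : SPoint N (par (a := p) (b := q))) : vecMul ν (outer b c) = rowPairing ν b • c := by
  ext K
  rw [vecMul_val, SPoint.val_esmul, coe_rowPairing, Finset.sum_mul]
  simp only [outer_val, mul_assoc]

/-- Bordered values are affine along a direction of rank one of the bordered array, since the second
differential vanishes on pairs of directions of rank one with a common factor. -/
theorem IsPreForm.bordered_affine (hL : IsPreForm L) {z : SPoint N (coordPar n m r s p q)}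
    (hz : z.body ∈ admissible n m r s p q)
    (ζ b : SPoint N (rowPar (n := n) (m := m) (r := r) (s := s)))
    (y c : SPoint N (par (a := p) (b := q))) (η e ε : EvenGr N) :
    ∃ X, ∀ t : ℝ, bordered L (z + t • outer b c) (ζ + t • ε • b) (y + t • e • c)
      (η + t • (e * ε)) = bordered L z ζ y η + t • X := by
  refine ⟨η * dEval L z (outer b c).val + e * ε * eval L z -
    d2Eval L z (outer b c).val (outer ζ y).val - ε * dEval L z (outer b y).val -
    e * dEval L z (outer ζ c).val, fun t => ?_⟩
  have h1 : d2Eval L z (outer (t • b) c).val (outer (ζ + t • ε • b) (y + t • e • c)).val =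
      t • d2Eval L z (outer b c).val (outer ζ y).val := by
    have e1 : outer (t • ε • b) (y + t • e • c) = outer (t • b) (ε • (y + t • e • c)) := by
      rw [outer_smul_left, outer_esmul_left, outer_smul_left, outer_esmul_right]
    have e2 : outer ζ (t • e • c) = outer (t • e • ζ) c := by
      rw [outer_smul_left, outer_esmul_left, outer_smul_right, outer_esmul_right]
    rw [outer_add_left, d2Eval_add_right, e1, hL.d2Eval_same_row hz, add_zero, outer_add_right,
      d2Eval_add_right, e2, hL.d2Eval_same_col hz, add_zero, outer_smul_left, d2Eval_smul_left]
  have h2 : (((η + t • (e * ε) : EvenGr N)) : Gr (Fin N)) = η + t • ((e : Gr (Fin N)) * ε) := rfl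
  rw [bordered, h2, ← outer_smul_left, hL.eval_add_outer hz, hL.dEval_add_outer hz, h1, bordered]
  simp only [outer_add_left, outer_add_right, dEval_add, outer_smul_left, outer_smul_right,
    outer_esmul_left, outer_esmul_right, dEval_smul, dEval_esmul]
  have h3 : (e : Gr (Fin N)) * (ε * dEval L z (outer b c).val) =
      ε * (e * dEval L z (outer b c).val) := by
    rw [← mul_assoc, ← mul_assoc, e.comm]
  simp only [mul_add, add_mul, smul_mul_assoc, mul_smul_comm, smul_add, smul_sub, mul_assoc, h3]
  abel

theorem borderedAt_add_smul_outer (L : MixedFun n m r s p q)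
    (Z : SPoint N (coordPar n m r s (p + 1) q)) (Y Y' : SPoint N (par (a := p + 1) (b := q)))
    (b : SPoint N (rowPar (n := n) (m := m) (r := r) (s := s)))
    (c : SPoint N (par (a := p + 1) (b := q))) (t : ℝ) :
    borderedAt L (Z + t • outer b c) (Y + t • Y') =
      bordered L (dropCol Z + t • outer b (initRow c)) (lastCol Z + t • corner c • b)
        (initRow Y + t • initRow Y') (corner Y + t • corner Y') := by
  have e1 : dropCol (Z + t • outer b c) = dropCol Z + t • outer b (initRow c) := by
    ext ⟨i, K⟩
    rfl
  have e2 : lastCol (Z + t • outer b c) = lastCol Z + t • corner c • b := by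
    ext i
    exact congrArg (fun x => Z.val (i, newCol) + t • x) ((corner c).comm (b.val i)).symm
  have e3 : initRow (Y + t • Y') = initRow Y + t • initRow Y' := by
    ext K
    rfl
  have e4 : corner (Y + t • Y') = corner Y + t • corner Y' := Subtype.ext rfl
  rw [borderedAt, e1, e2, e3, e4]

theorem initRow_esmul (e : EvenGr N) (c : SPoint N (par (a := p + 1) (b := q))) :
    initRow (e • c) = e • initRow c := by
  ext K
  rfl

theorem corner_esmul (e : EvenGr N) (c : SPoint N (par (a := p + 1) (b := q))) :
    corner (e • c) = e * corner c := Subtype.ext rfl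

theorem IsPreForm.borderedAt_affine (hL : IsPreForm L)
    {Z : SPoint N (coordPar n m r s (p + 1) q)} (hZ : Z.body ∈ admissible n m r s (p + 1) q)
    (Y : SPoint N (par (a := p + 1) (b := q)))
    (b : SPoint N (rowPar (n := n) (m := m) (r := r) (s := s)))
    (c : SPoint N (par (a := p + 1) (b := q))) (e : EvenGr N) :
    ∃ X, ∀ t : ℝ, borderedAt L (Z + t • outer b c) (Y + t • e • c) =
      borderedAt L Z Y + t • X := by
  obtain ⟨X, hX⟩ := hL.bordered_affine (admissible_dropCol.mpr hZ) (lastCol Z) b (initRow Y)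
    (initRow c) (corner Y) e (corner c)
  refine ⟨X, fun t => ?_⟩
  rw [borderedAt_add_smul_outer, initRow_esmul, corner_esmul]
  exact hX t

theorem IsPreForm.dEval_affine (hL : IsPreForm L) {z : SPoint N (coordPar n m r s p q)}
    (hz : z.body ∈ admissible n m r s p q)
    (ν b : SPoint N (rowPar (n := n) (m := m) (r := r) (s := s)))
    (y c : SPoint N (par (a := p) (b := q))) (e : EvenGr N) :
    ∃ X, ∀ t : ℝ, dEval L (z + t • outer b c) (outer ν (y + t • e • c)).val =
      dEval L z (outer ν y).val + t • X := by
  refine ⟨e * dEval L z (outer ν c).val + d2Eval L z (outer b c).val (outer ν y).val, fun t => ?_⟩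
  have e2 : outer ν (t • e • c) = outer (t • e • ν) c := by
    rw [outer_smul_left, outer_esmul_left, outer_smul_right, outer_esmul_right]
  rw [← outer_smul_left, hL.dEval_add_outer hz, outer_add_right, d2Eval_add_right, e2,
    hL.d2Eval_same_col hz, dEval_add]
  simp only [outer_smul_left, d2Eval_smul_left, add_zero, outer_esmul_left, dEval_smul, dEval_esmul,
    smul_add, add_assoc]

variable {V : Type*} [AddCommGroup V] [Module ℝ V] {b : Module.Basis (Idx n m) ℝ V}

theorem pRow_leftAct (ν : SPoint N (par (a := n) (b := m)))
    (a : SMat N (par (a := n) (b := m)) (par (a := r) (b := s))) (g : SSq N r s)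
    (z : SPoint N (coordPar n m r s p q)) :
    pRow ν (leftAct a g z) = pRow ν z + vecMul (wVec (vecMul ν a)) z := by
  ext K
  rw [SPoint.val_add, pRow_val, pRow_val, vecMul_wVec_val]
  simp only [leftAct, mul_add, Finset.sum_add_distrib, vecMul_val, Finset.sum_mul, Finset.mul_sum,
    mul_assoc]
  congr 1
  exact Finset.sum_comm

theorem pRow_add_smul_outer (ν : SPoint N (par (a := n) (b := m)))
    (z : SPoint N (coordPar n m r s p q)) (t : ℝ)
    (β : SPoint N (rowPar (n := n) (m := m) (r := r) (s := s)))
    (c : SPoint N (par (a := p) (b := q))) :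
    pRow ν (z + t • outer β c) = pRow ν z + t • rowPairing (pVec ν) β • c := by
  rw [← vecMul_outer]
  ext K
  rw [SPoint.val_add, SPoint.val_smul, pRow, pRow, vecMul_val, vecMul_val, vecMul_val]
  simp only [SPoint.val_add, SPoint.val_smul, mul_add, mul_smul_comm, Finset.sum_add_distrib,
    Finset.smul_sum]

theorem IsMixedForm.eVec (hL : IsMixedForm n m r s p q L) {u : V} {i : ZMod 2}
    (hu : ∀ A, par A ≠ i → b.repr u A = 0) : IsMixedForm n m r s (p + 1) q (eVec b u L) := by
  have hsm := hL.smooth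
  refine IsMixedForm.of_mul_eval i (contDiffOn_eVec hsm u) (fun N θ hθ Z h hZ hh => ?_)
    (fun N θ hθ Z a g hZ hg => ?_) (fun N θ hθ Z β c hZ => ?_)
  · rw [mul_eval_eVec hsm hu (admissible_mul hZ hh) hθ, mul_eval_eVec hsm hu hZ hθ, pRow,
      vecMul_mul, hL.borderedAt_mul hZ _ hh, smul_mul_assoc, pRow]
  · rw [mul_eval_eVec hsm hu (admissible_leftAct a hZ hg) hθ, mul_eval_eVec hsm hu hZ hθ,
      pRow_leftAct, hL.borderedAt_leftAct hZ _ a hg, hL.borderedAt_add_vecMul hZ, smul_mul_assoc]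
  · obtain ⟨X, hX⟩ := hL.isPreForm.borderedAt_affine hZ (pRow (paramVec (b.repr u) hu hθ) Z) β c
      (rowPairing (pVec (paramVec (b.repr u) hu hθ)) β)
    refine ⟨(-1 : ℝ) ^ r • X, fun t => ?_⟩
    have hZ' : (Z + t • outer β c).body ∈ admissible n m r s (p + 1) q := by
      rw [← outer_smul_left]; exact admissible_add_outer hZ _ _
    rw [mul_eval_eVec hsm hu hZ' hθ, mul_eval_eVec hsm hu hZ hθ, pRow_add_smul_outer,
      hX, smul_add, smul_comm t]

theorem dropRow_mul (Z : SPoint N (coordPar n m (r + 1) s p q)) (h : SSq N p q) :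
    dropRow (SMat.mul Z h) = SMat.mul (dropRow Z) h := by
  ext ⟨i, K⟩
  rfl

theorem lastRow_mul (Z : SPoint N (coordPar n m (r + 1) s p q)) (h : SSq N p q) :
    lastRow (SMat.mul Z h) = vecMul (lastRow Z) h := by
  ext K
  rfl

theorem dropRow_add_smul_outer (Z : SPoint N (coordPar n m (r + 1) s p q)) (t : ℝ)
    (β : SPoint N (rowPar (n := n) (m := m) (r := r + 1) (s := s)))
    (c : SPoint N (par (a := p) (b := q))) : dropRow (Z + t • outer β c) =
      dropRow Z + t • outer (β.comap oldRow rowPar_oldRow) c := by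
  ext ⟨i, K⟩
  rfl

theorem lastRow_add_smul_outer (Z : SPoint N (coordPar n m (r + 1) s p q)) (t : ℝ)
    (β : SPoint N (rowPar (n := n) (m := m) (r := r + 1) (s := s)))
    (c : SPoint N (par (a := p) (b := q))) : lastRow (Z + t • outer β c) =
      lastRow Z + t • (⟨β.val newRow, β.mem newRow⟩ : EvenGr N) • c := by
  ext K
  rfl

theorem IsMixedForm.sigmaFun (hL : IsMixedForm n m r s p q L) :
    IsMixedForm n m (r + 1) s (p + 1) q (sigmaFun L) := by
  have hsm := hL.smooth
  refine IsMixedForm.of_mul_eval 0 (contDiffOn_sigmaFun hsm) (fun N θ hθ Z h hZ hh => ?_)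
    (fun N θ hθ Z a g hZ hg => ?_) (fun N θ hθ Z β c hZ => ?_)
  · rw [eval_sigmaFun hsm (admissible_mul hZ hh), eval_sigmaFun hsm hZ, dropRow_mul, lastRow_mul,
      hL.borderedAt_mul (admissible_dropRow.mpr hZ) _ hh, mul_assoc]
  · rw [eval_sigmaFun hsm (admissible_leftAct a hZ hg), eval_sigmaFun hsm hZ, mul_assoc]
    congr 1
    exact leftAct_factor (borderedAt L) (fun z y hz a g hg => hL.borderedAt_leftAct hz y a hg)
      (fun z y _ e => borderedAt_esmul L z y e) (fun z y hz c => hL.borderedAt_add_vecMul hz y c)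
      (fun z y hz b => hL.isPreForm.borderedAt_add_outer hz y b) hZ a hg
  · obtain ⟨X, hX⟩ := hL.isPreForm.borderedAt_affine (admissible_dropRow.mpr hZ) (lastRow Z)
      (β.comap oldRow rowPar_oldRow) c ⟨β.val newRow, β.mem newRow⟩
    refine ⟨θ * X, fun t => ?_⟩
    have hZ' : (Z + t • outer β c).body ∈ admissible n m (r + 1) s (p + 1) q := by
      rw [← outer_smul_left]; exact admissible_add_outer hZ _ _
    rw [eval_sigmaFun hsm hZ', eval_sigmaFun hsm hZ, dropRow_add_smul_outer,
      lastRow_add_smul_outer, hX, mul_add, mul_smul_comm]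

theorem mulVec_leftMat_pVec (ν : SPoint N (par (a := n) (b := m)))
    (a : SMat N (par (a := n) (b := m)) (par (a := r) (b := s))) (g : SSq N r s) :
    mulVec (leftMat a g) (pVec ν) = pVec ν := by
  ext (A | F)
  · rw [mulVec_val]
    refine (Fintype.sum_sum_type _).trans ?_
    simp [leftMat, pVec, SMat.one_val]
  · rw [mulVec_val]
    refine (Fintype.sum_sum_type _).trans ?_
    simp [leftMat, pVec]

theorem IsMixedForm.eCov (hL : IsMixedForm n m r s p q L) {i : ZMod 2} {α : Module.Dual ℝ V}
    (hα : ∀ A, par A ≠ i → α (b A) * sgn (i * par A) = 0) :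
    IsMixedForm n m (r + 1) s p q (eCov b i α L) := by
  have hsm := hL.smooth
  refine IsMixedForm.of_mul_eval i (contDiffOn_eCov hsm i α) (fun N θ hθ Z h hZ hh => ?_)
    (fun N θ hθ Z a g hZ hg => ?_) (fun N θ hθ Z β c hZ => ?_)
  · rw [mul_eval_eCov hsm hα (admissible_mul hZ hh) hθ, mul_eval_eCov hsm hα hZ hθ, dropRow_mul,
      lastRow_mul, ← SMat.outer_mul, hL.dEval_mul (admissible_dropRow.mpr hZ) hh, smul_mul_assoc]
  · rw [mul_eval_eCov hsm hα (admissible_leftAct a hZ hg) hθ, mul_eval_eCov hsm hα hZ hθ,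
      smul_mul_assoc]
    congr 1
    refine leftAct_factor (fun z y => dEval L z (outer (pVec
      (paramVec (fun A => α (b A) * sgn (i * par A)) hα hθ)) y).val) (fun z y hz a g hg => ?_)
      (fun z y _ e => ?_) (fun z y hz c => ?_)
      (fun z y hz b => ?_) hZ a hg
    · rw [← hL.dEval_leftAct hz a hg, leftAct_outer, mulVec_leftMat_pVec]
    · rw [outer_esmul_right, dEval_esmul]
    · rw [outer_add_right, dEval_add, hL.dEval_outer_pVec hz, add_zero]
    · rw [hL.isPreForm.dEval_add_outer hz, hL.isPreForm.d2Eval_same_col hz, add_zero]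
  · obtain ⟨X, hX⟩ := hL.isPreForm.dEval_affine (admissible_dropRow.mpr hZ)
      (pVec (paramVec (fun A => α (b A) * sgn (i * par A)) hα hθ))
      (β.comap oldRow rowPar_oldRow) (lastRow Z) c ⟨β.val newRow, β.mem newRow⟩
    refine ⟨(-1 : ℝ) ^ r • X, fun t => ?_⟩
    have hZ' : (Z + t • outer β c).body ∈ admissible n m (r + 1) s p q := by
      rw [← outer_smul_left]; exact admissible_add_outer hZ _ _
    rw [mul_eval_eCov hsm hα hZ' hθ, mul_eval_eCov hsm hα hZ hθ, dropRow_add_smul_outer,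
      lastRow_add_smul_outer, hX, smul_add, smul_comm t]

end

/-! ### The stability map -/

section

variable {n m r s p q N : ℕ} {L : MixedFun n m r s p q}

theorem reduceArray_eq (Z : SPoint N (coordPar n m (r + 1) s (p + 1) q)) (c : EvenGr N) :
    reduceArray Z c = dropCol (dropRow Z) +
      outer ((-1 : ℝ) • c • lastCol (dropRow Z)) (initRow (lastRow Z)) := by
  ext ⟨i, K⟩
  rw [SPoint.val_add, outer_val, SPoint.val_smul, SPoint.val_esmul, EvenGr.comm, neg_one_smul,
    neg_mul, ← sub_eq_add_neg]
  rfl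

/-- For an invertible corner entry the bordered value is the value at the reduced array, because `L`
is affine in directions of rank one. -/
theorem IsPreForm.sigmaFormula (hL : IsPreForm L) : SigmaFormula L (sigmaFun L) := by
  intro N Z c hZ hc
  have hz := admissible_dropCol.mpr (admissible_dropRow.mpr hZ)
  have hc' : (c : Gr (Fin N)) * corner (lastRow Z) = 1 := hc
  have he : Z.val (newRow, newCol) = corner (lastRow Z) := rfl
  rw [eval_sigmaFun hL.smooth hZ, reduceArray_eq, hL.eval_add_outer hz, borderedAt, bordered,
    outer_smul_left, outer_esmul_left, dEval_smul, dEval_esmul, neg_one_smul, he, add_mul, neg_mul,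
    c.comm, mul_assoc, hc', mul_one, EvenGr.comm, sub_eq_add_neg]

/-- The formula for `σ` determines a smooth function, because the arrays with invertible corner entry
are dense. -/
theorem eqOn_of_sigmaFormula {L₁ L₂ : MixedFun n m (r + 1) s (p + 1) q}
    (h₁ : ContDiffOn ℝ ∞ L₁ (admissible n m (r + 1) s (p + 1) q)) (hσ₁ : SigmaFormula L L₁)
    (h₂ : ContDiffOn ℝ ∞ L₂ (admissible n m (r + 1) s (p + 1) q)) (hσ₂ : SigmaFormula L L₂) :
    Set.EqOn L₁ L₂ (admissible n m (r + 1) s (p + 1) q) := by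
  have hU := isOpen_admissible n m (r + 1) s (p + 1) q
  set k : EvenIdx (coordPar n m (r + 1) s (p + 1) q) := ⟨(newRow, newCol), rfl⟩ with hk
  -- the two functions agree where the corner entry does not vanish
  have key : ∀ x ∈ admissible n m (r + 1) s (p + 1) q, x k ≠ 0 → L₁ x = L₂ x := by
    intro x hx hxk
    rw [← sub_eq_zero]
    refine eq_zero_of_eval (F := L₁ - L₂) fun N z hz => ?_
    have hz' : z.body ∈ admissible n m (r + 1) s (p + 1) q := by rwa [hz]
    have hu : IsUnit (corner (lastRow z)) := by
      apply isUnit_of_evenBody_ne_zero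
      rw [← hz] at hxk
      exact hxk
    obtain ⟨c, hc⟩ := hu.exists_left_inv
    have hc' : (c : Gr (Fin N)) * z.val (newRow, newCol) = 1 := congrArg Subtype.val hc
    rw [eval_sub hU h₁ h₂ hz', hσ₁ N z c hz' hc', hσ₂ N z c hz' hc', sub_self]
  -- such points are dense on the line through `x` in the direction of the corner entry
  intro x hx
  have hline : ∀ t : ℝ, x + t • Pi.single k 1 ∈ admissible n m (r + 1) s (p + 1) q := by
    intro t
    refine admissible_congr (fun i j => ?_) hx
    have hne : (⟨(Sum.map Sum.inr Sum.inr i, Sum.inr j), by cases i <;> rfl⟩ :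
        EvenIdx (coordPar n m (r + 1) s (p + 1) q)) ≠ k := by
      intro h
      have := congrArg (fun a => a.1.2) h
      simp [hk, newCol] at this
    simp [oddEntry, Pi.single_eq_of_ne hne]
  have hc : Continuous fun t : ℝ => x + t • (Pi.single k 1 : _ → ℝ) := by fun_prop
  have h := Continuous.ext_on (dense_compl_singleton (-x k))
    (h₁.continuousOn.comp_continuous hc hline) (h₂.continuousOn.comp_continuous hc hline)
    (fun t ht => key _ (hline t) fun h => ht (by
      have h' : x k + t = 0 := by simpa using h
      exact Set.mem_singleton_iff.mpr (by linarith)))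
  simpa using congrFun h 0

theorem IsMixedForm.sigma_spec (hL : IsMixedForm n m r s p q L) :
    IsMixedForm n m (r + 1) s (p + 1) q (sigma L) ∧ SigmaFormula L (sigma L) := by
  have h : ∃ L', IsMixedForm n m (r + 1) s (p + 1) q L' ∧ SigmaFormula L L' :=
    ⟨_, hL.sigmaFun, hL.isPreForm.sigmaFormula⟩
  rw [sigma, dif_pos h]
  exact h.choose_spec

theorem IsMixedForm.sigma_eqOn (hL : IsMixedForm n m r s p q L) :
    Set.EqOn (sigma L) (MixedForms.sigmaFun L) (admissible n m (r + 1) s (p + 1) q) :=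
  eqOn_of_sigmaFormula hL.sigma_spec.1.smooth hL.sigma_spec.2
    hL.sigmaFun.smooth hL.isPreForm.sigmaFormula

end

/-! ### Derivatives of bordered values -/

section

variable {n m r s p q N : ℕ} {L : MixedFun n m r s p q}

theorem hasDerivAt_bordered (hL : ContDiffOn ℝ ∞ L (admissible n m r s p q))
    {z : SPoint N (coordPar n m r s p q)} (hz : z.body ∈ admissible n m r s p q)
    (δ : SPoint N (coordPar n m r s p q))
    (ζ ζ' : SPoint N (rowPar (n := n) (m := m) (r := r) (s := s)))
    (y y' : SPoint N (par (a := p) (b := q))) (e e' : EvenGr N) :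
    HasDerivAt (fun t : ℝ => bordered L (z + t • δ) (ζ + t • ζ') (y + t • y') (e + t • e'))
      (e' * eval L z + e * dEval L z δ.val - d2Eval L z (outer ζ y).val δ.val -
        dEval L z (outer ζ' y).val - dEval L z (outer ζ y').val) 0 := by
  have hU := isOpen_admissible n m r s p q
  have h1 := hasDerivAt_eval_zero hU hL hz δ
  have hd : ∀ η, HasDerivAt (fun t : ℝ => dEval L (z + t • δ) η) (d2Eval L z η δ.val) 0 :=
    fun η => hasDerivAt_dEval_zero hU hL η δ hz
  have hid : HasDerivAt (fun t : ℝ => t) 1 0 := hasDerivAt_id 0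
  have h2 := (hasDerivAt_gr_const_mul (e : Gr (Fin N)) h1).add
    (hid.smul (hasDerivAt_gr_const_mul (e' : Gr (Fin N)) h1))
  have h3 := (hid.smul ((hd (outer ζ' y).val).add (hd (outer ζ y').val)))
  have h4 := hid.smul (hid.smul (hd (outer ζ' y').val))
  have h5 := h2.sub (((hd (outer ζ y).val).add h3).add h4)
  refine (h5.congr_deriv ?_).congr_of_eventuallyEq (Filter.Eventually.of_forall fun t => ?_)
  · simp only [zero_smul, one_smul, add_zero, zero_add, Pi.add_apply, Pi.smul_apply']
    abel
  · have h2 : (((e + t • e' : EvenGr N)) : Gr (Fin N)) = e + t • (e' : Gr (Fin N)) := rfl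
    simp only [bordered, outer_add_left, outer_add_right, dEval_add, outer_smul_left,
      outer_smul_right, dEval_smul, h2, add_mul, smul_mul_assoc, Pi.add_apply, Pi.sub_apply,
      Pi.smul_apply', smul_add]
    abel

theorem hasDerivAt_dEval_outer (hL : ContDiffOn ℝ ∞ L (admissible n m r s p q))
    {z : SPoint N (coordPar n m r s p q)} (hz : z.body ∈ admissible n m r s p q)
    (δ : SPoint N (coordPar n m r s p q))
    (ν : SPoint N (rowPar (n := n) (m := m) (r := r) (s := s)))
    (y y' : SPoint N (par (a := p) (b := q))) :
    HasDerivAt (fun t : ℝ => dEval L (z + t • δ) (outer ν (y + t • y')).val)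
      (d2Eval L z (outer ν y).val δ.val + dEval L z (outer ν y').val) 0 := by
  have hU := isOpen_admissible n m r s p q
  have hd : ∀ η, HasDerivAt (fun t : ℝ => dEval L (z + t • δ) η) (d2Eval L z η δ.val) 0 :=
    fun η => hasDerivAt_dEval_zero hU hL η δ hz
  have hid : HasDerivAt (fun t : ℝ => t) 1 0 := hasDerivAt_id 0
  have h5 := (hd (outer ν y).val).add (hid.smul (hd (outer ν y').val))
  refine (h5.congr_deriv ?_).congr_of_eventuallyEq (Filter.Eventually.of_forall fun t => ?_)
  · simp only [zero_smul, one_smul, zero_add]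
    simp
  · simp only [outer_add_right, dEval_add, outer_smul_right, dEval_smul, Pi.add_apply,
      Pi.smul_apply']

/-- A parameter times a bordered value, from a formula for the values along the line in question. -/
theorem mul_borderedAt_eq (hL : ContDiffOn ℝ ∞ L (admissible n m r s p q))
    {Z : SPoint N (coordPar n m r s (p + 1) q)} (hZ : Z.body ∈ admissible n m r s (p + 1) q)
    (Y : SPoint N (par (a := p + 1) (b := q))) (θ : Gr (Fin N)) {φ : ℝ → Gr (Fin N)}
    {φ' : Gr (Fin N)} (hφ : HasDerivAt φ φ' 0)
    (h : ∀ t : ℝ, (dropCol Z + t • outer (lastCol Z) (initRow Y)).body ∈ admissible n m r s p q →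
      θ * eval L (dropCol Z + t • outer (lastCol Z) (initRow Y)) = φ t) :
    θ * borderedAt L Z Y = corner Y * φ 0 - φ' := by
  have hz := admissible_dropCol.mpr hZ
  have h0 := h 0 (by simpa using hz)
  rw [zero_smul, add_zero] at h0
  rw [borderedAt, bordered, mul_sub, mul_dEval_eq (isOpen_admissible n m r s p q) hL hz _ θ hφ h,
    ← mul_assoc, ← EvenGr.comm, mul_assoc, h0]

theorem borderedAt_congr {L' : MixedFun n m r s p q} (h : Set.EqOn L L' (admissible n m r s p q))
    {Z : SPoint N (coordPar n m r s (p + 1) q)} (hZ : Z.body ∈ admissible n m r s (p + 1) q)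
    (Y : SPoint N (par (a := p + 1) (b := q))) : borderedAt L Z Y = borderedAt L' Z Y := by
  have hU := isOpen_admissible n m r s p q
  have hz := admissible_dropCol.mpr hZ
  rw [borderedAt, borderedAt, bordered, bordered, eval_congr hU h hz, dEval_congr hU h hz]

/-- The value of `L` bordered with two columns and with two rows. -/
def bordered₂ (L : MixedFun n m r s p q) (Z : SPoint N (coordPar n m r s (p + 1 + 1) q))
    (Y Y' : SPoint N (par (a := p + 1 + 1) (b := q))) : Gr (Fin N) :=
  (corner Y * corner (initRow Y') - corner Y' * corner (initRow Y) : EvenGr N) *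
      eval L (dropCol (dropCol Z)) -
    (corner Y * dEval L (dropCol (dropCol Z))
        (outer (lastCol (dropCol Z)) (initRow (initRow Y'))).val -
      corner Y' * dEval L (dropCol (dropCol Z))
        (outer (lastCol (dropCol Z)) (initRow (initRow Y))).val) -
    (corner (initRow Y') * dEval L (dropCol (dropCol Z))
        (outer (lastCol Z) (initRow (initRow Y))).val -
      corner (initRow Y) * dEval L (dropCol (dropCol Z))
        (outer (lastCol Z) (initRow (initRow Y'))).val) +
    d2Eval L (dropCol (dropCol Z)) (outer (lastCol (dropCol Z)) (initRow (initRow Y'))).val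
      (outer (lastCol Z) (initRow (initRow Y))).val

/-- By the second-order equations, the double bordered values are skew-symmetric in the rows. -/
theorem IsPreForm.bordered₂_swap (hL : IsPreForm L)
    {Z : SPoint N (coordPar n m r s (p + 1 + 1) q)}
    (hZ : Z.body ∈ admissible n m r s (p + 1 + 1) q)
    (Y Y' : SPoint N (par (a := p + 1 + 1) (b := q))) :
    bordered₂ L Z Y Y' + bordered₂ L Z Y' Y = 0 := by
  have hz := admissible_dropCol.mpr (admissible_dropCol.mpr hZ)
  have h1 := hL.d2Eval_swap hz (lastCol (dropCol Z)) (lastCol Z) (initRow (initRow Y'))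
    (initRow (initRow Y))
  rw [d2Eval_symm (isOpen_admissible n m r s p q) hL.smooth hz
    (outer (lastCol Z) (initRow (initRow Y')))] at h1
  rw [← h1, bordered₂, bordered₂, ← neg_sub (corner Y * corner (initRow Y')), NegMemClass.coe_neg,
    neg_mul]
  abel

/-- The derivative, in the direction given by the last column and the row `Y`, of the bordered values
of the array without its last column. The row used for bordering varies with the array, as a row
`u^A p_A` does. -/
theorem hasDerivAt_borderedAt (hL : ContDiffOn ℝ ∞ L (admissible n m r s p q))
    {Z : SPoint N (coordPar n m r s (p + 1 + 1) q)}
    (hZ : Z.body ∈ admissible n m r s (p + 1 + 1) q)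
    (Y Y' : SPoint N (par (a := p + 1 + 1) (b := q))) :
    HasDerivAt (fun t : ℝ => borderedAt L (dropCol Z + t • outer (lastCol Z) (initRow Y))
        (initRow Y' + t • corner Y' • initRow Y))
      (corner Y * borderedAt L (dropCol Z) (initRow Y') - bordered₂ L Z Y Y') 0 := by
  have hz := admissible_dropCol.mpr (admissible_dropCol.mpr hZ)
  simp only [borderedAt_add_smul_outer]
  refine (hasDerivAt_bordered hL hz _ _ _ _ _ _ _).congr_deriv ?_
  rw [bordered₂, borderedAt, bordered, initRow_esmul, corner_esmul, outer_esmul_left,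
    outer_esmul_right, dEval_esmul, dEval_esmul, AddSubgroupClass.coe_sub, sub_mul, mul_sub,
    Subalgebra.coe_mul, Subalgebra.coe_mul, ← mul_assoc]
  abel

end

/-! ### Compositions of the operators -/

section

variable {n m r s p q N : ℕ} {L : MixedFun n m r s p q} {V : Type*} [AddCommGroup V] [Module ℝ V]
  {b : Module.Basis (Idx n m) ℝ V} {i j : ZMod 2}

theorem dropRow_dropCol (Z : SPoint N (coordPar n m (r + 1) s (p + 1) q)) :
    dropRow (dropCol Z) = dropCol (dropRow Z) := by
  ext ⟨k, K⟩
  rfl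

theorem lastRow_dropCol (Z : SPoint N (coordPar n m (r + 1) s (p + 1) q)) :
    lastRow (dropCol Z) = initRow (lastRow Z) := by
  ext K
  rfl

theorem comap_lastCol (Z : SPoint N (coordPar n m (r + 1) s (p + 1) q)) :
    (lastCol Z).comap oldRow rowPar_oldRow = lastCol (dropRow Z) := by
  ext k
  rfl

theorem comap_pVec (ν : SPoint N (par (a := n) (b := m))) :
    (pVec (r := r + 1) (s := s) ν).comap oldRow rowPar_oldRow = pVec ν := by
  ext (A | F) <;> rfl

theorem pRow_dropCol (ν : SPoint N (par (a := n) (b := m)))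
    (Z : SPoint N (coordPar n m r s (p + 1) q)) : pRow ν (dropCol Z) = initRow (pRow ν Z) := by
  ext K
  rfl

theorem pRow_dropRow (ν : SPoint N (par (a := n) (b := m)))
    (Z : SPoint N (coordPar n m (r + 1) s p q)) : pRow ν (dropRow Z) = pRow ν Z := by
  ext K
  rw [pRow_val, pRow_val]
  rfl

theorem rowPairing_lastCol (ν : SPoint N (par (a := n) (b := m)))
    (Z : SPoint N (coordPar n m r s (p + 1) q)) :
    rowPairing (pVec ν) (lastCol Z) = corner (pRow ν Z) := by
  apply Subtype.ext
  rw [coe_rowPairing]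
  rfl

/-- Bordering `e(v) L` by another column and a row `Y` gives `L` bordered with two columns and with
the rows `Y` and `v^A p_A`. -/
theorem mul_borderedAt_eVec (hL : ContDiffOn ℝ ∞ L (admissible n m r s p q)) {v : V}
    (hv : ∀ A, par A ≠ j → b.repr v A = 0) {Z : SPoint N (coordPar n m r s (p + 1 + 1) q)}
    (hZ : Z.body ∈ admissible n m r s (p + 1 + 1) q) (Y : SPoint N (par (a := p + 1 + 1) (b := q)))
    {θ : Gr (Fin N)} (hθ : θ ∈ grPart (Fin N) j) :
    θ * borderedAt (eVec b v L) Z Y =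
      (-1 : ℝ) ^ r • bordered₂ L Z Y (pRow (paramVec (b.repr v) hv hθ) Z) := by
  have h1 := (hasDerivAt_borderedAt hL hZ Y (pRow (paramVec (b.repr v) hv hθ) Z)).const_smul
    ((-1 : ℝ) ^ r)
  rw [mul_borderedAt_eq (contDiffOn_eVec hL v) hZ Y θ h1 fun t ht => ?_]
  · simp only [zero_smul, add_zero, Pi.smul_apply]
    rw [mul_smul_comm, ← smul_sub, sub_sub_cancel]
  · rw [mul_eval_eVec hL hv ht hθ, pRow_add_smul_outer, pRow_dropCol, rowPairing_lastCol]
    rfl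

theorem borderedAt_sigmaFun (hL : ContDiffOn ℝ ∞ L (admissible n m r s p q))
    {Z : SPoint N (coordPar n m (r + 1) s (p + 1 + 1) q)}
    (hZ : Z.body ∈ admissible n m (r + 1) s (p + 1 + 1) q)
    (Y : SPoint N (par (a := p + 1 + 1) (b := q))) :
    borderedAt (sigmaFun L) Z Y = bordered₂ L (dropRow Z) Y (lastRow Z) := by
  have h1 := hasDerivAt_borderedAt hL (admissible_dropRow.mpr hZ) Y (lastRow Z)
  have h2 := mul_borderedAt_eq (contDiffOn_sigmaFun hL) hZ Y 1 h1 fun t ht => ?_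
  · rw [one_mul] at h2
    rw [h2, zero_smul, zero_smul, add_zero, add_zero, sub_sub_cancel]
  · rw [one_mul, eval_sigmaFun hL ht, dropRow_add_smul_outer, lastRow_add_smul_outer,
      dropRow_dropCol, lastRow_dropCol, comap_lastCol]
    rfl

theorem hasDerivAt_borderedAt_outer (hL : ContDiffOn ℝ ∞ L (admissible n m r s p q))
    {Z : SPoint N (coordPar n m r s (p + 1) q)} (hZ : Z.body ∈ admissible n m r s (p + 1) q)
    (β : SPoint N (rowPar (n := n) (m := m) (r := r) (s := s)))
    (c Y Y' : SPoint N (par (a := p + 1) (b := q))) :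
    HasDerivAt (fun t : ℝ => borderedAt L (Z + t • outer β c) (Y + t • Y'))
      (borderedAt L Z Y' + (corner Y * dEval L (dropCol Z) (outer β (initRow c)).val -
        d2Eval L (dropCol Z) (outer β (initRow c)).val (outer (lastCol Z) (initRow Y)).val -
        corner c * dEval L (dropCol Z) (outer β (initRow Y)).val)) 0 := by
  have hz := admissible_dropCol.mpr hZ
  simp only [borderedAt_add_smul_outer]
  refine (hasDerivAt_bordered hL hz _ _ _ _ _ _ _).congr_deriv ?_
  rw [d2Eval_symm (isOpen_admissible n m r s p q) hL hz (outer (lastCol Z) (initRow Y)),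
    outer_esmul_left, dEval_esmul, borderedAt, bordered]
  abel

/-- The derivative, along the direction `β ⊗ W`, of the value of `L` bordered with the row `Y`, if
this row is kept. -/
def borderedDeriv (L : MixedFun n m r s p q) (Z : SPoint N (coordPar n m r s (p + 1) q))
    (β : SPoint N (rowPar (n := n) (m := m) (r := r) (s := s)))
    (Y W : SPoint N (par (a := p + 1) (b := q))) : Gr (Fin N) :=
  corner Y * dEval L (dropCol Z) (outer β (initRow W)).val -
    d2Eval L (dropCol Z) (outer β (initRow W)).val (outer (lastCol Z) (initRow Y)).val -
    corner W * dEval L (dropCol Z) (outer β (initRow Y)).val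

/-- By the second-order equations, bordered derivatives are skew-symmetric in the row and the
direction. -/
theorem IsPreForm.borderedDeriv_swap (hL : IsPreForm L)
    {Z : SPoint N (coordPar n m r s (p + 1) q)} (hZ : Z.body ∈ admissible n m r s (p + 1) q)
    (β : SPoint N (rowPar (n := n) (m := m) (r := r) (s := s)))
    (Y W : SPoint N (par (a := p + 1) (b := q))) :
    borderedDeriv L Z β Y W + borderedDeriv L Z β W Y = 0 := by
  have hz := admissible_dropCol.mpr hZ
  have h1 := hL.d2Eval_swap hz β (lastCol Z) (initRow W) (initRow Y)
  rw [d2Eval_symm (isOpen_admissible n m r s p q) hL.smooth hz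
    (outer (lastCol Z) (initRow W))] at h1
  rw [← neg_eq_zero, ← h1, borderedDeriv, borderedDeriv]
  abel

variable {α : Module.Dual ℝ V}

theorem mul_dEval_eCov (hL : ContDiffOn ℝ ∞ L (admissible n m r s p q))
    (hα : ∀ A, par A ≠ i → α (b A) * sgn (i * par A) = 0)
    {Z : SPoint N (coordPar n m (r + 1) s p q)} (hZ : Z.body ∈ admissible n m (r + 1) s p q)
    (γ : SPoint N (rowPar (n := n) (m := m) (r := r + 1) (s := s)))
    (c : SPoint N (par (a := p) (b := q))) {θ : Gr (Fin N)} (hθ : θ ∈ grPart (Fin N) i) :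
    θ * dEval (eCov b i α L) Z (outer γ c).val = (-1 : ℝ) ^ r • (d2Eval L (dropRow Z)
        (outer (pVec (paramVec (fun A => α (b A) * sgn (i * par A)) hα hθ)) (lastRow Z)).val
        (outer (γ.comap oldRow rowPar_oldRow) c).val +
      γ.val newRow * dEval L (dropRow Z)
        (outer (pVec (paramVec (fun A => α (b A) * sgn (i * par A)) hα hθ)) c).val) := by
  have h1 := (hasDerivAt_dEval_outer hL (admissible_dropRow.mpr hZ)
    (outer (γ.comap oldRow rowPar_oldRow) c)
    (pVec (paramVec (fun A => α (b A) * sgn (i * par A)) hα hθ)) (lastRow Z)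
    ((⟨γ.val newRow, γ.mem newRow⟩ : EvenGr N) • c)).const_smul ((-1 : ℝ) ^ r)
  rw [mul_dEval_eq (isOpen_admissible n m (r + 1) s p q) (contDiffOn_eCov hL i α) hZ (outer γ c) θ
    h1 fun t ht => ?_]
  · rw [outer_esmul_right, dEval_esmul]
  · rw [mul_eval_eCov hL hα ht hθ, dropRow_add_smul_outer, lastRow_add_smul_outer]
    rfl

theorem mul_borderedAt_eCov (hL : ContDiffOn ℝ ∞ L (admissible n m r s p q))
    (hα : ∀ A, par A ≠ i → α (b A) * sgn (i * par A) = 0)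
    {Z : SPoint N (coordPar n m (r + 1) s (p + 1) q)}
    (hZ : Z.body ∈ admissible n m (r + 1) s (p + 1) q)
    (Y : SPoint N (par (a := p + 1) (b := q))) {θ : Gr (Fin N)} (hθ : θ ∈ grPart (Fin N) i) :
    θ * borderedAt (eCov b i α L) Z Y = (-1 : ℝ) ^ r • borderedDeriv L (dropRow Z)
      (pVec (paramVec (fun A => α (b A) * sgn (i * par A)) hα hθ)) Y (lastRow Z) := by
  have hz := admissible_dropCol.mpr hZ
  rw [borderedAt, bordered, mul_sub, ← mul_assoc, ← EvenGr.comm, mul_assoc,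
    mul_eval_eCov hL hα hz hθ, mul_dEval_eCov hL hα hz _ _ hθ, mul_smul_comm, ← smul_sub,
    dropRow_dropCol, lastRow_dropCol, comap_lastCol, borderedDeriv, sub_sub]
  rfl

/-- The derivative of `e(u) L` in the direction `γ ⊗ W`. The row `u^A p_A` varies with the array,
which yields the first term. -/
theorem mul_dEval_eVec (hL : ContDiffOn ℝ ∞ L (admissible n m r s p q)) {u : V}
    (hu : ∀ A, par A ≠ i → b.repr u A = 0) {Z : SPoint N (coordPar n m r s (p + 1) q)}
    (hZ : Z.body ∈ admissible n m r s (p + 1) q)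
    (γ : SPoint N (rowPar (n := n) (m := m) (r := r) (s := s)))
    (W : SPoint N (par (a := p + 1) (b := q))) {θ : Gr (Fin N)} (hθ : θ ∈ grPart (Fin N) i) :
    θ * dEval (eVec b u L) Z (outer γ W).val = (-1 : ℝ) ^ r •
      (rowPairing (pVec (paramVec (b.repr u) hu hθ)) γ * borderedAt L Z W +
        borderedDeriv L Z γ (pRow (paramVec (b.repr u) hu hθ) Z) W) := by
  have h1 := (hasDerivAt_borderedAt_outer hL hZ γ W (pRow (paramVec (b.repr u) hu hθ) Z)
    (rowPairing (pVec (paramVec (b.repr u) hu hθ)) γ • W)).const_smul ((-1 : ℝ) ^ r)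
  rw [mul_dEval_eq (isOpen_admissible n m r s (p + 1) q) (contDiffOn_eVec hL u) hZ (outer γ W) θ
    h1 fun t ht => ?_]
  · rw [borderedAt_esmul]
    rfl
  · rw [mul_eval_eVec hL hu ht hθ, pRow_add_smul_outer]
    rfl

theorem dEval_sigmaFun (hL : ContDiffOn ℝ ∞ L (admissible n m r s p q))
    {Z : SPoint N (coordPar n m (r + 1) s (p + 1) q)}
    (hZ : Z.body ∈ admissible n m (r + 1) s (p + 1) q)
    (ν : SPoint N (par (a := n) (b := m))) (W : SPoint N (par (a := p + 1) (b := q))) :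
    dEval (sigmaFun L) Z (outer (pVec ν) W).val =
      borderedDeriv L (dropRow Z) (pVec ν) (lastRow Z) W := by
  have h1 := hasDerivAt_borderedAt_outer hL (admissible_dropRow.mpr hZ) (pVec ν) W (lastRow Z) 0
  have h0 : borderedAt L (dropRow Z) 0 = 0 := by
    have := borderedAt_esmul L (dropRow Z) 0 0
    rwa [esmul_zero, ZeroMemClass.coe_zero, zero_mul] at this
  have h2 := mul_dEval_eq (isOpen_admissible n m (r + 1) s (p + 1) q) (contDiffOn_sigmaFun hL) hZ
    (outer (pVec ν) W) 1 h1 fun t ht => ?_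
  · rw [one_mul, h0, zero_add] at h2
    exact h2
  · have e : (⟨(pVec (r := r + 1) (s := s) ν).val newRow, (pVec (r := r + 1) (s := s) ν).mem newRow⟩ :
        EvenGr N) • W = 0 := by
      ext K
      exact zero_mul _
    rw [one_mul, eval_sigmaFun hL ht, dropRow_add_smul_outer, lastRow_add_smul_outer, comap_pVec, e]

end

/-! ### The relations -/

section

variable {n m r s p q : ℕ} {L : MixedFun n m r s p q} {V : Type*} [AddCommGroup V] [Module ℝ V]
  {b : Module.Basis (Idx n m) ℝ V} {i j : ZMod 2}

theorem neg_one_pow_smul_neg_one_pow_smul {M : Type*} [AddCommGroup M] [Module ℝ M] (r : ℕ)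
    (x : M) : (-1 : ℝ) ^ r • (-1 : ℝ) ^ r • x = x := by
  rw [smul_smul, ← mul_pow, neg_one_mul, neg_neg, one_pow, one_smul]

theorem IsMixedForm.eVec_eVec (hL : IsMixedForm n m r s p q L) {u v : V}
    (hu : ∀ A, par A ≠ i → b.repr u A = 0) (hv : ∀ A, par A ≠ j → b.repr v A = 0) :
    Set.EqOn (MixedForms.eVec b u (MixedForms.eVec b v L) +
      sgn (i * j) • MixedForms.eVec b v (MixedForms.eVec b u L)) 0
      (admissible n m r s (p + 1 + 1) q) := by
  intro x hx
  have hU := isOpen_admissible n m r s (p + 1 + 1) q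
  have hsm := hL.smooth
  have h1 := contDiffOn_eVec (b := b) (contDiffOn_eVec (b := b) hsm v) u
  have h2 := contDiffOn_eVec (b := b) (contDiffOn_eVec (b := b) hsm u) v
  have h2' : ContDiffOn ℝ ∞ (sgn (i * j) • MixedForms.eVec b v (MixedForms.eVec b u L))
    (admissible n m r s (p + 1 + 1) q) := h2.const_smul (sgn (i * j))
  have key : ∀ {i j : ZMod 2} {u v : V} (hu : ∀ A, par A ≠ i → b.repr u A = 0)
      (hv : ∀ A, par A ≠ j → b.repr v A = 0) (N : ℕ)
      (Z : SPoint N (coordPar n m r s (p + 1 + 1) q)),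
      Z.body ∈ admissible n m r s (p + 1 + 1) q → ∀ (θ θ' : Gr (Fin N))
      (hθ : θ ∈ grPart (Fin N) i) (hθ' : θ' ∈ grPart (Fin N) j),
      θ' * θ * eval (MixedForms.eVec b u (MixedForms.eVec b v L)) Z =
        bordered₂ L Z (pRow (paramVec (b.repr u) hu hθ) Z) (pRow (paramVec (b.repr v) hv hθ') Z) := by
    intro i j u v hu hv N Z hZ θ θ' hθ hθ'
    rw [mul_assoc, mul_eval_eVec (contDiffOn_eVec hsm v) hu hZ hθ, mul_smul_comm,
      mul_borderedAt_eVec hsm hv hZ _ hθ', neg_one_pow_smul_neg_one_pow_smul]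
  refine eq_zero_of_mul_mul_eval (F := MixedForms.eVec b u (MixedForms.eVec b v L) +
    sgn (i * j) • MixedForms.eVec b v (MixedForms.eVec b u L)) hU (h1.add h2') hx j i
    fun N Z hZ θ' hθ' θ hθ => ?_
  have hZ' : Z.body ∈ admissible n m r s (p + 1 + 1) q := by rwa [hZ]
  rw [eval_add hU h1 h2' hZ', eval_const_smul hU h2 hZ', mul_add,
    mul_smul_comm, ← smul_mul_assoc, ← gr_mul_comm_sgn hθ hθ', key hu hv N Z hZ' θ θ' hθ hθ',
    key hv hu N Z hZ' θ' θ hθ' hθ, hL.isPreForm.bordered₂_swap hZ']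

theorem IsMixedForm.eCov_eCov (hL : IsMixedForm n m r s p q L) {α β : Module.Dual ℝ V}
    (hα : ∀ A, par A ≠ i → α (b A) * sgn (i * par A) = 0)
    (hβ : ∀ A, par A ≠ j → β (b A) * sgn (j * par A) = 0) :
    Set.EqOn (MixedForms.eCov b i α (MixedForms.eCov b j β L) +
      sgn (i * j) • MixedForms.eCov b j β (MixedForms.eCov b i α L)) 0
      (admissible n m (r + 1 + 1) s p q) := by
  intro x hx
  have hU := isOpen_admissible n m (r + 1 + 1) s p q
  have hsm := hL.smooth
  have h1 := contDiffOn_eCov (b := b) (contDiffOn_eCov (b := b) hsm j β) i α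
  have h2 := contDiffOn_eCov (b := b) (contDiffOn_eCov (b := b) hsm i α) j β
  have h2' : ContDiffOn ℝ ∞ (sgn (i * j) • MixedForms.eCov b j β (MixedForms.eCov b i α L))
    (admissible n m (r + 1 + 1) s p q) := h2.const_smul (sgn (i * j))
  have key : ∀ {i j : ZMod 2} {α β : Module.Dual ℝ V}
      (hα : ∀ A, par A ≠ i → α (b A) * sgn (i * par A) = 0)
      (hβ : ∀ A, par A ≠ j → β (b A) * sgn (j * par A) = 0) (N : ℕ)
      (Z : SPoint N (coordPar n m (r + 1 + 1) s p q)),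
      Z.body ∈ admissible n m (r + 1 + 1) s p q → ∀ (θ θ' : Gr (Fin N))
      (hθ : θ ∈ grPart (Fin N) i) (hθ' : θ' ∈ grPart (Fin N) j),
      θ' * θ * eval (MixedForms.eCov b i α (MixedForms.eCov b j β L)) Z =
        -d2Eval L (dropRow (dropRow Z))
          (outer (pVec (paramVec (fun A => β (b A) * sgn (j * par A)) hβ hθ'))
            (lastRow (dropRow Z))).val
          (outer (pVec (paramVec (fun A => α (b A) * sgn (i * par A)) hα hθ)) (lastRow Z)).val := by
    intro i j α β hα hβ N Z hZ θ θ' hθ hθ'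
    have e : (pVec (r := r + 1) (s := s) (paramVec (fun A => α (b A) * sgn (i * par A)) hα
      hθ)).val newRow = 0 := rfl
    rw [mul_assoc, mul_eval_eCov (contDiffOn_eCov hsm j β) hα hZ hθ, mul_smul_comm,
      mul_dEval_eCov hsm hβ (admissible_dropRow.mpr hZ) _ _ hθ', e, zero_mul, add_zero, comap_pVec,
      pow_succ, mul_neg_one, neg_smul, neg_one_pow_smul_neg_one_pow_smul]
  refine eq_zero_of_mul_mul_eval (F := MixedForms.eCov b i α (MixedForms.eCov b j β L) +
    sgn (i * j) • MixedForms.eCov b j β (MixedForms.eCov b i α L)) hU (h1.add h2') hx j i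
    fun N Z hZ θ' hθ' θ hθ => ?_
  have hZ' : Z.body ∈ admissible n m (r + 1 + 1) s p q := by rwa [hZ]
  have hz := admissible_dropRow.mpr (admissible_dropRow.mpr hZ')
  rw [eval_add hU h1 h2' hZ', eval_const_smul hU h2 hZ', mul_add,
    mul_smul_comm, ← smul_mul_assoc, ← gr_mul_comm_sgn hθ hθ', key hα hβ N Z hZ' θ θ' hθ hθ',
    key hβ hα N Z hZ' θ' θ hθ' hθ, ← neg_add, neg_eq_zero,
    d2Eval_symm (isOpen_admissible n m r s p q) hsm hz (outer (pVec (paramVec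
      (fun A => α (b A) * sgn (i * par A)) hα hθ)) (lastRow (dropRow Z)))]
  rw [d2Eval_symm (isOpen_admissible n m r s p q) hsm hz (outer (pVec (paramVec
      (fun A => β (b A) * sgn (j * par A)) hβ hθ')) (lastRow Z))]
  exact hL.isPreForm.d2Eval_swap hz _ _ _ _

/-- The contraction of the parameter vectors of `u` and `α` is `⟨u, α⟩`, up to parameters. -/
theorem rowPairing_paramVec {N : ℕ} {u : V} {α : Module.Dual ℝ V}
    (hu : ∀ A, par A ≠ i → b.repr u A = 0)
    (hα : ∀ A, par A ≠ j → α (b A) * sgn (j * par A) = 0) {θ θ' : Gr (Fin N)}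
    (hθ : θ ∈ grPart (Fin N) i) (hθ' : θ' ∈ grPart (Fin N) j) :
    (rowPairing (pVec (r := r) (s := s) (paramVec (b.repr u) hu hθ))
      (pVec (paramVec (fun A => α (b A) * sgn (j * par A)) hα hθ')) : Gr (Fin N)) =
      α u • (θ' * θ) := by
  rw [coe_rowPairing]
  refine (Fintype.sum_sum_type _).trans ?_
  have h0 : ∑ F : Idx r s, (pVec (r := r) (s := s) (paramVec (b.repr u) hu hθ)).val (Sum.inr F) *
      (pVec (r := r) (s := s) (paramVec (fun A => α (b A) * sgn (j * par A)) hα hθ')).val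
        (Sum.inr F) = 0 := Finset.sum_eq_zero fun F _ => zero_mul _
  rw [h0, add_zero]
  have h1 : α u = ∑ A, b.repr u A * α (b A) := by
    conv_lhs => rw [← b.sum_repr u]
    simp only [map_sum, map_smul, smul_eq_mul]
  rw [h1, Finset.sum_smul]
  refine Finset.sum_congr rfl fun A _ => ?_
  change (b.repr u A • θ) * ((α (b A) * sgn (j * par A)) • θ') = _
  by_cases hi : par A = i
  · by_cases hj : par A = j
    · rw [smul_mul_smul_comm, gr_mul_comm_sgn hθ hθ', smul_smul, ← hi, ← hj]
      congr 1
      rw [mul_assoc, mul_assoc, sgn_mul_self, mul_one]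
    · have h2 := hα A hj
      have h3 : sgn (j * par A) ≠ 0 := fun h => by
        have := sgn_mul_self (j * par A)
        rw [h] at this
        simp at this
      have h4 := (mul_eq_zero.mp h2).resolve_right h3
      simp [h4]
  · simp [hu A hi]

/-- Both compositions consist of a bordered derivative in the direction `α ⊗ w_{r+1}`, with opposite
signs; the remaining term of `e(α) e(u)` comes from the derivative of the row `u^A p_A`. -/
theorem IsMixedForm.eVec_eCov (hL : IsMixedForm n m r s p q L) {u : V} {α : Module.Dual ℝ V}
    (hu : ∀ A, par A ≠ i → b.repr u A = 0)
    (hα : ∀ A, par A ≠ j → α (b A) * sgn (j * par A) = 0) :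
    Set.EqOn (MixedForms.eVec b u (MixedForms.eCov b j α L) +
      sgn (j * i) • MixedForms.eCov b j α (MixedForms.eVec b u L)) (α u • sigma L)
      (admissible n m (r + 1) s (p + 1) q) := by
  intro x hx
  have hU := isOpen_admissible n m (r + 1) s (p + 1) q
  have hsm := hL.smooth
  have h1 := contDiffOn_eVec (b := b) (contDiffOn_eCov (b := b) hsm j α) u
  have h2 := contDiffOn_eCov (b := b) (contDiffOn_eVec (b := b) hsm u) j α
  have h2' : ContDiffOn ℝ ∞ (sgn (j * i) • MixedForms.eCov b j α (MixedForms.eVec b u L))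
    (admissible n m (r + 1) s (p + 1) q) := h2.const_smul (sgn (j * i))
  have h3 : ContDiffOn ℝ ∞ (α u • MixedForms.sigmaFun L) (admissible n m (r + 1) s (p + 1) q) :=
    (contDiffOn_sigmaFun hsm).const_smul (α u)
  have h12 : ContDiffOn ℝ ∞ (MixedForms.eVec b u (MixedForms.eCov b j α L) +
    sgn (j * i) • MixedForms.eCov b j α (MixedForms.eVec b u L))
    (admissible n m (r + 1) s (p + 1) q) := h1.add h2'
  have hσ : (α u • sigma L) x = (α u • MixedForms.sigmaFun L) x :=
    congrArg (α u • ·) (hL.sigma_eqOn hx)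
  rw [hσ, ← sub_eq_zero]
  refine eq_zero_of_mul_mul_eval (F := MixedForms.eVec b u (MixedForms.eCov b j α L) +
    sgn (j * i) • MixedForms.eCov b j α (MixedForms.eVec b u L) - α u • MixedForms.sigmaFun L)
    hU (h12.sub h3) hx j i fun N Z hZ θ' hθ' θ hθ => ?_
  have hZ' : Z.body ∈ admissible n m (r + 1) s (p + 1) q := by rwa [hZ]
  rw [eval_sub hU h12 h3 hZ', eval_add hU h1 h2' hZ', eval_const_smul hU h2 hZ',
    eval_const_smul hU (contDiffOn_sigmaFun hsm) hZ', eval_sigmaFun hsm hZ', mul_sub, mul_add,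
    mul_smul_comm, mul_comm j i, ← smul_mul_assoc, ← gr_mul_comm_sgn hθ hθ', mul_assoc θ',
    mul_assoc θ, mul_eval_eVec (contDiffOn_eCov hsm j α) hu hZ' hθ,
    mul_eval_eCov (contDiffOn_eVec hsm u) hα hZ' hθ', mul_smul_comm, mul_smul_comm,
    mul_borderedAt_eCov hsm hα hZ' _ hθ', mul_dEval_eVec hsm hu (admissible_dropRow.mpr hZ') _ _ hθ,
    pow_succ, mul_neg_one, neg_smul, neg_one_pow_smul_neg_one_pow_smul,
    neg_one_pow_smul_neg_one_pow_smul, rowPairing_paramVec hu hα hθ hθ', pRow_dropRow,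
    smul_mul_assoc, mul_smul_comm]
  abel

theorem IsMixedForm.sigma_eVec (hL : IsMixedForm n m r s p q L) {u : V}
    (hu : ∀ A, par A ≠ i → b.repr u A = 0) :
    Set.EqOn (sigma (MixedForms.eVec b u L)) (MixedForms.eVec b u (sigma L))
      (admissible n m (r + 1) s (p + 1 + 1) q) := by
  intro x hx
  have hU := isOpen_admissible n m (r + 1) s (p + 1 + 1) q
  have hsm := hL.smooth
  have hsu := contDiffOn_eVec (b := b) hsm u
  have h1 := contDiffOn_sigmaFun hsu
  have h2 := contDiffOn_eVec (b := b) hL.sigma_spec.1.smooth u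
  rw [(hL.eVec hu).sigma_eqOn hx, ← sub_eq_zero]
  refine eq_zero_of_mul_eval (F := MixedForms.sigmaFun (MixedForms.eVec b u L) -
    MixedForms.eVec b u (sigma L)) hU (h1.sub h2) hx i fun N Z hZ θ hθ => ?_
  have hZ' : Z.body ∈ admissible n m (r + 1) s (p + 1 + 1) q := by rwa [hZ]
  rw [eval_sub hU h1 h2 hZ', mul_sub, eval_sigmaFun hsu hZ',
    mul_borderedAt_eVec hsm hu (admissible_dropRow.mpr hZ') _ hθ,
    mul_eval_eVec hL.sigma_spec.1.smooth hu hZ' hθ, borderedAt_congr hL.sigma_eqOn hZ',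
    borderedAt_sigmaFun hsm hZ', pow_succ, mul_neg_one, neg_smul, sub_neg_eq_add, ← smul_add,
    pRow_dropRow, hL.isPreForm.bordered₂_swap (admissible_dropRow.mpr hZ'), smul_zero]

theorem IsMixedForm.sigma_eCov (hL : IsMixedForm n m r s p q L) {α : Module.Dual ℝ V}
    (hα : ∀ A, par A ≠ i → α (b A) * sgn (i * par A) = 0) :
    Set.EqOn (sigma (MixedForms.eCov b i α L)) (MixedForms.eCov b i α (sigma L))
      (admissible n m (r + 1 + 1) s (p + 1) q) := by
  intro x hx
  have hU := isOpen_admissible n m (r + 1 + 1) s (p + 1) q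
  have hsm := hL.smooth
  have hsα := contDiffOn_eCov (b := b) hsm i α
  have h1 := contDiffOn_sigmaFun hsα
  have h2 := contDiffOn_eCov (b := b) hL.sigma_spec.1.smooth i α
  rw [(hL.eCov hα).sigma_eqOn hx, ← sub_eq_zero]
  refine eq_zero_of_mul_eval (F := MixedForms.sigmaFun (MixedForms.eCov b i α L) -
    MixedForms.eCov b i α (sigma L)) hU (h1.sub h2) hx i fun N Z hZ θ hθ => ?_
  have hZ' : Z.body ∈ admissible n m (r + 1 + 1) s (p + 1) q := by rwa [hZ]
  have hZ₁ := admissible_dropRow.mpr hZ'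
  rw [eval_sub hU h1 h2 hZ', mul_sub, eval_sigmaFun hsα hZ', mul_borderedAt_eCov hsm hα hZ₁ _ hθ,
    mul_eval_eCov hL.sigma_spec.1.smooth hα hZ' hθ,
    dEval_congr (isOpen_admissible n m (r + 1) s (p + 1) q) hL.sigma_eqOn hZ₁,
    dEval_sigmaFun hsm hZ₁, pow_succ, mul_neg_one, neg_smul, sub_neg_eq_add, ← smul_add,
    hL.isPreForm.borderedDeriv_swap (admissible_dropRow.mpr hZ₁), smul_zero]

/-! ### Homogeneous vectors and covectors -/

variable {𝒱 : ZMod 2 → Submodule ℝ V}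

/-- The components of a homogeneous vector vanish at the basis vectors of the other parity. -/
theorem repr_eq_zero_of_mem (h𝒱 : DirectSum.IsInternal 𝒱) (hb : ∀ A, b A ∈ 𝒱 (par A)) {u : V}
    (hu : u ∈ 𝒱 i) (A : Idx n m) (hA : par A ≠ i) : b.repr u A = 0 := by
  -- the part of `u` of parity `i + 1` vanishes and is a combination of basis vectors
  have hsplit : u = ∑ A, (if par A = i then b.repr u A else 0) • b A +
      ∑ A, (if par A = i then 0 else b.repr u A) • b A := by
    conv_lhs => rw [← b.sum_repr u]
    rw [← Finset.sum_add_distrib]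
    refine Finset.sum_congr rfl fun A _ => ?_
    split_ifs <;> simp
  have hd : ∀ a i : ZMod 2, a ≠ i → a = i + 1 := by decide
  have h1 : ∑ A, (if par A = i then b.repr u A else 0) • b A ∈ 𝒱 i :=
    Submodule.sum_mem _ fun A _ => by
      split_ifs with h
      · exact Submodule.smul_mem _ _ (h ▸ hb A)
      · rw [zero_smul]; exact Submodule.zero_mem _
  have h2 : ∑ A, (if par A = i then 0 else b.repr u A) • b A ∈ 𝒱 (i + 1) :=
    Submodule.sum_mem _ fun A _ => by
      split_ifs with h
      · rw [zero_smul]; exact Submodule.zero_mem _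
      · exact Submodule.smul_mem _ _ (hd _ _ h ▸ hb A)
  have h3 : ∑ A, (if par A = i then 0 else b.repr u A) • b A ∈ 𝒱 i := by
    rw [show ∑ A, (if par A = i then 0 else b.repr u A) • b A =
      u - ∑ A, (if par A = i then b.repr u A else 0) • b A from eq_sub_of_add_eq' hsplit.symm]
    exact Submodule.sub_mem _ hu h1
  have hne : ∀ i : ZMod 2, i ≠ i + 1 := by decide
  have hdis := h𝒱.submodule_iSupIndep.pairwiseDisjoint (hne i)
  have h4 := Submodule.disjoint_def.mp hdis _ h3 h2
  have h5 := congrFun (congrArg DFunLike.coe (congrArg b.repr h4)) A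
  rw [b.repr_sum_self, map_zero, Finsupp.coe_zero, Pi.zero_apply, if_neg hA] at h5
  exact h5

theorem CovectorOfParity.mul_sgn_eq_zero {α : Module.Dual ℝ V} (hα : CovectorOfParity 𝒱 i α)
    (hb : ∀ A, b A ∈ 𝒱 (par A)) (A : Idx n m) (hA : par A ≠ i) :
    α (b A) * sgn (i * par A) = 0 := by
  rw [hα _ hA _ (hb A), zero_mul]

end

end MixedForms

end

theorem mainTheorem2 {n m : ℕ} {V : Type*} [AddCommGroup V] [Module ℝ V]
    (𝒱 : ZMod 2 → Submodule ℝ V) (h𝒱 : DirectSum.IsInternal 𝒱)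
    (b : Module.Basis (MixedForms.Idx n m) ℝ V) (hb : ∀ A, b A ∈ 𝒱 (MixedForms.par A))
    (r s p q : ℕ) (L : MixedForms.MixedFun n m r s p q)
    (hL : MixedForms.IsMixedForm n m r s p q L) :
    -- the operators act on mixed forms
    (∀ (i : ZMod 2), ∀ u ∈ 𝒱 i,
      MixedForms.IsMixedForm n m r s (p + 1) q (MixedForms.eVec b u L)) ∧
    (∀ (i : ZMod 2) (α : Module.Dual ℝ V), MixedForms.CovectorOfParity 𝒱 i α →
      MixedForms.IsMixedForm n m (r + 1) s p q (MixedForms.eCov b i α L)) ∧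
    -- `σ L` is the unique mixed form given by the formula for `σ`
    (MixedForms.IsMixedForm n m (r + 1) s (p + 1) q (MixedForms.sigma L) ∧
      MixedForms.SigmaFormula L (MixedForms.sigma L) ∧
      ∀ L', MixedForms.IsMixedForm n m (r + 1) s (p + 1) q L' → MixedForms.SigmaFormula L L' →
        Set.EqOn L' (MixedForms.sigma L) (MixedForms.admissible n m (r + 1) s (p + 1) q)) ∧
    -- `e(u) e(v) + (-1)^{uv} e(v) e(u) = 0`
    (∀ (i j : ZMod 2), ∀ u ∈ 𝒱 i, ∀ v ∈ 𝒱 j,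
      Set.EqOn
        (MixedForms.eVec b u (MixedForms.eVec b v L) +
          MixedForms.sgn (i * j) • MixedForms.eVec b v (MixedForms.eVec b u L))
        0 (MixedForms.admissible n m r s (p + 1 + 1) q)) ∧
    -- `e(α) e(β) + (-1)^{αβ} e(β) e(α) = 0`
    (∀ (i j : ZMod 2) (α β : Module.Dual ℝ V), MixedForms.CovectorOfParity 𝒱 i α →
      MixedForms.CovectorOfParity 𝒱 j β →
      Set.EqOn
        (MixedForms.eCov b i α (MixedForms.eCov b j β L) +
          MixedForms.sgn (i * j) • MixedForms.eCov b j β (MixedForms.eCov b i α L))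
        0 (MixedForms.admissible n m (r + 1 + 1) s p q)) ∧
    -- `e(u) e(α) + (-1)^{uα} e(α) e(u) = ⟨u, α⟩ σ`
    (∀ (i j : ZMod 2), ∀ u ∈ 𝒱 i, ∀ α : Module.Dual ℝ V, MixedForms.CovectorOfParity 𝒱 j α →
      Set.EqOn
        (MixedForms.eVec b u (MixedForms.eCov b j α L) +
          MixedForms.sgn (j * i) • MixedForms.eCov b j α (MixedForms.eVec b u L))
        (α u • MixedForms.sigma L) (MixedForms.admissible n m (r + 1) s (p + 1) q)) ∧
    -- `σ` is central
    (∀ (i : ZMod 2), ∀ u ∈ 𝒱 i,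
      Set.EqOn (MixedForms.sigma (MixedForms.eVec b u L))
        (MixedForms.eVec b u (MixedForms.sigma L))
        (MixedForms.admissible n m (r + 1) s (p + 1 + 1) q)) ∧
    (∀ (i : ZMod 2) (α : Module.Dual ℝ V), MixedForms.CovectorOfParity 𝒱 i α →
      Set.EqOn (MixedForms.sigma (MixedForms.eCov b i α L))
        (MixedForms.eCov b i α (MixedForms.sigma L))
        (MixedForms.admissible n m (r + 1 + 1) s (p + 1) q)) := by
  have hvec : ∀ {i : ZMod 2} {u : V}, u ∈ 𝒱 i → ∀ A, MixedForms.par A ≠ i → b.repr u A = 0 :=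
    fun hu => MixedForms.repr_eq_zero_of_mem h𝒱 hb hu
  refine ⟨fun i u hu => hL.eVec (hvec hu), fun i α hα => hL.eCov (hα.mul_sgn_eq_zero hb),
    ⟨hL.sigma_spec.1, hL.sigma_spec.2, fun L' hL' hσ => ?_⟩,
    fun i j u hu v hv => hL.eVec_eVec (hvec hu) (hvec hv),
    fun i j α β hα hβ => hL.eCov_eCov (hα.mul_sgn_eq_zero hb) (hβ.mul_sgn_eq_zero hb),
    fun i j u hu α hα => hL.eVec_eCov (hvec hu) (hα.mul_sgn_eq_zero hb),
    fun i u hu => hL.sigma_eVec (hvec hu), fun i α hα => hL.sigma_eCov (hα.mul_sgn_eq_zero hb)⟩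
  exact MixedForms.eqOn_of_sigmaFormula hL'.smooth hσ hL.sigma_spec.1.smooth
    hL.sigma_spec.2
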